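/- Let $\zeta(s)$ denote the Riemann zeta function and $\zeta'(s)$ its derivative. There is an absolute constant $T_0$ such that for every real number $k \ge 0$ there is a constant $c_k > 0$, depending only on $k$, such that for all real $T \ge T_0$, $$\int_1^T \left|\zeta'\left(\tfrac12+it\right)\right|^{2k}\,dt \;\ge\; c_k\, T(\log T)^{k^2+2k}$$ (with the convention $0^0=1$, so that the left-hand side is $T-1$ when $k=0$). -/

import Mathlib

namespace ZetaMoments

open Finset Polynomial
open scoped ArithmeticFunction

/-! The proof compares ζ' with Dirichlet polynomials that imitate powers of zeta, and carries the
comparison slightly to the right of the critical line by convexity of mean values.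

The polynomials. Fix a Gaussian weight of width Δ and put L = θ log Δ with θ small. The prime powers
with log n ≤ L are cut into ranges L/4^(j+1) < log n ≤ L/4^j, and P_j is the sum of Λ(n)/log n ·
n^(-s) over the j-th range. Replacing exp(a P_j) by its Taylor polynomial of degree B·2^j and
multiplying over j gives N_a (`NK`), a polynomial of length exp(O(L)) which imitates ζ^a. Write X =
N_k and X₁ = N_(-1), and let Y (`rho`) be the part with log n ≤ L of (∑ log n · n^(-s)) X₁ X. Then
-ζ' X₁ X and Y differ only by terms with log n > L, so their difference is O(e^(-L)) on Re s = 4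
(`exists_norm_deriv_zeta_mul_add_le`).

The comparison. Take an integer v ≥ 3 with vk > 1 and p = 2/v, and put F = κ ζ' X^v X₁ and S = κ
X^(v-1) Y, where κ is a bounded rational function killing the pole at 1. Four facts are combined in
`moment_comparison`. (a) Hölder on Re s = 1/2 bounds the mean of |F|^p by a power of the 2k-th
moment of ζ' times a power of the mean of |X|^(vq)|X₁|^q with vq = 2 + q/k. Since |X|^(q/k)|X₁|^q is
morally 1, the latter is O(Δ L^(k²)) (`exists_majorant`). (b) The mean of |S|^p on Re s = 1/2 is
bounded through the mean squares of X and Y, of orders Δ L^(k²) and Δ L^(k²+2). (c) On Re s = 1/2 +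
A/L, orthogonality and a lower bound for ∑ x(n) y(n) n^(-2σ) (`exists_le_sum_NK`) show that the mean
of |XY| is at least of order A^(-(k²+1)) Δ L^(k²+1). Hölder turns this into a lower bound for the
mean of |S|^p whose dependence on A is a fixed power. (d) |H|^p is subharmonic, so its means on
vertical lines obey a maximum principle. Applied to F, and with an exponential weight to F + S, it
bounds the mean of |S|^p at 1/2 + A/L by exp(-A/(2v)) times its mean at 1/2, plus means of |F|^p,
plus negligible terms from Re s = 4. For A large the exponential gain in (d) beats the power loss in
(c), so the mean of |F|^p on the critical line is large, and by (a) so is the moment.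

Mean squares of coefficients rest on Cauchy–Schwarz and the fact that exp(∑ P_j) has coefficients at
most 1 (`expProd_le_one`, `nrm_prod_aeval_le`). Finally Δ = T/log T, the centre of the Gaussian is
averaged over [T/3, 2T/3], and bounded T are covered by the positivity of the integral over [1, 2],
so that the threshold 2 serves every k. -/

/-- Real arithmetic functions, with Dirichlet convolution as multiplication. -/
abbrev AF := ArithmeticFunction ℝ

/-! ### Dirichlet polynomials and their logarithmic length. -/

/-- `LogLen f N`: the support of `f` is contained in `{n : log n ≤ N}`. -/
def LogLen (f : AF) (N : ℝ) : Prop := ∀ n, f n ≠ 0 → Real.log n ≤ N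

/-- The value `∑ f n χ(n)` of a finitely supported arithmetic function at a character. -/
noncomputable def ev {R : Type*} [CommRing R] [Algebra ℝ R] (χ : ℕ →* R) (f : AF) : R :=
  ∑ᶠ n, f n • χ n

/-- The positive integers with `log n ≤ N`. -/
noncomputable def upTo (N : ℝ) : Finset ℕ := Icc 1 ⌊Real.exp N⌋₊

theorem mem_upTo {N : ℝ} {n : ℕ} : n ∈ upTo N ↔ n ≠ 0 ∧ Real.log n ≤ N := by
  unfold upTo
  rw [mem_Icc, Nat.one_le_iff_ne_zero]
  refine and_congr_right fun h => ?_
  rw [Nat.le_floor_iff (Real.exp_pos _).le, Real.log_le_iff_le_exp (by positivity)]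

theorem apply_ne_zero {f : AF} {n : ℕ} (h : f n ≠ 0) : n ≠ 0 := by
  rintro rfl; simp at h

theorem LogLen.support {f : AF} {N : ℝ} (h : LogLen f N) : Function.support f ⊆ upTo N :=
  fun n hn => mem_upTo.2 ⟨apply_ne_zero hn, h n hn⟩

theorem LogLen.mono {f : AF} {N M : ℝ} (h : LogLen f N) (hNM : N ≤ M) : LogLen f M :=
  fun n hn => (h n hn).trans hNM

theorem LogLen.one {N : ℝ} (hN : 0 ≤ N) : LogLen 1 N := by
  intro n hn
  rw [ArithmeticFunction.one_apply] at hn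
  split_ifs at hn with h
  · simpa [h] using hN
  · simp at hn

theorem smul_apply' (c : ℝ) (f : AF) (n : ℕ) : (c • f) n = c * f n := rfl

theorem LogLen.smul {f : AF} {N : ℝ} (hf : LogLen f N) (c : ℝ) : LogLen (c • f) N := by
  intro n hn
  rw [smul_apply'] at hn
  exact hf n (right_ne_zero_of_mul hn)

theorem sum_apply' {ι : Type*} (s : Finset ι) (f : ι → AF) (n : ℕ) :
    (∑ i ∈ s, f i) n = ∑ i ∈ s, f i n := by
  classical
  induction s using Finset.induction_on with
  | empty => simp
  | insert a s ha ih => rw [sum_insert ha, sum_insert ha, ArithmeticFunction.add_apply, ih]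

theorem LogLen.sum {ι : Type*} {s : Finset ι} {f : ι → AF} {N : ℝ}
    (h : ∀ i ∈ s, LogLen (f i) N) : LogLen (∑ i ∈ s, f i) N := by
  intro n hn
  rw [sum_apply'] at hn
  obtain ⟨i, hi, h'⟩ := exists_ne_zero_of_sum_ne_zero hn
  exact h i hi n h'

theorem LogLen.mul {f g : AF} {N M : ℝ} (hf : LogLen f N) (hg : LogLen g M) :
    LogLen (f * g) (N + M) := by
  intro n hn
  rw [ArithmeticFunction.mul_apply] at hn
  obtain ⟨⟨d, e⟩, hi, h⟩ := exists_ne_zero_of_sum_ne_zero hn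
  rw [Nat.mem_divisorsAntidiagonal] at hi
  have hd := left_ne_zero_of_mul h
  have he := right_ne_zero_of_mul h
  have hd0 := apply_ne_zero hd
  have he0 := apply_ne_zero he
  simp only at hi hd he hd0 he0
  rw [← hi.1, Nat.cast_mul, Real.log_mul (by positivity) (by positivity)]
  exact add_le_add (hf d hd) (hg e he)

theorem LogLen.pow {f : AF} {N : ℝ} (hf : LogLen f N) (r : ℕ) : LogLen (f ^ r) (r * N) := by
  induction r with
  | zero => simpa using LogLen.one le_rfl
  | succ r ih =>
    rw [pow_succ]; push_cast; rw [add_mul, one_mul]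
    exact ih.mul hf

theorem LogLen.prod {ι : Type*} {s : Finset ι} {f : ι → AF} {N : ι → ℝ}
    (h : ∀ i ∈ s, LogLen (f i) (N i)) : LogLen (∏ i ∈ s, f i) (∑ i ∈ s, N i) := by
  classical
  induction s using Finset.induction_on with
  | empty => simpa using LogLen.one le_rfl
  | insert a s ha ih =>
    rw [prod_insert ha, sum_insert ha]
    exact (h a (mem_insert_self _ _)).mul (ih fun i hi => h i (mem_insert_of_mem hi))

theorem LogLen.aeval {f : AF} {N : ℝ} (hN : 0 ≤ N) (hf : LogLen f N) {q : ℝ[X]} {d : ℕ}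
    (hq : q.natDegree ≤ d) : LogLen (Polynomial.aeval f q) (d * N) := by
  rw [Polynomial.aeval_eq_sum_range]
  refine LogLen.sum fun r hr => ((hf.pow r).smul _).mono ?_
  have : (r : ℝ) ≤ d := by
    have := mem_range.1 hr
    exact_mod_cast (by omega : r ≤ d)
  gcongr

/-! ### Evaluation at a completely multiplicative character is a ring homomorphism on finite
supports. -/

section Ev

variable {R : Type*} [CommRing R] [Algebra ℝ R] (χ : ℕ →* R)

theorem ev_eq_sum {f : AF} {s : Finset ℕ} (h : Function.support f ⊆ s) :
    ev χ f = ∑ n ∈ s, f n • χ n :=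
  finsum_eq_sum_of_support_subset _ fun n hn => h fun h0 => hn (by simp [h0])

theorem ev_eq_sum' {f : AF} {N : ℝ} (h : LogLen f N) :
    ev χ f = ∑ n ∈ upTo N, f n • χ n := ev_eq_sum χ h.support

theorem ev_one : ev χ 1 = 1 := by
  rw [ev_eq_sum χ (s := {1})]
  · simp
  · intro n hn
    by_contra h
    exact hn (ArithmeticFunction.one_apply_ne (by simpa using h))

theorem ev_smul {f : AF} {N : ℝ} (hf : LogLen f N) (c : ℝ) : ev χ (c • f) = c • ev χ f := by
  rw [ev_eq_sum' χ hf, ev_eq_sum' χ (hf.smul c), smul_sum]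
  exact sum_congr rfl fun n _ => by rw [smul_apply', mul_smul]

theorem ev_sum {ι : Type*} {s : Finset ι} {f : ι → AF} {N : ℝ} (h : ∀ i ∈ s, LogLen (f i) N) :
    ev χ (∑ i ∈ s, f i) = ∑ i ∈ s, ev χ (f i) := by
  rw [ev_eq_sum' χ (LogLen.sum h)]
  simp_rw [sum_apply', sum_smul]
  rw [sum_comm]
  exact sum_congr rfl fun i hi => (ev_eq_sum' χ (h i hi)).symm

theorem ev_mul {f g : AF} {N M : ℝ} (hf : LogLen f N) (hg : LogLen g M) :
    ev χ (f * g) = ev χ f * ev χ g := by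
  rw [ev_eq_sum' χ hf, ev_eq_sum' χ hg, ev_eq_sum' χ (hf.mul hg), sum_mul_sum, ← sum_product',
    ← sum_fiberwise_of_maps_to (t := upTo (N + M)) (g := fun x : ℕ × ℕ => x.1 * x.2)]
  · refine sum_congr rfl fun n hn => ?_
    rw [ArithmeticFunction.mul_apply, sum_smul]
    symm
    have hn0 := (mem_upTo.1 hn).1
    refine (sum_subset ?_ ?_).trans (sum_congr rfl ?_)
    · intro x hx
      rw [mem_filter] at hx
      exact Nat.mem_divisorsAntidiagonal.2 ⟨hx.2, hn0⟩
    · rintro ⟨d, e⟩ hx hx'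
      rw [Nat.mem_divisorsAntidiagonal] at hx
      by_contra h
      have h1 : f d ≠ 0 := fun h1 => h (by simp [h1])
      have h2 : g e ≠ 0 := fun h2 => h (by simp [h2])
      exact hx' (mem_filter.2 ⟨mem_product.2 ⟨hf.support h1, hg.support h2⟩, hx.1⟩)
    · rintro ⟨d, e⟩ hx
      rw [Nat.mem_divisorsAntidiagonal] at hx
      rw [← hx.1, map_mul, smul_mul_smul_comm]
  · rintro ⟨d, e⟩ hx
    rw [mem_product] at hx
    obtain ⟨h1, h2⟩ := hx
    rw [mem_upTo] at h1 h2 ⊢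
    refine ⟨mul_ne_zero h1.1 h2.1, ?_⟩
    have := h1.1
    have := h2.1
    simp only at *
    rw [Nat.cast_mul, Real.log_mul (by positivity) (by positivity)]
    exact add_le_add h1.2 h2.2

theorem ev_pow {f : AF} {N : ℝ} (hf : LogLen f N) (r : ℕ) : ev χ (f ^ r) = ev χ f ^ r := by
  induction r with
  | zero => simp [ev_one]
  | succ r ih => rw [pow_succ, ev_mul χ (hf.pow r) hf, ih, pow_succ]

theorem ev_prod {ι : Type*} {s : Finset ι} {f : ι → AF} {N : ι → ℝ}
    (h : ∀ i ∈ s, LogLen (f i) (N i)) : ev χ (∏ i ∈ s, f i) = ∏ i ∈ s, ev χ (f i) := by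
  classical
  induction s using Finset.induction_on with
  | empty => simp [ev_one]
  | insert a s ha ih =>
    have h' : ∀ i ∈ s, LogLen (f i) (N i) := fun i hi => h i (mem_insert_of_mem hi)
    rw [prod_insert ha, prod_insert ha, ev_mul χ (h a (mem_insert_self _ _)) (LogLen.prod h'), ih h']

theorem ev_aeval {f : AF} {N : ℝ} (hN : 0 ≤ N) (hf : LogLen f N) (q : ℝ[X]) :
    ev χ (Polynomial.aeval f q) = Polynomial.aeval (ev χ f) q := by
  rw [Polynomial.aeval_eq_sum_range, Polynomial.aeval_eq_sum_range,
    ev_sum χ (N := q.natDegree * N)]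
  · exact sum_congr rfl fun r _ => by rw [ev_smul χ (hf.pow r), ev_pow χ hf]
  · intro r hr
    refine ((hf.pow r).smul _).mono ?_
    have : (r : ℝ) ≤ q.natDegree := by
      have := mem_range.1 hr
      exact_mod_cast (by omega : r ≤ q.natDegree)
    gcongr

end Ev

/-! ### The characters n^(-s). -/

/-- `n ↦ n ^ (-σ)` as a real character. -/
noncomputable def rchar (σ : ℝ) : ℕ →* ℝ where
  toFun n := (n : ℝ) ^ (-σ)
  map_one' := by simp
  map_mul' m n := by rw [Nat.cast_mul, Real.mul_rpow (by positivity) (by positivity)]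

/-- `n ↦ n ^ (-s)` as a complex character. -/
noncomputable def cchar (s : ℂ) : ℕ →* ℂ where
  toFun n := (n : ℂ) ^ (-s)
  map_one' := by simp
  map_mul' m n := by rw [Nat.cast_mul, Complex.natCast_mul_natCast_cpow]

theorem rchar_apply (σ : ℝ) (n : ℕ) : rchar σ n = (n : ℝ) ^ (-σ) := rfl
theorem cchar_apply (s : ℂ) (n : ℕ) : cchar s n = (n : ℂ) ^ (-s) := rfl

theorem norm_cchar (s : ℂ) {n : ℕ} (hn : n ≠ 0) : ‖cchar s n‖ = rchar s.re n := by
  rw [cchar_apply, rchar_apply, Complex.norm_natCast_cpow_of_pos (Nat.pos_of_ne_zero hn)]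
  simp

theorem norm_ev_le {f : AF} {N : ℝ} (hf : LogLen f N) {g : AF} (hg : LogLen g N)
    (h : ∀ n, |f n| ≤ g n) (s : ℂ) : ‖ev (cchar s) f‖ ≤ ev (rchar s.re) g := by
  rw [ev_eq_sum' _ hf, ev_eq_sum' _ hg]
  refine (norm_sum_le _ _).trans (sum_le_sum fun n hn => ?_)
  rw [norm_smul, norm_cchar _ (mem_upTo.1 hn).1, Real.norm_eq_abs, smul_eq_mul]
  gcongr
  · rw [rchar_apply]; positivity
  · exact h n

theorem ev_rchar_nonneg {f : AF} (h : ∀ n, 0 ≤ f n) (σ : ℝ) : 0 ≤ ev (rchar σ) f :=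
  finsum_nonneg fun n => mul_nonneg (h n) (by rw [rchar_apply]; positivity)

theorem ev_rchar_mono {f g : AF} {N : ℝ} (hf : LogLen f N) (hg : LogLen g N)
    (h : ∀ n, f n ≤ g n) (σ : ℝ) : ev (rchar σ) f ≤ ev (rchar σ) g := by
  rw [ev_eq_sum' _ hf, ev_eq_sum' _ hg]
  refine sum_le_sum fun n hn => ?_
  rw [smul_eq_mul, smul_eq_mul]
  gcongr
  · rw [rchar_apply]; positivity
  · exact h n

theorem rchar_anti {σ τ : ℝ} (h : σ ≤ τ) (n : ℕ) (hn : n ≠ 0) : rchar τ n ≤ rchar σ n := by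
  rw [rchar_apply, rchar_apply]
  exact Real.rpow_le_rpow_of_exponent_le (by exact_mod_cast Nat.one_le_iff_ne_zero.2 hn)
    (by linarith)

/-! ### Nonnegativity and coefficientwise comparison -/

theorem mul_nonneg' {f g : AF} (hf : ∀ n, 0 ≤ f n) (hg : ∀ n, 0 ≤ g n) (n : ℕ) :
    0 ≤ (f * g) n := by
  rw [ArithmeticFunction.mul_apply]
  exact sum_nonneg fun x _ => mul_nonneg (hf _) (hg _)

theorem one_nonneg' (n : ℕ) : 0 ≤ (1 : AF) n := by
  rw [ArithmeticFunction.one_apply]; split_ifs <;> norm_num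

theorem pow_nonneg' {f : AF} (hf : ∀ n, 0 ≤ f n) (r : ℕ) (n : ℕ) : 0 ≤ (f ^ r) n := by
  induction r generalizing n with
  | zero => simpa using one_nonneg' n
  | succ r ih => rw [pow_succ]; exact mul_nonneg' ih hf n

theorem prod_nonneg' {ι : Type*} {s : Finset ι} {f : ι → AF} (h : ∀ i ∈ s, ∀ n, 0 ≤ f i n) :
    ∀ n, 0 ≤ (∏ i ∈ s, f i) n := by
  classical
  induction s using Finset.induction_on with
  | empty => simpa using one_nonneg'
  | insert a s ha ih =>
    rw [prod_insert ha]
    exact mul_nonneg' (h a (mem_insert_self _ _)) (ih fun i hi => h i (mem_insert_of_mem hi))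

theorem aeval_apply {f : AF} (q : ℝ[X]) (n : ℕ) :
    (Polynomial.aeval f q) n = ∑ r ∈ range (q.natDegree + 1), q.coeff r * (f ^ r) n := by
  rw [Polynomial.aeval_eq_sum_range, sum_apply']
  rfl

theorem aeval_apply' {f : AF} (q : ℝ[X]) {d : ℕ} (hd : q.natDegree ≤ d) (n : ℕ) :
    (Polynomial.aeval f q) n = ∑ r ∈ range (d + 1), q.coeff r * (f ^ r) n := by
  rw [aeval_apply]
  refine sum_subset (range_mono (by omega)) fun r _ hr => ?_
  rw [coeff_eq_zero_of_natDegree_lt (by simpa using hr), zero_mul]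

theorem aeval_nonneg {f : AF} (hf : ∀ n, 0 ≤ f n) {q : ℝ[X]} (hq : ∀ r, 0 ≤ q.coeff r) (n : ℕ) :
    0 ≤ (Polynomial.aeval f q) n := by
  rw [aeval_apply]
  exact sum_nonneg fun r _ => mul_nonneg (hq r) (pow_nonneg' hf r n)

/-- Monotonicity of Dirichlet convolution on `n ≤ Y`. -/
theorem mul_le_mul_upTo {f f' g g' : AF} {N : ℕ} (hf : ∀ n ≤ N, 0 ≤ f n ∧ f n ≤ f' n)
    (hg : ∀ n ≤ N, 0 ≤ g n ∧ g n ≤ g' n) :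
    ∀ n ≤ N, 0 ≤ (f * g) n ∧ (f * g) n ≤ (f' * g') n := by
  intro n hn
  simp only [ArithmeticFunction.mul_apply]
  have key : ∀ x ∈ n.divisorsAntidiagonal, x.1 ≤ N ∧ x.2 ≤ N := by
    rintro ⟨d, e⟩ hx
    exact ⟨(Nat.divisor_le (Nat.fst_mem_divisors_of_mem_antidiagonal hx)).trans hn,
      (Nat.divisor_le (Nat.snd_mem_divisors_of_mem_antidiagonal hx)).trans hn⟩
  refine ⟨sum_nonneg fun x hx => ?_, sum_le_sum fun x hx => ?_⟩
  · exact mul_nonneg (hf _ (key x hx).1).1 (hg _ (key x hx).2).1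
  · exact mul_le_mul (hf _ (key x hx).1).2 (hg _ (key x hx).2).2 (hg _ (key x hx).2).1
      ((hf _ (key x hx).1).1.trans (hf _ (key x hx).1).2)

theorem prod_le_prod_upTo {ι : Type*} {s : Finset ι} {f g : ι → AF} {N : ℕ}
    (h : ∀ i ∈ s, ∀ n ≤ N, 0 ≤ f i n ∧ f i n ≤ g i n) :
    ∀ n ≤ N, 0 ≤ (∏ i ∈ s, f i) n ∧ (∏ i ∈ s, f i) n ≤ (∏ i ∈ s, g i) n := by
  classical
  induction s using Finset.induction_on with
  | empty => exact fun n _ => ⟨by simpa using one_nonneg' n, le_rfl⟩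
  | insert a s ha ih =>
    rw [prod_insert ha, prod_insert ha]
    exact mul_le_mul_upTo (h a (mem_insert_self _ _)) (ih fun i hi => h i (mem_insert_of_mem hi))

theorem abs_mul_le {f f' g g' : AF} (hf : ∀ n, |f n| ≤ f' n) (hg : ∀ n, |g n| ≤ g' n) (n : ℕ) :
    |(f * g) n| ≤ (f' * g') n := by
  simp only [ArithmeticFunction.mul_apply]
  refine (abs_sum_le_sum_abs _ _).trans (sum_le_sum fun x _ => ?_)
  rw [abs_mul]
  exact mul_le_mul (hf _) (hg _) (abs_nonneg _) ((abs_nonneg _).trans (hf _))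

theorem abs_prod_le {ι : Type*} {s : Finset ι} {f g : ι → AF} (h : ∀ i ∈ s, ∀ n, |f i n| ≤ g i n) :
    ∀ n, |(∏ i ∈ s, f i) n| ≤ (∏ i ∈ s, g i) n := by
  classical
  induction s using Finset.induction_on with
  | empty => intro n; simp only [prod_empty]; rw [abs_of_nonneg (one_nonneg' n)]
  | insert a s ha ih =>
    rw [prod_insert ha, prod_insert ha]
    exact abs_mul_le (h a (mem_insert_self _ _)) (ih fun i hi => h i (mem_insert_of_mem hi))

theorem abs_aeval_le {f : AF} (hf : ∀ n, 0 ≤ f n) {q q' : ℝ[X]} (h : ∀ r, |q.coeff r| ≤ q'.coeff r)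
    (n : ℕ) : |(Polynomial.aeval f q) n| ≤ (Polynomial.aeval f q') n := by
  rw [aeval_apply' q (le_max_left _ q'.natDegree), aeval_apply' q' (le_max_right q.natDegree _)]
  refine (abs_sum_le_sum_abs _ _).trans (sum_le_sum fun r _ => ?_)
  rw [abs_mul, abs_of_nonneg (pow_nonneg' hf r n)]
  exact mul_le_mul_of_nonneg_right (h r) (pow_nonneg' hf r n)

/-! ### Truncated exponentials -/

/-- The Taylor polynomial of degree `ℓ` of `exp (a X)`. -/
noncomputable def texp (ℓ : ℕ) (a : ℝ) : ℝ[X] :=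
  ∑ r ∈ range (ℓ + 1), monomial r (a ^ r / r.factorial)

theorem coeff_texp (ℓ : ℕ) (a : ℝ) (r : ℕ) :
    (texp ℓ a).coeff r = if r ≤ ℓ then a ^ r / r.factorial else 0 := by
  unfold texp
  rw [finsetSum_coeff]
  simp only [coeff_monomial, sum_ite_eq', mem_range, Nat.lt_succ_iff]

theorem natDegree_texp_le (ℓ : ℕ) (a : ℝ) : (texp ℓ a).natDegree ≤ ℓ := by
  rw [natDegree_le_iff_coeff_eq_zero]
  intro r hr
  rw [coeff_texp, if_neg (by omega)]

theorem coeff_texp_nonneg (ℓ : ℕ) {a : ℝ} (ha : 0 ≤ a) (r : ℕ) : 0 ≤ (texp ℓ a).coeff r := by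
  rw [coeff_texp]; split_ifs <;> positivity

/-- Coefficients bounded by those of `exp (A X)`. -/
def ExpBdd (q : ℝ[X]) (A : ℝ) : Prop := ∀ r, |q.coeff r| ≤ A ^ r / r.factorial

theorem expBdd_texp (ℓ : ℕ) {a A : ℝ} (h : |a| ≤ A) : ExpBdd (texp ℓ a) A := by
  intro r
  have hA : 0 ≤ A := (abs_nonneg a).trans h
  rw [coeff_texp]
  split_ifs
  · rw [abs_div, abs_pow, Nat.abs_cast]; gcongr
  · rw [abs_zero]; positivity

/-- The binomial theorem in divided-power form, that is exp(AX) exp(BX) = exp((A+B)X). It makes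
`ExpBdd` additive in the exponent under products. -/
theorem sum_antidiagonal_exp (A B : ℝ) (r : ℕ) :
    ∑ x ∈ antidiagonal r, A ^ x.1 / x.1.factorial * (B ^ x.2 / x.2.factorial) =
      (A + B) ^ r / r.factorial := by
  rw [add_pow, ← Nat.sum_antidiagonal_eq_sum_range_succ_mk
    (f := fun x : ℕ × ℕ => A ^ x.1 * B ^ x.2 * (r.choose x.1 : ℝ)), sum_div]
  refine sum_congr rfl fun x hx => ?_
  rw [HasAntidiagonal.mem_antidiagonal] at hx
  subst hx
  have h := Nat.choose_mul_factorial_mul_factorial (Nat.le_add_right x.1 x.2)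
  rw [Nat.add_sub_cancel_left] at h
  have h' : ((x.1 + x.2).choose x.1 : ℝ) * x.1.factorial * x.2.factorial =
    (x.1 + x.2).factorial := by exact_mod_cast h
  have h1 : (x.1.factorial : ℝ) ≠ 0 := by positivity
  have h2 : (x.2.factorial : ℝ) ≠ 0 := by positivity
  have h3 : ((x.1 + x.2).factorial : ℝ) ≠ 0 := by positivity
  rw [div_mul_div_comm, div_eq_div_iff (by positivity) h3, ← h']
  ring

theorem ExpBdd.mul {p q : ℝ[X]} {A B : ℝ} (hp : ExpBdd p A) (hq : ExpBdd q B) :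
    ExpBdd (p * q) (A + B) := by
  intro r
  rw [coeff_mul, ← sum_antidiagonal_exp]
  refine (abs_sum_le_sum_abs _ _).trans (sum_le_sum fun x _ => ?_)
  rw [abs_mul]
  exact mul_le_mul (hp _) (hq _) (abs_nonneg _) ((abs_nonneg _).trans (hp _))

theorem sum_exp_le {x : ℝ} (hx : 0 ≤ x) (s : Finset ℕ) :
    ∑ r ∈ s, x ^ r / r.factorial ≤ Real.exp x := by
  refine (sum_le_sum_of_subset_of_nonneg (t := range (s.sup id + 1)) ?_ ?_).trans
    (Real.sum_le_exp_of_nonneg hx _)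
  · intro r hr
    rw [mem_range, Nat.lt_succ_iff]
    exact le_sup (f := id) hr
  · intros; positivity

/-! ### The weighted norm of a polynomial in a nonnegative arithmetic function -/

/-- The squared norm `∑ r! |q_r|² V^r`. -/
noncomputable def fock (q : ℝ[X]) (V : ℝ) : ℝ :=
  ∑ r ∈ range (q.natDegree + 1), r.factorial * q.coeff r ^ 2 * V ^ r

/-- The polynomial `∑ r! q_r² X^r`. -/
noncomputable def fockPoly (q : ℝ[X]) : ℝ[X] :=
  ∑ r ∈ range (q.natDegree + 1), monomial r (r.factorial * q.coeff r ^ 2)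

theorem coeff_fockPoly (q : ℝ[X]) (r : ℕ) :
    (fockPoly q).coeff r = r.factorial * q.coeff r ^ 2 := by
  unfold fockPoly
  rw [finsetSum_coeff]
  simp only [coeff_monomial, sum_ite_eq', mem_range, Nat.lt_succ_iff]
  split_ifs with h
  · rfl
  · rw [coeff_eq_zero_of_natDegree_lt (by omega)]; simp

theorem natDegree_fockPoly_le (q : ℝ[X]) : (fockPoly q).natDegree ≤ q.natDegree := by
  rw [natDegree_le_iff_coeff_eq_zero]
  intro r hr
  rw [coeff_fockPoly, coeff_eq_zero_of_natDegree_lt hr]; simp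

theorem aeval_fockPoly (q : ℝ[X]) (V : ℝ) : aeval V (fockPoly q) = fock q V := by
  unfold fockPoly fock
  rw [map_sum]
  exact sum_congr rfl fun r _ => by rw [aeval_monomial]; rfl

theorem fock_eq {q : ℝ[X]} {d : ℕ} (hd : q.natDegree ≤ d) (V : ℝ) :
    fock q V = ∑ r ∈ range (d + 1), r.factorial * q.coeff r ^ 2 * V ^ r := by
  unfold fock
  refine sum_subset (range_mono (by omega)) fun r _ hr => ?_
  rw [coeff_eq_zero_of_natDegree_lt (by simpa using hr)]; simp

theorem fock_nonneg (q : ℝ[X]) {V : ℝ} (hV : 0 ≤ V) : 0 ≤ fock q V :=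
  sum_nonneg fun r _ => by positivity

/-- Since r! (a^r/r!)² V^r = (a²V)^r/r!, the norm is a partial sum of the series of exp(a²V). -/
theorem fock_texp_le (ℓ : ℕ) (a : ℝ) {V : ℝ} (hV : 0 ≤ V) :
    fock (texp ℓ a) V ≤ Real.exp (a ^ 2 * V) := by
  rw [fock_eq (natDegree_texp_le ℓ a)]
  refine le_trans (le_of_eq ?_) (sum_exp_le (by positivity) (range (ℓ + 1)))
  refine sum_congr rfl fun r hr => ?_
  rw [coeff_texp, if_pos (by simpa [Nat.lt_succ_iff] using hr)]
  have : (r.factorial : ℝ) ≠ 0 := by positivity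
  field_simp
  rw [mul_pow]; ring

theorem fock_smul (c : ℝ) (q : ℝ[X]) (V : ℝ) : fock (C c * q) V = c ^ 2 * fock q V := by
  rw [fock_eq (natDegree_C_mul_le c q), fock, mul_sum]
  refine sum_congr rfl fun r _ => ?_
  rw [coeff_C_mul]; ring

theorem fock_monomial (m : ℕ) (c V : ℝ) :
    fock (monomial m c) V = m.factorial * c ^ 2 * V ^ m := by
  rw [fock_eq (natDegree_monomial_le c), sum_eq_single m]
  · simp
  · intro r _ hr
    rw [coeff_monomial, if_neg (Ne.symm hr)]; simp
  · intro h; simp at h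

/-- A polynomial agreeing with `exp (k X)` up to degree `ℓ` and dominated by `exp (A X)`. -/
theorem fock_le_of_expBdd {q : ℝ[X]} {ℓ : ℕ} {k A V : ℝ} (hV : 0 ≤ V)
    (hq : ExpBdd q A) (hk : ∀ r ≤ ℓ, q.coeff r = k ^ r / r.factorial) :
    fock q V ≤ Real.exp (k ^ 2 * V) + (1 / 2) ^ ℓ * Real.exp (2 * A ^ 2 * V) := by
  rw [fock_eq (le_max_left _ ℓ)]
  set d := max q.natDegree ℓ
  have key : ∀ r ∈ range (d + 1), (r.factorial : ℝ) * q.coeff r ^ 2 * V ^ r ≤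
      (k ^ 2 * V) ^ r / r.factorial + (1 / 2) ^ ℓ * ((2 * A ^ 2 * V) ^ r / r.factorial) := by
    intro r _
    have hf : (0 : ℝ) < r.factorial := by positivity
    by_cases hr : r ≤ ℓ
    · rw [hk r hr]
      have : (r.factorial : ℝ) * (k ^ r / r.factorial) ^ 2 * V ^ r =
        (k ^ 2 * V) ^ r / r.factorial := by
        field_simp; rw [mul_pow]; ring
      rw [this]
      have : 0 ≤ (1 / 2 : ℝ) ^ ℓ * ((2 * A ^ 2 * V) ^ r / r.factorial) := by positivity
      linarith
    -- Beyond degree ℓ only the domination by exp(AX) is known. Writing (A²V)^r = 2^(-r) (2A²V)^r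
    -- buys the small factor 2^(-ℓ) at the price of doubling the exponent.
    · have h1 : q.coeff r ^ 2 ≤ (A ^ r / r.factorial) ^ 2 := sq_le_sq' (by
        have := neg_abs_le (q.coeff r); have := hq r; linarith) ((le_abs_self _).trans (hq r))
      have h2 : (r.factorial : ℝ) * q.coeff r ^ 2 * V ^ r ≤
          r.factorial * (A ^ r / r.factorial) ^ 2 * V ^ r := by gcongr
      have h3 : (r.factorial : ℝ) * (A ^ r / r.factorial) ^ 2 * V ^ r =
          (1 / 2) ^ r * ((2 * A ^ 2 * V) ^ r / r.factorial) := by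
        have : (1 / 2 : ℝ) ^ r * 2 ^ r = 1 := by rw [← mul_pow]; norm_num
        field_simp
        rw [show (2 * A ^ 2 * V) ^ r = 2 ^ r * (A ^ r) ^ 2 * V ^ r by rw [mul_pow, mul_pow]; ring]
        linear_combination (-(A ^ r) ^ 2 * V ^ r) * this
      have h4 : (1 / 2 : ℝ) ^ r ≤ (1 / 2) ^ ℓ :=
        pow_le_pow_of_le_one (by norm_num) (by norm_num) (by omega)
      have h5 : 0 ≤ (k ^ 2 * V) ^ r / r.factorial := by positivity
      have h6 : (1 / 2 : ℝ) ^ r * ((2 * A ^ 2 * V) ^ r / r.factorial) ≤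
        (1 / 2) ^ ℓ * ((2 * A ^ 2 * V) ^ r / r.factorial) := by gcongr
      linarith
  refine (sum_le_sum key).trans ?_
  rw [sum_add_distrib, ← mul_sum]
  gcongr
  · exact sum_exp_le (by positivity) _
  · exact sum_exp_le (by positivity) _

/-! ### Pointwise Cauchy–Schwarz for coefficients. -/

/-- `f² ≤ u a` pointwise with `u, a ≥ 0`. -/
def SqDom (f u a : AF) : Prop := ∀ n, 0 ≤ u n ∧ 0 ≤ a n ∧ f n ^ 2 ≤ u n * a n

/-- Cauchy–Schwarz over the factorisations of n. This is what allows the ranges to be treated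
separately. -/
theorem SqDom.mul {f u a g w b : AF} (h : SqDom f u a) (h' : SqDom g w b) :
    SqDom (f * g) (u * w) (a * b) := by
  intro n
  refine ⟨mul_nonneg' (fun n => (h n).1) (fun n => (h' n).1) n,
    mul_nonneg' (fun n => (h n).2.1) (fun n => (h' n).2.1) n, ?_⟩
  simp only [ArithmeticFunction.mul_apply]
  refine sum_sq_le_sum_mul_sum_of_sq_le_mul _ (fun x _ => mul_nonneg (h _).1 (h' _).1)
    (fun x _ => mul_nonneg (h _).2.1 (h' _).2.1) fun x _ => ?_
  rw [mul_pow]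
  calc _ ≤ (u x.1 * a x.1) * (w x.2 * b x.2) :=
        mul_le_mul (h _).2.2 (h' _).2.2 (sq_nonneg _) (mul_nonneg (h _).1 (h _).2.1)
    _ = _ := by ring

theorem SqDom.one : SqDom 1 1 1 := by
  intro n
  refine ⟨one_nonneg' n, one_nonneg' n, ?_⟩
  rw [sq]

theorem SqDom.prod {ι : Type*} {s : Finset ι} {f u a : ι → AF}
    (h : ∀ i ∈ s, SqDom (f i) (u i) (a i)) :
    SqDom (∏ i ∈ s, f i) (∏ i ∈ s, u i) (∏ i ∈ s, a i) := by
  classical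
  induction s using Finset.induction_on with
  | empty => simpa using SqDom.one
  | insert b s hb ih =>
    simp only [prod_insert hb]
    exact (h b (mem_insert_self _ _)).mul (ih fun i hi => h i (mem_insert_of_mem hi))

theorem SqDom.self {f : AF} (hf : ∀ n, 0 ≤ f n) : SqDom f f f :=
  fun n => ⟨hf n, hf n, by rw [sq]⟩

/-- Cauchy–Schwarz after splitting each coefficient as (√r! q_r)(1/√r!): the second factor
reassembles into the truncated exponential of P, independent of q. -/
theorem sqDom_aeval {P : AF} (hP : ∀ n, 0 ≤ P n) {q : ℝ[X]} {M : ℕ} (hq : q.natDegree ≤ M) :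
    SqDom (aeval P q) (aeval P (fockPoly q)) (aeval P (texp M 1)) := by
  intro n
  refine ⟨aeval_nonneg hP (fun r => by rw [coeff_fockPoly]; positivity) n,
    aeval_nonneg hP (coeff_texp_nonneg M zero_le_one) n, ?_⟩
  rw [aeval_apply' q hq, aeval_apply' _ ((natDegree_fockPoly_le q).trans hq),
    aeval_apply' _ (natDegree_texp_le M 1)]
  refine sum_sq_le_sum_mul_sum_of_sq_le_mul _ (fun r _ => ?_) (fun r _ => ?_) fun r hr => ?_
  · rw [coeff_fockPoly]; exact mul_nonneg (by positivity) (pow_nonneg' hP r n)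
  · exact mul_nonneg (coeff_texp_nonneg M zero_le_one r) (pow_nonneg' hP r n)
  · rw [coeff_fockPoly, coeff_texp, if_pos (by simpa [Nat.lt_succ_iff] using hr)]
    have : (r.factorial : ℝ) ≠ 0 := by positivity
    refine le_of_eq ?_
    field_simp
    ring

/-! ### Exponentials of prime power sums have coefficients at most one -/

/-- Multiplication by `log n`, a derivation for Dirichlet convolution. -/
noncomputable def logD (f : AF) : AF := ⟨fun n => Real.log n * f n, by simp⟩

theorem logD_apply (f : AF) (n : ℕ) : logD f n = Real.log n * f n := rfl

theorem logD_nonneg {f : AF} (hf : ∀ n, 0 ≤ f n) (n : ℕ) : 0 ≤ logD f n :=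
  mul_nonneg (Real.log_natCast_nonneg n) (hf n)

theorem logD_mul (f g : AF) : logD (f * g) = logD f * g + f * logD g := by
  ext n
  rw [ArithmeticFunction.add_apply, logD_apply]
  simp only [ArithmeticFunction.mul_apply, logD_apply]
  rw [mul_sum, ← sum_add_distrib]
  refine sum_congr rfl fun x hx => ?_
  rw [Nat.mem_divisorsAntidiagonal] at hx
  have h1 : x.1 ≠ 0 := left_ne_zero_of_mul (hx.1 ▸ hx.2)
  have h2 : x.2 ≠ 0 := right_ne_zero_of_mul (hx.1 ▸ hx.2)
  rw [← hx.1, Nat.cast_mul, Real.log_mul (by positivity) (by positivity)]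
  ring

theorem logD_one : logD 1 = 0 := by
  ext n
  rw [logD_apply, ArithmeticFunction.one_apply]
  split_ifs with h <;> simp [h]

theorem logD_add (f g : AF) : logD (f + g) = logD f + logD g := by
  ext n; simp [logD_apply, mul_add]

theorem logD_smul (c : ℝ) (f : AF) : logD (c • f) = c • logD f := by
  ext n; simp only [logD_apply, smul_apply']; ring

theorem logD_pow (f : AF) (r : ℕ) : logD (f ^ (r + 1)) = ((r : ℝ) + 1) • (f ^ r * logD f) := by
  induction r with
  | zero => simp
  | succ r ih =>
    rw [pow_succ, logD_mul, ih, smul_mul_assoc, mul_right_comm, ← pow_succ]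
    push_cast
    rw [add_smul ((r : ℝ) + 1) 1, one_smul]

theorem logD_aeval (f : AF) (q : ℝ[X]) : logD (aeval f q) = aeval f (derivative q) * logD f := by
  induction q using Polynomial.induction_on' with
  | add p q hp hq => rw [map_add, logD_add, hp, hq, derivative_add, map_add, add_mul]
  | monomial r c =>
    rw [derivative_monomial, aeval_monomial, aeval_monomial, ← Algebra.smul_def,
      ← Algebra.smul_def, logD_smul]
    cases r with
    | zero => simp [logD_one]
    | succ r =>
      rw [logD_pow, smul_smul, Nat.add_sub_cancel, smul_mul_assoc]
      push_cast
      rfl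

/-- `log · f ≤ lam * f` coefficientwise. -/
def LogSub (f lam : AF) : Prop := (∀ n, 0 ≤ f n) ∧ ∀ n, logD f n ≤ (lam * f) n

/-- `log · f ≥ lam * f` coefficientwise up to `N`. -/
def LogSup (N : ℕ) (f lam : AF) : Prop := (∀ n, 0 ≤ f n) ∧ ∀ n ≤ N, (lam * f) n ≤ logD f n

theorem mul_le_mul_right' {f f' g : AF} (h : ∀ n, f n ≤ f' n) (hg : ∀ n, 0 ≤ g n) (n : ℕ) :
    (f * g) n ≤ (f' * g) n := by
  simp only [ArithmeticFunction.mul_apply]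
  exact sum_le_sum fun x _ => mul_le_mul_of_nonneg_right (h _) (hg _)

theorem mul_le_mul_right_upTo {f f' g : AF} {N : ℕ} (h : ∀ n ≤ N, f n ≤ f' n)
    (hg : ∀ n, 0 ≤ g n) : ∀ n ≤ N, (f * g) n ≤ (f' * g) n := by
  intro n hn
  simp only [ArithmeticFunction.mul_apply]
  exact sum_le_sum fun x hx => mul_le_mul_of_nonneg_right
    (h _ ((Nat.divisor_le (Nat.fst_mem_divisors_of_mem_antidiagonal hx)).trans hn)) (hg _)

/-- By the Leibniz rule logarithmic derivatives add under convolution, so one-sided bounds for them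
are stable under products of nonnegative functions. -/
theorem LogSub.mul {f g lam mu : AF} (hf : LogSub f lam) (hg : LogSub g mu) :
    LogSub (f * g) (lam + mu) := by
  refine ⟨mul_nonneg' hf.1 hg.1, fun n => ?_⟩
  rw [logD_mul, show (lam + mu) * (f * g) = (lam * f) * g + (mu * g) * f by ring,
    mul_comm f (logD g), ArithmeticFunction.add_apply, ArithmeticFunction.add_apply]
  exact add_le_add (mul_le_mul_right' hf.2 hg.1 n) (mul_le_mul_right' hg.2 hf.1 n)

theorem LogSup.mul {N : ℕ} {f g lam mu : AF} (hf : LogSup N f lam) (hg : LogSup N g mu) :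
    LogSup N (f * g) (lam + mu) := by
  refine ⟨mul_nonneg' hf.1 hg.1, fun n hn => ?_⟩
  rw [logD_mul, show (lam + mu) * (f * g) = (lam * f) * g + (mu * g) * f by ring,
    mul_comm f (logD g), ArithmeticFunction.add_apply, ArithmeticFunction.add_apply]
  exact add_le_add (mul_le_mul_right_upTo hf.2 hg.1 n hn) (mul_le_mul_right_upTo hg.2 hf.1 n hn)

theorem LogSub.prod {ι : Type*} {s : Finset ι} {f lam : ι → AF}
    (h : ∀ i ∈ s, LogSub (f i) (lam i)) : LogSub (∏ i ∈ s, f i) (∑ i ∈ s, lam i) := by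
  classical
  induction s using Finset.induction_on with
  | empty => exact ⟨by simpa using one_nonneg', fun n => by simp [logD_one]⟩
  | insert a s ha ih =>
    rw [prod_insert ha, sum_insert ha]
    exact (h a (mem_insert_self _ _)).mul (ih fun i hi => h i (mem_insert_of_mem hi))

theorem LogSup.prod {ι : Type*} {s : Finset ι} {N : ℕ} {f lam : ι → AF}
    (h : ∀ i ∈ s, LogSup N (f i) (lam i)) : LogSup N (∏ i ∈ s, f i) (∑ i ∈ s, lam i) := by
  classical
  induction s using Finset.induction_on with
  | empty => exact ⟨by simpa using one_nonneg', fun n _ => by simp [logD_one]⟩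
  | insert a s ha ih =>
    rw [prod_insert ha, sum_insert ha]
    exact (h a (mem_insert_self _ _)).mul (ih fun i hi => h i (mem_insert_of_mem hi))

theorem derivative_texp (M : ℕ) : derivative (texp (M + 1) 1) = texp M 1 := by
  ext r
  rw [coeff_derivative, coeff_texp, coeff_texp]
  simp only [Nat.add_le_add_iff_right]
  split_ifs
  · rw [Nat.factorial_succ]; push_cast
    have : (r.factorial : ℝ) ≠ 0 := by positivity
    have : (r : ℝ) + 1 ≠ 0 := by positivity
    field_simp
    simp
  · simp

theorem texp_succ (M : ℕ) (a : ℝ) :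
    texp (M + 1) a = texp M a + monomial (M + 1) (a ^ (M + 1) / (M + 1).factorial) := by
  unfold texp; rw [sum_range_succ]

/-- The full exponential would satisfy log·f = (log·P) * f. Differentiating the truncation loses its
top term, which is nonnegative, and leaves an inequality. -/
theorem logSub_aeval_texp {P : AF} (hP : ∀ n, 0 ≤ P n) (M : ℕ) :
    LogSub (aeval P (texp (M + 1) 1)) (logD P) := by
  refine ⟨aeval_nonneg hP (coeff_texp_nonneg _ zero_le_one), fun n => ?_⟩
  rw [logD_aeval, derivative_texp, mul_comm (logD P)]
  refine mul_le_mul_right' (fun n => ?_) (logD_nonneg hP) n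
  refine (le_abs_self _).trans (abs_aeval_le hP (fun r => ?_) n)
  rw [coeff_texp, coeff_texp]
  split_ifs with h1 h2 h2
  · exact (abs_of_nonneg (by positivity)).le
  · omega
  · rw [abs_zero]; positivity
  · simp

/-- A product of r integers that are each at least 2 is at least 2^r. -/
theorem pow_apply_eq_zero {P : AF} (hP1 : P 1 = 0) {r n : ℕ} (hn : n < 2 ^ r) : (P ^ r) n = 0 := by
  induction r generalizing n with
  | zero => simp at hn; simp [hn]
  | succ r ih =>
    rw [pow_succ, ArithmeticFunction.mul_apply]
    refine sum_eq_zero fun x hx => ?_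
    rw [Nat.mem_divisorsAntidiagonal] at hx
    have h2 : x.2 ≠ 0 := right_ne_zero_of_mul (hx.1 ▸ hx.2)
    by_cases h : x.2 = 1
    · rw [h, hP1, mul_zero]
    · rw [ih, zero_mul]
      have : 2 ≤ x.2 := by omega
      have := hx.1
      rw [pow_succ] at hn
      nlinarith

/-- The term lost by differentiating is a multiple of P^(M+1), which lives on n ≥ 2^(M+1), beyond N.
-/
theorem logSup_aeval_texp {P : AF} (hP : ∀ n, 0 ≤ P n) (hP1 : P 1 = 0) {M N : ℕ}
    (hN : N < 2 ^ (M + 1)) : LogSup N (aeval P (texp (M + 1) 1)) (logD P) := by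
  refine ⟨aeval_nonneg hP (coeff_texp_nonneg _ zero_le_one), fun n hn => ?_⟩
  rw [logD_aeval, derivative_texp, mul_comm (logD P)]
  refine mul_le_mul_right_upTo (fun n hn => ?_) (logD_nonneg hP) n hn
  rw [texp_succ, map_add, ArithmeticFunction.add_apply, aeval_monomial, ← Algebra.smul_def,
    smul_apply', pow_apply_eq_zero hP1 (hn.trans_lt hN)]
  simp

theorem sum_divisorsAntidiagonal_vonMangoldt (n : ℕ) :
    ∑ x ∈ n.divisorsAntidiagonal, ArithmeticFunction.vonMangoldt x.1 = Real.log n := by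
  rw [Nat.sum_divisorsAntidiagonal (fun d _ => ArithmeticFunction.vonMangoldt d),
    ArithmeticFunction.vonMangoldt_sum]

/-- Strong induction: log n · f(n) ≤ ∑ Λ(d) f(n/d) ≤ ∑ Λ(d) = log n. The divisor d = 1, where the
induction hypothesis is unavailable, carries Λ(1) = 0. -/
theorem le_one_of_logSub {f lam : AF} (h : LogSub f lam) (h1 : f 1 = 1)
    (hlam : ∀ n, lam n ≤ ArithmeticFunction.vonMangoldt n) (n : ℕ) : f n ≤ 1 := by
  induction n using Nat.strong_induction_on with
  | _ n ih =>
    rcases Nat.lt_or_ge n 2 with hn | hn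
    · interval_cases n
      · simp
      · exact h1.le
    · have hlog : 0 < Real.log n := Real.log_pos (by exact_mod_cast hn)
      have key : logD f n ≤ Real.log n := by
        refine (h.2 n).trans ?_
        refine (mul_le_mul_right' hlam h.1 n).trans ?_
        rw [← sum_divisorsAntidiagonal_vonMangoldt, ArithmeticFunction.mul_apply]
        refine sum_le_sum fun x hx => ?_
        rw [Nat.mem_divisorsAntidiagonal] at hx
        have h2 : x.2 ≠ 0 := right_ne_zero_of_mul (hx.1 ▸ hx.2)
        by_cases hx1 : x.1 = 1
        · simp [hx1]
        · have h0 : x.1 ≠ 0 := left_ne_zero_of_mul (hx.1 ▸ hx.2)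
          have : x.2 < n := by
            have : 2 ≤ x.1 := by omega
            have := hx.1
            have : 0 < x.2 := Nat.pos_of_ne_zero h2
            nlinarith
          exact mul_le_of_le_one_right ArithmeticFunction.vonMangoldt_nonneg (ih _ this)
      rw [logD_apply] at key
      nlinarith

/-- The same induction with the inequalities reversed, run only up to N. -/
theorem one_le_of_logSup {f lam : AF} {N : ℕ} (h : LogSup N f lam) (h1 : f 1 = 1)
    (hlam : ∀ n ≤ N, ArithmeticFunction.vonMangoldt n ≤ lam n) (n : ℕ) (hn0 : n ≠ 0)
    (hnN : n ≤ N) : 1 ≤ f n := by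
  induction n using Nat.strong_induction_on with
  | _ n ih =>
    rcases Nat.lt_or_ge n 2 with hn | hn
    · have : n = 1 := by omega
      rw [this, h1]
    · have hlog : 0 < Real.log n := Real.log_pos (by exact_mod_cast hn)
      have key : Real.log n ≤ logD f n := by
        refine le_trans ?_ (h.2 n hnN)
        refine le_trans ?_ (mul_le_mul_right_upTo hlam h.1 n hnN)
        rw [← sum_divisorsAntidiagonal_vonMangoldt, ArithmeticFunction.mul_apply]
        refine sum_le_sum fun x hx => ?_
        rw [Nat.mem_divisorsAntidiagonal] at hx
        have h2 : x.2 ≠ 0 := right_ne_zero_of_mul (hx.1 ▸ hx.2)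
        by_cases hx1 : x.1 = 1
        · simp [hx1]
        · have h0 : x.1 ≠ 0 := left_ne_zero_of_mul (hx.1 ▸ hx.2)
          have : x.2 < n := by
            have : 2 ≤ x.1 := by omega
            have := hx.1
            have : 0 < x.2 := Nat.pos_of_ne_zero h2
            nlinarith
          exact le_mul_of_one_le_right ArithmeticFunction.vonMangoldt_nonneg
            (ih _ this h2 (this.le.trans hnN))
      rw [logD_apply] at key
      nlinarith

theorem prod_apply_one {ι : Type*} (s : Finset ι) (f : ι → AF) :
    (∏ i ∈ s, f i) 1 = ∏ i ∈ s, f i 1 := by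
  classical
  induction s using Finset.induction_on with
  | empty => simp
  | insert a s ha ih => rw [prod_insert ha, prod_insert ha, ArithmeticFunction.mul_apply_one, ih]

theorem aeval_apply_one {P : AF} (hP1 : P 1 = 0) (q : ℝ[X]) : (aeval P q) 1 = q.coeff 0 := by
  rw [aeval_apply, sum_eq_single 0]
  · simp
  · intro r _ hr
    rw [pow_apply_eq_zero hP1 (Nat.one_lt_two_pow hr), mul_zero]
  · simp

/-! ### The alternating product `exp(X) E_ℓ(-X)` -/

/-- The coefficient is a truncated alternating sum of binomial coefficients, which has a closed
form. So up to degree M the product is 1 plus terms of degree above ℓ, and these are nonnegative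
when ℓ is even. -/
theorem coeff_texp_mul_texp_neg {M ℓ r : ℕ} (hr : r + 1 ≤ M) :
    (texp M 1 * texp ℓ (-1)).coeff (r + 1) =
      (-1) ^ ℓ * (r.choose ℓ : ℝ) / (r + 1).factorial := by
  have h := Int.alternating_sum_range_choose_eq_choose (n := r) (m := ℓ)
  have h' : (∑ i ∈ range (ℓ + 1), ((-1) ^ i * ((r + 1).choose i : ℝ))) =
      (-1) ^ ℓ * (r.choose ℓ : ℝ) := by exact_mod_cast h
  rw [← h', mul_comm, coeff_mul, Nat.sum_antidiagonal_eq_sum_range_succ_mk, sum_div]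
  have hf : ((r + 1).factorial : ℝ) ≠ 0 := by positivity
  have key : ∀ i ∈ range (r + 1).succ, (texp ℓ (-1)).coeff i * (texp M 1).coeff (r + 1 - i) =
      if i ≤ ℓ then (-1) ^ i * ((r + 1).choose i : ℝ) / (r + 1).factorial else 0 := by
    intro i hi
    rw [mem_range] at hi
    rw [coeff_texp, coeff_texp, if_pos (by omega : r + 1 - i ≤ M)]
    split_ifs
    · have h := Nat.choose_mul_factorial_mul_factorial (by omega : i ≤ r + 1)
      have h2 : ((r + 1).choose i : ℝ) * i.factorial * (r + 1 - i).factorial =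
        (r + 1).factorial := by exact_mod_cast h
      have h3 : (i.factorial : ℝ) ≠ 0 := by positivity
      have h4 : ((r + 1 - i).factorial : ℝ) ≠ 0 := by positivity
      rw [one_pow, div_mul_div_comm, mul_one, div_eq_div_iff (by positivity) hf, ← h2]
      ring
    · rw [zero_mul]
  rw [sum_congr rfl key, ← sum_filter]
  refine sum_subset (fun i hi => ?_) fun i hi hi' => ?_
  · rw [mem_filter] at hi
    rw [mem_range]; omega
  · rw [mem_range] at hi
    have : r + 1 < i := by
      by_contra h
      exact hi' (mem_filter.2 ⟨mem_range.2 (by omega), by omega⟩)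
    rw [Nat.choose_eq_zero_of_lt this]; simp

/-- The polynomial replacing `exp(X) exp(-X) exp(kX)`, built from truncated exponentials. -/
noncomputable def texpTriple (M ℓ : ℕ) (k : ℝ) : ℝ[X] := texp M 1 * texp ℓ (-1) * texp ℓ k

theorem expBdd_texpTriple (M ℓ : ℕ) {k : ℝ} (hk : 0 ≤ k) : ExpBdd (texpTriple M ℓ k) (k + 2) := by
  have := ((expBdd_texp M (a := 1) (A := 1) (by simp)).mul
    (expBdd_texp ℓ (a := -1) (A := 1) (by simp))).mul
    (expBdd_texp ℓ (a := k) (A := k) (abs_of_nonneg hk).le)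
  rwa [show (1 : ℝ) + 1 + k = k + 2 by ring] at this

theorem coeff_zero_texp_mul_texp_neg (M ℓ : ℕ) : (texp M 1 * texp ℓ (-1)).coeff 0 = 1 := by
  rw [mul_coeff_zero, coeff_texp, coeff_texp]; simp

/-- Only the constant term 1 of the first two factors is kept; for even ℓ all other contributions
are nonnegative. -/
theorem le_coeff_texpTriple {M ℓ : ℕ} (hℓ : Even ℓ) {k : ℝ} (hk : 0 ≤ k) {r : ℕ} (hr : r ≤ M) :
    (texp ℓ k).coeff r ≤ (texpTriple M ℓ k).coeff r := by
  unfold texpTriple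
  rw [coeff_mul]
  refine le_trans (le_of_eq ?_) (single_le_sum (a := (0, r)) (fun x hx => ?_) (by simp))
  · simp only
    rw [coeff_zero_texp_mul_texp_neg, one_mul]
  · rw [HasAntidiagonal.mem_antidiagonal] at hx
    refine mul_nonneg ?_ (coeff_texp_nonneg _ hk _)
    rcases h : x.1 with _ | i
    · rw [coeff_zero_texp_mul_texp_neg]; norm_num
    · rw [coeff_texp_mul_texp_neg (by omega), hℓ.neg_one_pow]; positivity

theorem coeff_texpTriple {M ℓ : ℕ} {k : ℝ} (hM : ℓ ≤ M) {r : ℕ} (hr : r ≤ ℓ) :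
    (texpTriple M ℓ k).coeff r = k ^ r / r.factorial := by
  unfold texpTriple
  rw [coeff_mul, sum_eq_single (0, r)]
  · simp only
    rw [coeff_zero_texp_mul_texp_neg, one_mul, coeff_texp, if_pos hr]
  · intro x hx hne
    rw [HasAntidiagonal.mem_antidiagonal] at hx
    rcases h : x.1 with _ | i
    · exact absurd (Prod.ext h (by simp only; omega)) hne
    · rw [coeff_texp_mul_texp_neg (by omega), Nat.choose_eq_zero_of_lt (by omega)]; simp
  · simp

theorem fock_texpTriple_le {M ℓ : ℕ} {k V : ℝ} (hk : 0 ≤ k) (hM : ℓ ≤ M) (hV : 0 ≤ V) :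
    fock (texpTriple M ℓ k) V ≤
      Real.exp (k ^ 2 * V) + (1 / 2) ^ ℓ * Real.exp (2 * (k + 2) ^ 2 * V) :=
  fock_le_of_expBdd hV (expBdd_texpTriple M ℓ hk) fun _ hr => coeff_texpTriple hM hr

/-- If `q'` dominates `q ≥ 0` up to degree `M`, the same holds for values at `P` up to `N < 2^M`. -/
theorem aeval_le_upTo {P : AF} (hP : ∀ n, 0 ≤ P n) (hP1 : P 1 = 0) {q q' : ℝ[X]} {M N : ℕ}
    (hN : N < 2 ^ M) (hq : ∀ r, 0 ≤ q.coeff r) (h : ∀ r ≤ M, q.coeff r ≤ q'.coeff r) :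
    ∀ n ≤ N, 0 ≤ (aeval P q) n ∧ (aeval P q) n ≤ (aeval P q') n := by
  intro n hn
  refine ⟨aeval_nonneg hP hq n, ?_⟩
  rw [aeval_apply' q (le_max_left _ q'.natDegree), aeval_apply' q' (le_max_right q.natDegree _)]
  refine sum_le_sum fun r _ => ?_
  by_cases hr : r ≤ M
  · exact mul_le_mul_of_nonneg_right (h r hr) (pow_nonneg' hP r n)
  · rw [pow_apply_eq_zero hP1 ((hn.trans_lt hN).trans_le (Nat.pow_le_pow_right (by norm_num)
      (by omega)))]
    simp

/-! ### Prime power sums over ranges -/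

/-- The function `Λ(n) / log n` restricted to `A < log n ≤ B`. -/
noncomputable def rangeP (A B : ℝ) : AF :=
  ⟨fun n => if A < Real.log n ∧ Real.log n ≤ B then
    ArithmeticFunction.vonMangoldt n / Real.log n else 0, by simp⟩

theorem rangeP_apply (A B : ℝ) (n : ℕ) : rangeP A B n =
    if A < Real.log n ∧ Real.log n ≤ B then ArithmeticFunction.vonMangoldt n / Real.log n else 0 :=
  rfl

theorem rangeP_nonneg (A B : ℝ) (n : ℕ) : 0 ≤ rangeP A B n := by
  rw [rangeP_apply]
  split_ifs
  · exact div_nonneg ArithmeticFunction.vonMangoldt_nonneg (Real.log_natCast_nonneg n)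
  · rfl

theorem rangeP_one (A B : ℝ) : rangeP A B 1 = 0 := by
  rw [rangeP_apply]; simp

theorem rangeP_le_one (A B : ℝ) (n : ℕ) : rangeP A B n ≤ 1 := by
  rw [rangeP_apply]
  split_ifs
  · exact div_le_one_of_le₀ ArithmeticFunction.vonMangoldt_le_log (Real.log_natCast_nonneg n)
  · exact zero_le_one

theorem logLen_rangeP (A B : ℝ) : LogLen (rangeP A B) B := by
  intro n hn
  rw [rangeP_apply] at hn
  by_contra h
  exact hn (if_neg fun h' => h h'.2)

theorem logD_rangeP (A B : ℝ) (n : ℕ) : logD (rangeP A B) n =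
    if A < Real.log n ∧ Real.log n ≤ B then ArithmeticFunction.vonMangoldt n else 0 := by
  rw [logD_apply, rangeP_apply, mul_ite, mul_zero]
  refine if_congr Iff.rfl ?_ rfl
  by_cases h : Real.log n = 0
  · have := ArithmeticFunction.vonMangoldt_le_log (n := n)
    have h0 := ArithmeticFunction.vonMangoldt_nonneg (n := n)
    have : ArithmeticFunction.vonMangoldt n = 0 := by linarith
    simp [this]
  · field_simp

theorem rangeP_prime {A B : ℝ} {p : ℕ} (hp : p.Prime) (hA : A < Real.log p) (hB : Real.log p ≤ B) :
    rangeP A B p = 1 := by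
  rw [rangeP_apply, if_pos ⟨hA, hB⟩, ArithmeticFunction.vonMangoldt_apply_prime hp]
  have : 0 < Real.log p := Real.log_pos (by exact_mod_cast hp.one_lt)
  field_simp

/-- The endpoints `L / 4^j` of the logarithmic ranges. -/
noncomputable def cut (L : ℝ) (j : ℕ) : ℝ := L / 4 ^ j

/-- The prime power sum over the `j`-th range. -/
noncomputable def PJ (L : ℝ) (j : ℕ) : AF := rangeP (cut L (j + 1)) (cut L j)

theorem cut_zero (L : ℝ) : cut L 0 = L := by simp [cut]

theorem cut_succ (L : ℝ) (j : ℕ) : cut L (j + 1) = cut L j / 4 := by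
  unfold cut; rw [pow_succ, div_div]

theorem cut_nonneg {L : ℝ} (hL : 0 ≤ L) (j : ℕ) : 0 ≤ cut L j := by unfold cut; positivity

theorem cut_le {L : ℝ} (hL : 0 ≤ L) (j : ℕ) : cut L j ≤ L := by
  unfold cut
  exact div_le_self hL (one_le_pow₀ (by norm_num))

theorem cut_antitone {L : ℝ} (hL : 0 ≤ L) : Antitone (cut L) :=
  antitone_nat_of_succ_le fun j => by
    rw [cut_succ]; linarith [cut_nonneg hL j]

theorem sum_ranges {L : ℝ} (hL : 0 ≤ L) (J : ℕ) (x c : ℝ) :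
    ∑ j ∈ range J, (if cut L (j + 1) < x ∧ x ≤ cut L j then c else 0) =
      if cut L J < x ∧ x ≤ L then c else 0 := by
  induction J with
  | zero =>
    rw [cut_zero, if_neg (by rintro ⟨h, h'⟩; linarith)]; simp
  | succ J ih =>
    rw [sum_range_succ, ih]
    have h1 := cut_le hL J
    have h2 : cut L (J + 1) ≤ cut L J := cut_antitone hL (Nat.le_succ J)
    by_cases a : cut L J < x
    · rw [if_neg (show ¬(cut L (J + 1) < x ∧ x ≤ cut L J) from fun h => absurd h.2 (not_le.2 a)),
        add_zero]
      refine if_congr ⟨fun h => ⟨by linarith, h.2⟩, fun h => ⟨a, h.2⟩⟩ rfl rfl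
    · rw [if_neg (fun h => a h.1), zero_add]
      rw [not_lt] at a
      refine if_congr ⟨fun h => ⟨h.1, by linarith⟩, fun h => ⟨h.1, a⟩⟩ rfl rfl

theorem sum_PJ_apply {L : ℝ} (hL : 0 ≤ L) (J n : ℕ) :
    (∑ j ∈ range J, PJ L j) n = rangeP (cut L J) L n := by
  rw [sum_apply', rangeP_apply, ← sum_ranges hL]
  rfl

theorem sum_PJ {L : ℝ} (hL : 0 ≤ L) (J : ℕ) : ∑ j ∈ range J, PJ L j = rangeP (cut L J) L :=
  ArithmeticFunction.ext (sum_PJ_apply hL J)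

theorem sum_logD_PJ_apply {L : ℝ} (hL : 0 ≤ L) (J n : ℕ) :
    (∑ j ∈ range J, logD (PJ L j)) n =
      if cut L J < Real.log n ∧ Real.log n ≤ L then ArithmeticFunction.vonMangoldt n else 0 := by
  rw [sum_apply', ← sum_ranges hL]
  exact sum_congr rfl fun j _ => logD_rangeP _ _ n

theorem PJ_nonneg (L : ℝ) (j n : ℕ) : 0 ≤ PJ L j n := rangeP_nonneg _ _ n
theorem PJ_one (L : ℝ) (j : ℕ) : PJ L j 1 = 0 := rangeP_one _ _
theorem logLen_PJ (L : ℝ) (j : ℕ) : LogLen (PJ L j) (cut L j) := logLen_rangeP _ _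

/-- The product of truncated exponentials of all the range sums. -/
noncomputable def expProd (L : ℝ) (J M : ℕ) : AF := ∏ j ∈ range J, aeval (PJ L j) (texp (M + 1) 1)

theorem expProd_apply_one (L : ℝ) (J M : ℕ) : expProd L J M 1 = 1 := by
  unfold expProd
  rw [prod_apply_one]
  exact prod_eq_one fun j _ => by rw [aeval_apply_one (PJ_one L j), coeff_texp]; simp

/-- The product truncates exp(∑ Λ(n)/log n · n^(-s)) = ζ(s), whose coefficients are all 1. -/
theorem expProd_le_one {L : ℝ} (hL : 0 ≤ L) (J M n : ℕ) : expProd L J M n ≤ 1 := by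
  refine le_one_of_logSub (LogSub.prod fun j _ => logSub_aeval_texp (PJ_nonneg L j) M)
    (expProd_apply_one L J M) (fun n => ?_) n
  rw [sum_logD_PJ_apply hL]
  split_ifs
  · rfl
  · exact ArithmeticFunction.vonMangoldt_nonneg

/-- Once the ranges reach below log 2 they contain every prime power with log n ≤ L, and for 2^(M+1)
> e^L the truncation of the exponentials is invisible on these integers. The product then coincides
with zeta there. -/
theorem expProd_eq_one {L : ℝ} (hL : 0 ≤ L) {J M n : ℕ} (hJ : cut L J < Real.log 2)
    (hM : Real.exp L < 2 ^ (M + 1)) (hn : n ∈ upTo L) : expProd L J M n = 1 := by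
  refine le_antisymm (expProd_le_one hL J M n) ?_
  have hn' := hn
  rw [mem_upTo] at hn'
  have hN : ⌊Real.exp L⌋₊ < 2 ^ (M + 1) := by
    rw [Nat.floor_lt (Real.exp_pos L).le]; exact_mod_cast hM
  refine one_le_of_logSup (LogSup.prod fun j _ => logSup_aeval_texp (PJ_nonneg L j) (PJ_one L j) hN)
    (expProd_apply_one L J M) (fun m hm => ?_) n hn'.1 (mem_Icc.1 hn).2
  rw [sum_logD_PJ_apply hL]
  split_ifs with h
  · rfl
  · rcases Nat.lt_or_ge m 2 with hm2 | hm2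
    · interval_cases m <;> simp
    · exfalso
      refine h ⟨hJ.trans_le (Real.log_le_log (by norm_num) (by exact_mod_cast hm2)), ?_⟩
      exact (mem_upTo.1 (mem_Icc.2 ⟨by omega, hm⟩ : m ∈ upTo L)).2

/-! ### Estimates of Chebyshev and Mertens type -/

/-- Legendre's formula for log N!, by writing log m as the sum of Λ over divisors and counting
multiples. -/
theorem sum_vonMangoldt_mul_floor (N : ℕ) :
    ∑ n ∈ Icc 1 N, ArithmeticFunction.vonMangoldt n * (N / n : ℕ) =
      ∑ m ∈ Icc 1 N, Real.log m := by
  simp_rw [← ArithmeticFunction.vonMangoldt_sum]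
  rw [sum_comm' (t' := Icc 1 N) (s' := fun d => (Icc 1 N).filter (d ∣ ·))]
  · refine sum_congr rfl fun n hn => ?_
    rw [sum_const, nsmul_eq_mul, mul_comm]
    congr 2
    have := Nat.card_multiples N n
    rw [Nat.Ioc_filter_dvd_card_eq_div N n |>.symm]
    rfl
  · intro m d
    simp only [mem_Icc, Nat.mem_divisors, mem_filter]
    constructor
    · rintro ⟨h, hd, hm⟩
      exact ⟨⟨h, hd⟩, Nat.pos_of_dvd_of_pos hd (by omega), (Nat.le_of_dvd (by omega) hd).trans h.2⟩
    · rintro ⟨⟨h, hd⟩, _⟩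
      exact ⟨h, hd, by omega⟩

/-- Mertens' first estimate, upper half: replacing the floor in Legendre's formula by N/n costs at
most ψ(N), which is O(N) by Chebyshev. -/
theorem exists_sum_vonMangoldt_div_le : ∃ C : ℝ, 0 ≤ C ∧ ∀ x : ℝ, 0 ≤ x →
    ∑ n ∈ upTo x, ArithmeticFunction.vonMangoldt n / n ≤ x + C := by
  refine ⟨Real.log 4 + 4, by positivity, fun x hx => ?_⟩
  set N := ⌊Real.exp x⌋₊ with hN
  have hN1 : 1 ≤ N := by
    rw [hN, Nat.one_le_floor_iff]; exact Real.one_le_exp hx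
  have hNpos : (0 : ℝ) < N := by exact_mod_cast hN1
  have hlogN : Real.log N ≤ x := by
    rw [Real.log_le_iff_le_exp hNpos]; exact Nat.floor_le (Real.exp_pos x).le
  have h1 : ∑ n ∈ Icc 1 N, ArithmeticFunction.vonMangoldt n * (N / n : ℕ) ≤ N * x := by
    rw [sum_vonMangoldt_mul_floor]
    refine (sum_le_card_nsmul _ _ x fun m hm => ?_).trans (by simp)
    rw [mem_Icc] at hm
    exact (Real.log_le_log (by exact_mod_cast hm.1) (by exact_mod_cast hm.2)).trans hlogN
  have h2 : ∑ n ∈ Icc 1 N, ArithmeticFunction.vonMangoldt n ≤ (Real.log 4 + 4) * N := by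
    have := Chebyshev.psi_le_const_mul_self (x := (N : ℝ)) hNpos.le
    rw [Chebyshev.psi, Nat.floor_natCast] at this
    exact this
  have h3 : N * ∑ n ∈ Icc 1 N, ArithmeticFunction.vonMangoldt n / n ≤
      ∑ n ∈ Icc 1 N, ArithmeticFunction.vonMangoldt n * (N / n : ℕ) +
        ∑ n ∈ Icc 1 N, ArithmeticFunction.vonMangoldt n := by
    rw [mul_sum, ← sum_add_distrib]
    refine sum_le_sum fun n hn => ?_
    have h0 := ArithmeticFunction.vonMangoldt_nonneg (n := n)
    have h4 : (N : ℝ) / n ≤ (N / n : ℕ) + 1 := by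
      have h := Nat.lt_floor_add_one ((N : ℝ) / n)
      rw [Nat.floor_div_eq_div] at h
      exact h.le
    calc (N : ℝ) * (ArithmeticFunction.vonMangoldt n / n)
        = ArithmeticFunction.vonMangoldt n * ((N : ℝ) / n) := by ring
      _ ≤ ArithmeticFunction.vonMangoldt n * ((N / n : ℕ) + 1) := by gcongr
      _ = _ := by ring
  have h5 : N * ∑ n ∈ Icc 1 N, ArithmeticFunction.vonMangoldt n / n ≤
      N * (x + (Real.log 4 + 4)) := by linarith
  exact le_of_mul_le_mul_left h5 hNpos

/-- Comparison of a term with the integral of x^(-1-ε) over [t, t+1], in a form that telescopes. -/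
theorem rpow_neg_one_sub_le {ε t : ℝ} (hε : 0 < ε) (ht : 1 ≤ t) :
    (t + 1) ^ (-(1 + ε)) ≤ (t ^ (-ε) - (t + 1) ^ (-ε)) / ε := by
  have h1 : 0 < t + 1 := by linarith
  have h2 : t ^ (-ε) = (t + 1) ^ (-ε) * (t / (t + 1)) ^ (-ε) := by
    rw [← Real.mul_rpow h1.le (by positivity)]
    congr 1; field_simp
  have h3 : 1 + ε / (t + 1) ≤ (t / (t + 1)) ^ (-ε) := by
    rw [Real.rpow_def_of_pos (by positivity)]
    have h4 : Real.log (t / (t + 1)) ≤ -(1 / (t + 1)) := by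
      have := Real.log_le_sub_one_of_pos (show 0 < t / (t + 1) by positivity)
      have h5 : t / (t + 1) - 1 = -(1 / (t + 1)) := by field_simp; ring
      linarith
    have h6 := Real.add_one_le_exp (Real.log (t / (t + 1)) * -ε)
    have h7 : ε / (t + 1) ≤ Real.log (t / (t + 1)) * -ε := by
      have : ε / (t + 1) = ε * (1 / (t + 1)) := by ring
      rw [this]; nlinarith
    linarith
  rw [le_div_iff₀ hε, neg_add, Real.rpow_add h1, Real.rpow_neg_one, h2]
  have h8 : 0 < (t + 1) ^ (-ε) := by positivity
  have h9 : (t + 1)⁻¹ * (t + 1) ^ (-ε) * ε = (t + 1) ^ (-ε) * (ε / (t + 1)) := by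
    field_simp
  rw [h9]
  nlinarith

theorem sum_rpow_le {ε : ℝ} (hε : 0 < ε) (N : ℕ) :
    ∑ n ∈ Icc 1 N, (n : ℝ) ^ (-(1 + ε)) ≤ 1 + 1 / ε := by
  have key : ∀ N : ℕ, ∑ n ∈ Icc 1 (N + 1), (n : ℝ) ^ (-(1 + ε)) ≤
      1 + 1 / ε - ((N + 1 : ℕ) : ℝ) ^ (-ε) / ε := by
    intro N
    induction N with
    | zero => simp
    | succ N ih =>
      rw [sum_Icc_succ_top (by omega)]
      have := rpow_neg_one_sub_le hε (t := ((N + 1 : ℕ) : ℝ)) (by push_cast; linarith [N.cast_nonneg (α := ℝ)])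
      rw [sub_div] at this
      push_cast at this ih ⊢
      linarith
  rcases N with _ | N
  · simp; positivity
  · refine (key N).trans ?_
    have : 0 ≤ ((N + 1 : ℕ) : ℝ) ^ (-ε) / ε := by positivity
    linarith

theorem ev_rchar_le_of_le_one {f : AF} {N : ℝ} (hf : LogLen f N) (h : ∀ n, f n ≤ 1) {ε : ℝ}
    (hε : 0 < ε) : ev (rchar (1 + ε)) f ≤ 1 + 1 / ε := by
  rw [ev_eq_sum' _ hf]
  refine (sum_le_sum fun n _ => ?_).trans (sum_rpow_le hε ⌊Real.exp N⌋₊)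
  rw [smul_eq_mul, rchar_apply]
  exact mul_le_of_le_one_left (by positivity) (h n)

theorem ev_texp {R : Type*} [CommRing R] [Algebra ℝ R] (χ : ℕ →* R) {f : AF} {N : ℝ} (hN : 0 ≤ N)
    (hf : LogLen f N) (ℓ : ℕ) (a : ℝ) :
    ev χ (aeval f (texp ℓ a)) = aeval (ev χ f) (texp ℓ a) := ev_aeval χ hN hf _

theorem aeval_texp_real (ℓ : ℕ) (a y : ℝ) :
    aeval y (texp ℓ a) = ∑ r ∈ range (ℓ + 1), (a * y) ^ r / r.factorial := by
  unfold texp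
  rw [map_sum]
  refine sum_congr rfl fun r _ => ?_
  rw [aeval_monomial]
  simp only [Algebra.algebraMap_self, RingHom.id_apply]
  rw [mul_pow]; ring

theorem exp_le_of_aeval_texp_le {y C : ℝ} (h : ∀ M : ℕ, aeval y (texp (M + 1) 1) ≤ C) :
    Real.exp y ≤ C := by
  have h1 : Filter.Tendsto (fun n => ∑ r ∈ range n, y ^ r / r.factorial) Filter.atTop
      (nhds (Real.exp y)) := by
    have := NormedSpace.expSeries_div_hasSum_exp (𝔸 := ℝ) y
    rw [← Real.exp_eq_exp_ℝ] at this
    exact this.tendsto_sum_nat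
  refine le_of_tendsto h1 ?_
  filter_upwards [Filter.eventually_ge_atTop 2] with n hn
  obtain ⟨m, rfl⟩ := Nat.exists_eq_add_of_le hn
  have := h m
  rw [aeval_texp_real] at this
  simpa [add_comm, add_left_comm] using this

/-- Mertens' second estimate. At the shifted point 1 + 1/x, exp(P) has coefficients at most 1 and so
is bounded by ζ(1 + 1/x) ≤ 1 + x; moving back to 1 changes P by at most (1/x) ∑ Λ(n)/n = O(1). -/
theorem exists_exp_ev_rangeP_le : ∃ C : ℝ, 0 < C ∧ ∀ x : ℝ, 1 ≤ x →
    Real.exp (ev (rchar 1) (rangeP 0 x)) ≤ C * x := by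
  obtain ⟨C1, hC1, h1⟩ := exists_sum_vonMangoldt_div_le
  refine ⟨2 * Real.exp (1 + C1), by positivity, fun x hx => ?_⟩
  have hx0 : 0 < x := by linarith
  set P := rangeP 0 x
  have hP : LogLen P x := logLen_rangeP 0 x
  have step1 : Real.exp (ev (rchar (1 + 1 / x)) P) ≤ 1 + x := by
    refine exp_le_of_aeval_texp_le fun M => ?_
    rw [← ev_texp (rchar (1 + 1 / x)) hx0.le hP]
    have := ev_rchar_le_of_le_one (LogLen.aeval hx0.le hP (natDegree_texp_le (M + 1) 1))
      (ε := 1 / x) (fun n => ?_) (by positivity)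
    · simpa using this
    · refine le_one_of_logSub (logSub_aeval_texp (rangeP_nonneg 0 x) M) ?_ (fun n => ?_) n
      · rw [aeval_apply_one (rangeP_one 0 x), coeff_texp]; simp
      · rw [logD_rangeP]
        split_ifs
        · rfl
        · exact ArithmeticFunction.vonMangoldt_nonneg
  have step2 : ev (rchar 1) P ≤ ev (rchar (1 + 1 / x)) P + (1 + C1) := by
    rw [ev_eq_sum' _ hP, ev_eq_sum' _ hP]
    have h2 : ∀ n ∈ upTo x, P n • rchar 1 n ≤ P n • rchar (1 + 1 / x) n +
        (1 / x) * (ArithmeticFunction.vonMangoldt n / n) := by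
      intro n hn
      have hn0 := (mem_upTo.1 hn).1
      have hnpos : (0 : ℝ) < n := by positivity
      rw [smul_eq_mul, smul_eq_mul, rchar_apply, rchar_apply, neg_add, Real.rpow_add hnpos]
      have h3 : 1 - (1 / x) * Real.log n ≤ (n : ℝ) ^ (-(1 / x)) := by
        rw [Real.rpow_def_of_pos hnpos]
        have := Real.add_one_le_exp (Real.log n * -(1 / x))
        linarith
      have h4 : P n * Real.log n ≤ ArithmeticFunction.vonMangoldt n := by
        have := logD_rangeP 0 x n
        rw [logD_apply] at this
        rw [mul_comm, this]
        split_ifs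
        · rfl
        · exact ArithmeticFunction.vonMangoldt_nonneg
      rw [Real.rpow_neg_one]
      have h5 : 0 ≤ P n * (n : ℝ)⁻¹ := mul_nonneg (rangeP_nonneg 0 x n) (by positivity)
      have h6 : P n * (n : ℝ)⁻¹ * ((1 / x) * Real.log n) ≤
          (1 / x) * (ArithmeticFunction.vonMangoldt n / n) := by
        calc P n * (n : ℝ)⁻¹ * ((1 / x) * Real.log n)
            = (1 / x) * (P n * Real.log n / n) := by ring
          _ ≤ _ := by gcongr
      nlinarith
    refine (sum_le_sum h2).trans ?_
    rw [sum_add_distrib, ← mul_sum]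
    gcongr
    have h7 := h1 x hx0.le
    calc 1 / x * ∑ n ∈ upTo x, ArithmeticFunction.vonMangoldt n / n ≤ 1 / x * (x + C1) := by gcongr
      _ = 1 + C1 / x := by field_simp
      _ ≤ 1 + C1 := by
        gcongr
        exact div_le_self hC1 hx
  calc Real.exp (ev (rchar 1) P) ≤ Real.exp (ev (rchar (1 + 1 / x)) P + (1 + C1)) := by gcongr
    _ = Real.exp (ev (rchar (1 + 1 / x)) P) * Real.exp (1 + C1) := Real.exp_add _ _
    _ ≤ (1 + x) * Real.exp (1 + C1) := by gcongr
    _ ≤ (2 * x) * Real.exp (1 + C1) := by gcongr; linarith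
    _ = _ := by ring

/-- The mass `∑ P_j(n) / n` of the `j`-th range. -/
noncomputable def VJ (L : ℝ) (j : ℕ) : ℝ := ev (rchar 1) (PJ L j)

theorem VJ_nonneg (L : ℝ) (j : ℕ) : 0 ≤ VJ L j := ev_rchar_nonneg (PJ_nonneg L j) 1

theorem ev_sum_PJ {L : ℝ} (hL : 0 ≤ L) (J : ℕ) (σ : ℝ) :
    ∑ j ∈ range J, ev (rchar σ) (PJ L j) = ev (rchar σ) (rangeP (cut L J) L) := by
  rw [← sum_PJ hL, ev_sum _ (N := L)]
  exact fun j _ => (logLen_PJ L j).mono (cut_le hL j)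

theorem exists_exp_sum_VJ_le : ∃ C : ℝ, 0 < C ∧ ∀ L : ℝ, 1 ≤ L → ∀ J : ℕ,
    Real.exp (∑ j ∈ range J, VJ L j) ≤ C * L := by
  obtain ⟨C, hC, h⟩ := exists_exp_ev_rangeP_le
  refine ⟨C, hC, fun L hL J => le_trans (Real.exp_le_exp.2 ?_) (h L hL)⟩
  unfold VJ
  rw [ev_sum_PJ (by linarith)]
  refine ev_rchar_mono (logLen_rangeP _ _) (logLen_rangeP _ _) (fun n => ?_) 1
  rw [rangeP_apply, rangeP_apply]
  have h0 := cut_nonneg (by linarith : 0 ≤ L) J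
  split_ifs with h1 h2 h2
  · rfl
  · exact absurd ⟨by linarith, h1.2⟩ h2
  · exact div_nonneg ArithmeticFunction.vonMangoldt_nonneg (Real.log_natCast_nonneg n)
  · rfl

/-- Within a range log n exceeds a quarter of the upper endpoint c, so the mass is at most (4/c) ∑
Λ(n)/n, which is bounded by Mertens. If c < log 2 the range is empty. -/
theorem exists_VJ_le : ∃ V : ℝ, 0 < V ∧ ∀ L : ℝ, 0 < L → ∀ j : ℕ, VJ L j ≤ V := by
  obtain ⟨C1, hC1, h1⟩ := exists_sum_vonMangoldt_div_le
  refine ⟨4 + 4 * C1 / Real.log 2, by have := Real.log_pos one_lt_two; positivity, fun L hL j => ?_⟩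
  have hl2 := Real.log_pos one_lt_two
  unfold VJ
  rw [ev_eq_sum' _ (logLen_PJ L j)]
  set c := cut L j with hc
  have hcpos : 0 < c := by rw [hc]; unfold cut; positivity
  by_cases hc2 : c < Real.log 2
  · rw [sum_eq_zero]
    · positivity
    · intro n hn
      rw [mem_upTo] at hn
      have : n = 1 := by
        by_contra hne
        have : 2 ≤ n := by have := hn.1; omega
        have := Real.log_le_log (by norm_num) (show (2 : ℝ) ≤ n by exact_mod_cast this)
        linarith [hn.2]
      rw [this, PJ_one, zero_smul]
  · rw [not_lt] at hc2
    have h2 : ∀ n ∈ upTo c, PJ L j n • rchar 1 n ≤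
        (4 / c) * (ArithmeticFunction.vonMangoldt n / n) := by
      intro n hn
      have h0 := ArithmeticFunction.vonMangoldt_nonneg (n := n)
      rw [PJ, rangeP_apply, cut_succ, ← hc]
      split_ifs with h
      · have hlog : 0 < Real.log n := by linarith [h.1]
        rw [smul_eq_mul, rchar_apply, Real.rpow_neg_one]
        have h3 : 1 / Real.log n ≤ 4 / c := by
          rw [div_le_div_iff₀ hlog hcpos]; linarith [h.1]
        calc ArithmeticFunction.vonMangoldt n / Real.log n * (n : ℝ)⁻¹
            = 1 / Real.log n * (ArithmeticFunction.vonMangoldt n / n) := by ring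
          _ ≤ _ := by gcongr
      · rw [zero_smul]; positivity
    refine (sum_le_sum h2).trans ?_
    rw [← mul_sum]
    calc 4 / c * ∑ n ∈ upTo c, ArithmeticFunction.vonMangoldt n / n ≤ 4 / c * (c + C1) := by
          gcongr; exact h1 c hcpos.le
      _ = 4 + 4 * C1 / c := by field_simp
      _ ≤ _ := by gcongr

theorem sum_ev_PJ_le_two {L : ℝ} (hL : 0 ≤ L) (J : ℕ) :
    ∑ j ∈ range J, ev (rchar 2) (PJ L j) ≤ 2 := by
  rw [ev_sum_PJ hL]
  have := ev_rchar_le_of_le_one (logLen_rangeP (cut L J) L) (rangeP_le_one _ _) (ε := 1) one_pos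
  norm_num at this
  exact this

/-! ### Sums over primes -/

/-- The primes `p` with `log p ≤ y`. -/
noncomputable def primesLog (y : ℝ) : Finset ℕ := (upTo y).filter Nat.Prime

theorem mem_primesLog {y : ℝ} {p : ℕ} : p ∈ primesLog y ↔ p.Prime ∧ Real.log p ≤ y := by
  unfold primesLog
  rw [mem_filter, mem_upTo]
  exact ⟨fun h => ⟨h.2, h.1.2⟩, fun h => ⟨⟨h.1.ne_zero, h.2⟩, h.1⟩⟩

theorem sum_inv_sq_primesLog_le (y : ℝ) : ∑ p ∈ primesLog y, ((p : ℝ) ^ 2)⁻¹ ≤ 1 := by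
  refine (sum_le_sum_of_subset_of_nonneg (t := Ioo 1 (⌊Real.exp y⌋₊ + 1)) ?_ ?_).trans
    ((sum_Ioo_inv_sq_le 1 (⌊Real.exp y⌋₊ + 1)).trans (by norm_num))
  · intro p hp
    unfold primesLog upTo at hp
    rw [mem_filter, mem_Icc] at hp
    rw [mem_Ioo]
    exact ⟨hp.2.one_lt, by omega⟩
  · intros; positivity

theorem exists_exp_sum_inv_primesLog_le : ∃ C : ℝ, 0 < C ∧ ∀ y : ℝ, 1 ≤ y →
    Real.exp (∑ p ∈ primesLog y, (p : ℝ)⁻¹) ≤ C * y := by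
  obtain ⟨C, hC, h⟩ := exists_exp_ev_rangeP_le
  refine ⟨C, hC, fun y hy => le_trans (Real.exp_le_exp.2 ?_) (h y hy)⟩
  rw [ev_eq_sum' _ (logLen_rangeP 0 y)]
  unfold primesLog
  rw [sum_filter]
  refine sum_le_sum fun n hn => ?_
  split_ifs with hp
  · rw [rangeP_prime hp (Real.log_pos (by exact_mod_cast hp.one_lt)) (mem_upTo.1 hn).2, one_smul,
      rchar_apply, Real.rpow_neg_one]
  · exact mul_nonneg (rangeP_nonneg _ _ _) (by rw [rchar_apply]; positivity)

/-- The Euler product over p ≤ e^y dominates the harmonic sum up to e^y, which is at least y. Each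
Euler factor is at most exp(1/p + 1/p²), and ∑ 1/p² ≤ 1. -/
theorem le_exp_sum_inv_primesLog (y : ℝ) :
    y ≤ Real.exp (∑ p ∈ primesLog y, (p : ℝ)⁻¹ + 1) := by
  have hF : ∀ {p : ℕ}, p.Prime → ‖rchar 1 p‖ < 1 := by
    intro p hp
    rw [rchar_apply, Real.rpow_neg_one, norm_inv, Real.norm_natCast]
    exact inv_lt_one_of_one_lt₀ (by exact_mod_cast hp.one_lt)
  have h1 := (EulerProduct.summable_and_hasSum_factoredNumbers_prod_filter_prime_geometric
    hF (upTo y)).2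
  have h2 : y ≤ ∏ p ∈ primesLog y, (1 - rchar 1 p)⁻¹ := by
    have h3 : ∑ n ∈ upTo y, (n : ℝ)⁻¹ ≤ ∏ p ∈ primesLog y, (1 - rchar 1 p)⁻¹ := by
      have hmem : ∀ n ∈ upTo y, n ∈ Nat.factoredNumbers (upTo y) := by
        intro n hn
        rw [Nat.mem_factoredNumbers']
        intro p hp hpn
        have hn' := mem_Icc.1 hn
        exact mem_Icc.2 ⟨hp.one_lt.le, (Nat.le_of_dvd (by omega) hpn).trans hn'.2⟩
      have := sum_le_hasSum ((upTo y).attach.map ⟨fun n => ⟨n.1, hmem n.1 n.2⟩, fun a b hab =>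
        Subtype.ext (Subtype.mk.inj hab)⟩) (fun i _ => by rw [rchar_apply]; positivity) h1
      refine le_trans (le_of_eq ?_) this
      rw [sum_map, ← sum_attach]
      refine sum_congr rfl fun n _ => ?_
      rw [rchar_apply, Real.rpow_neg_one]
      rfl
    refine le_trans ?_ h3
    have h4 := log_add_one_le_harmonic ⌊Real.exp y⌋₊
    rw [harmonic_eq_sum_Icc] at h4
    push_cast at h4
    refine le_trans ?_ h4
    rw [Real.le_log_iff_exp_le (by positivity)]
    exact (Nat.lt_floor_add_one _).le
  refine h2.trans ?_
  have h5 : ∏ p ∈ primesLog y, (1 - rchar 1 p)⁻¹ ≤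
      ∏ p ∈ primesLog y, Real.exp ((p : ℝ)⁻¹ + ((p : ℝ) ^ 2)⁻¹) := by
    refine prod_le_prod (fun p hp => ?_) fun p hp => ?_
    · have := hF (mem_primesLog.1 hp).1
      rw [inv_nonneg]
      have := (abs_lt.1 this).2
      linarith
    · have hp2 : (2 : ℝ) ≤ p := by exact_mod_cast (mem_primesLog.1 hp).1.two_le
      rw [rchar_apply, Real.rpow_neg_one]
      set u := (p : ℝ)⁻¹ with hu
      have hu0 : 0 < u := by positivity
      have hu2 : u ≤ 1 / 2 := by
        rw [hu, inv_le_comm₀ (by linarith) (by norm_num)]; linarith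
      rw [← inv_pow, ← hu]
      rw [inv_le_comm₀ (by linarith) (Real.exp_pos _), ← Real.exp_neg]
      have h7 := Real.quadratic_le_exp_of_nonneg (show 0 ≤ u + u ^ 2 by positivity)
      rw [Real.exp_neg, inv_le_comm₀ (Real.exp_pos _) (by linarith)]
      refine le_trans ?_ h7
      rw [inv_le_iff_one_le_mul₀ (by linarith)]
      have h8 : 0 ≤ u ^ 2 * (1 - 2 * u) := by nlinarith [sq_nonneg u]
      have h9 : 0 ≤ u ^ 3 * (1 - 2 * u) := by nlinarith [pow_pos hu0 3]
      nlinarith [pow_pos hu0 3, pow_pos hu0 4, mul_pos hu0 (pow_pos hu0 4)]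
  refine h5.trans ?_
  rw [← Real.exp_sum, sum_add_distrib]
  gcongr
  exact sum_inv_sq_primesLog_le y

theorem sum_log_div_primesLog_le {C : ℝ} (hC : ∀ x : ℝ, 0 ≤ x →
    ∑ n ∈ upTo x, ArithmeticFunction.vonMangoldt n / n ≤ x + C) {y : ℝ} (hy : 0 ≤ y) :
    ∑ p ∈ primesLog y, Real.log p / p ≤ y + C := by
  refine le_trans ?_ (hC y hy)
  unfold primesLog
  rw [sum_filter]
  refine sum_le_sum fun n _ => ?_
  split_ifs with hp
  · rw [ArithmeticFunction.vonMangoldt_apply_prime hp]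
  · exact div_nonneg ArithmeticFunction.vonMangoldt_nonneg (by positivity)

/-! ### Lower bounds on squarefree integers -/

/-- Among the factorisations of a squarefree n only p · (n/p) are kept, everything being
nonnegative. -/
theorem sum_erase_le_mul {g h : AF} (hg : ∀ n, 0 ≤ g n) (hh : ∀ n, 0 ≤ h n) {t : Finset ℕ}
    (ht : ∀ p ∈ t, p.Prime) :
    ∑ p ∈ t, g p * h (∏ q ∈ t.erase p, q) ≤ (g * h) (∏ q ∈ t, q) := by
  rw [ArithmeticFunction.mul_apply]
  have hinj : Set.InjOn (fun p => (p, ∏ q ∈ t.erase p, q)) (t : Set ℕ) :=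
    fun p _ q _ h => (Prod.mk.inj h).1
  rw [← sum_image (f := fun x : ℕ × ℕ => g x.1 * h x.2) hinj]
  refine sum_le_sum_of_subset_of_nonneg (fun x hx => ?_) fun x _ _ => mul_nonneg (hg _) (hh _)
  obtain ⟨p, hp, rfl⟩ := mem_image.1 hx
  rw [Nat.mem_divisorsAntidiagonal]
  exact ⟨mul_prod_erase t (fun q => q) hp, prod_ne_zero_iff.2 fun q hq => (ht q hq).ne_zero⟩

/-- A product of r distinct primes arises from r! orderings. This cancels the r! in the Taylor
coefficients. -/
theorem factorial_le_pow_apply {P : AF} (hP : ∀ n, 0 ≤ P n) {r : ℕ} {t : Finset ℕ}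
    (ht : ∀ p ∈ t, p.Prime) (h1 : ∀ p ∈ t, 1 ≤ P p) (hr : t.card = r) :
    (r.factorial : ℝ) ≤ (P ^ r) (∏ q ∈ t, q) := by
  induction r generalizing t with
  | zero => rw [card_eq_zero] at hr; simp [hr]
  | succ r ih =>
    rw [pow_succ']
    refine le_trans ?_ (sum_erase_le_mul hP (pow_nonneg' hP r) ht)
    calc ((r + 1).factorial : ℝ) = ∑ p ∈ t, (r.factorial : ℝ) := by
          rw [sum_const, hr, Nat.factorial_succ, nsmul_eq_mul]; push_cast; ring
      _ ≤ _ := by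
        refine sum_le_sum fun p hp => ?_
        have h2 := ih (fun q hq => ht q (mem_of_mem_erase hq)) (fun q hq => h1 q (mem_of_mem_erase hq))
          (by rw [card_erase_of_mem hp, hr]; rfl)
        have h3 : (0 : ℝ) ≤ r.factorial := by positivity
        nlinarith [h1 p hp]

theorem le_mul_apply {f g : AF} (hf : ∀ n, 0 ≤ f n) (hg : ∀ n, 0 ≤ g n) {m n : ℕ} (hm : m ≠ 0)
    (hn : n ≠ 0) : f m * g n ≤ (f * g) (m * n) := by
  rw [ArithmeticFunction.mul_apply]
  exact single_le_sum (f := fun x : ℕ × ℕ => f x.1 * g x.2) (a := (m, n))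
    (fun x _ => mul_nonneg (hf _) (hg _))
    (Nat.mem_divisorsAntidiagonal.2 ⟨rfl, mul_ne_zero hm hn⟩)

/-! ### The polynomials imitating powers of zeta, evaluated on squarefree integers. -/

/-- The truncation degrees. -/
def deg (B j : ℕ) : ℕ := B * 2 ^ j

/-- The arithmetic function whose Dirichlet polynomial approximates `ζ^k`. -/
noncomputable def NK (L : ℝ) (J B : ℕ) (k : ℝ) : AF :=
  ∏ j ∈ range J, aeval (PJ L j) (texp (deg B j) k)

theorem NK_nonneg (L : ℝ) (J B : ℕ) {k : ℝ} (hk : 0 ≤ k) (n : ℕ) : 0 ≤ NK L J B k n :=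
  prod_nonneg' (fun j _ => aeval_nonneg (PJ_nonneg L j) (coeff_texp_nonneg _ hk)) n

/-- The primes of `t` in the `j`-th range. -/
noncomputable def part (L : ℝ) (t : Finset ℕ) (j : ℕ) : Finset ℕ :=
  t.filter fun p => cut L (j + 1) < Real.log p ∧ Real.log p ≤ cut L j

/-- The primes are sorted by range. A range containing r of them contributes at least (k^r/r!)·r! =
k^r, provided the truncation keeps degree r. -/
theorem pow_card_le_NK {L : ℝ} {B : ℕ} {k : ℝ} (hk : 0 ≤ k) {J : ℕ} {t : Finset ℕ}
    (ht : ∀ p ∈ t, p.Prime) (hJ : ∀ p ∈ t, cut L J < Real.log p) (hL : ∀ p ∈ t, Real.log p ≤ L)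
    (hB : ∀ j < J, (part L t j).card ≤ deg B j) :
    k ^ t.card ≤ NK L J B k (∏ q ∈ t, q) := by
  induction J generalizing t with
  | zero =>
    have : t = ∅ := by
      refine eq_empty_of_forall_notMem fun p hp => ?_
      have h1 := hJ p hp
      have h2 := hL p hp
      rw [cut_zero] at h1
      linarith
    simp [this, NK]
  | succ J ih =>
    set t1 := t.filter fun p : ℕ => cut L J < Real.log p with ht1
    set t2 := t.filter fun p : ℕ => ¬ cut L J < Real.log p with ht2
    have hcard : t1.card + t2.card = t.card := card_filter_add_card_filter_not _
    have hprod : (∏ q ∈ t1, q) * ∏ q ∈ t2, q = ∏ q ∈ t, q := prod_filter_mul_prod_filter_not _ _ _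
    have hne : ∀ s ⊆ t, (∏ q ∈ s, q) ≠ 0 := fun s hs =>
      prod_ne_zero_iff.2 fun q hq => (ht q (hs hq)).ne_zero
    have h2 : t2 = part L t J := by
      ext p
      simp only [ht2, part, mem_filter, not_lt]
      exact ⟨fun h => ⟨h.1, hJ p h.1, h.2⟩, fun h => ⟨h.1, h.2.2⟩⟩
    have hx1 : k ^ t1.card ≤ NK L J B k (∏ q ∈ t1, q) := by
      refine ih (fun p hp => ht p (mem_filter.1 hp).1) (fun p hp => (mem_filter.1 hp).2)
        (fun p hp => hL p (mem_filter.1 hp).1) fun j hj => (card_le_card ?_).trans (hB j (by omega))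
      exact filter_subset_filter _ (filter_subset _ _)
    have hx2 : k ^ t2.card ≤ (aeval (PJ L J) (texp (deg B J) k)) (∏ q ∈ t2, q) := by
      rw [aeval_apply' _ (natDegree_texp_le _ _)]
      have hc : t2.card ≤ deg B J := h2 ▸ hB J (by omega)
      refine le_trans ?_ (single_le_sum (a := t2.card) (fun r _ =>
        mul_nonneg (coeff_texp_nonneg _ hk r) (pow_nonneg' (PJ_nonneg L J) r _))
        (mem_range.2 (by omega)))
      have h3 : (t2.card.factorial : ℝ) ≤ ((PJ L J) ^ t2.card) (∏ q ∈ t2, q) := by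
        refine factorial_le_pow_apply (PJ_nonneg L J) (fun p hp => ht p (mem_filter.1 hp).1)
          (fun p hp => ?_) rfl
        rw [h2] at hp
        have h4 := mem_filter.1 hp
        rw [PJ, rangeP_prime (ht p h4.1) h4.2.1 h4.2.2]
      rw [coeff_texp, if_pos hc]
      have hf : (0 : ℝ) < t2.card.factorial := by positivity
      calc k ^ t2.card = k ^ t2.card / t2.card.factorial * t2.card.factorial := by field_simp
        _ ≤ _ := by gcongr
    rw [← hcard, pow_add, ← hprod, NK, prod_range_succ]
    refine le_trans ?_ (le_mul_apply (NK_nonneg L J B hk)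
      (aeval_nonneg (PJ_nonneg L J) (coeff_texp_nonneg _ hk)) (hne _ (filter_subset _ _))
      (hne _ (filter_subset _ _)))
    exact mul_le_mul hx1 hx2 (by positivity) (NK_nonneg L J B hk _)

/-- The von Mangoldt function restricted to `log n ≤ L`. -/
noncomputable def LamL (L : ℝ) : AF := logD (rangeP 0 L)

theorem LamL_nonneg (L : ℝ) (n : ℕ) : 0 ≤ LamL L n := logD_nonneg (rangeP_nonneg 0 L) n

theorem LamL_prime {L : ℝ} {p : ℕ} (hp : p.Prime) (h : Real.log p ≤ L) :
    LamL L p = Real.log p := by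
  rw [LamL, logD_apply, rangeP_prime hp (Real.log_pos (by exact_mod_cast hp.one_lt)) h, mul_one]

/-- Removing one prime p from n gives weight log p and leaves one prime fewer, whence the division
by k. -/
theorem le_LamL_mul_NK {L : ℝ} {B : ℕ} {k : ℝ} (hk : 0 < k) {J : ℕ} {t : Finset ℕ}
    (ht : ∀ p ∈ t, p.Prime) (hJ : ∀ p ∈ t, cut L J < Real.log p) (hL : ∀ p ∈ t, Real.log p ≤ L)
    (hB : ∀ j < J, (part L t j).card ≤ deg B j) :
    k ^ t.card / k * ∑ p ∈ t, Real.log p ≤ (LamL L * NK L J B k) (∏ q ∈ t, q) := by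
  refine le_trans ?_ (sum_erase_le_mul (LamL_nonneg L) (NK_nonneg L J B hk.le) ht)
  rw [mul_sum]
  refine sum_le_sum fun p hp => ?_
  rw [LamL_prime (ht p hp) (hL p hp), mul_comm]
  refine mul_le_mul_of_nonneg_left ?_ (Real.log_natCast_nonneg p)
  have h1 := pow_card_le_NK (t := t.erase p) hk.le (fun q hq => ht q (mem_of_mem_erase hq))
    (fun q hq => hJ q (mem_of_mem_erase hq)) (fun q hq => hL q (mem_of_mem_erase hq))
    (fun j hj => (card_le_card (filter_subset_filter _ (erase_subset _ _))).trans (hB j hj))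
  refine le_trans (le_of_eq ?_) h1
  rw [card_erase_of_mem hp, div_eq_iff hk.ne', ← pow_succ]
  congr 1
  have := card_pos.2 ⟨p, hp⟩
  omega

/-! ### Weighted subsets of primes -/

/-- The weight `∏ a/p` of a set of primes. -/
noncomputable def wt (a : ℝ) (t : Finset ℕ) : ℝ := ∏ p ∈ t, a / p

theorem wt_nonneg {a : ℝ} (ha : 0 ≤ a) (t : Finset ℕ) : 0 ≤ wt a t :=
  prod_nonneg fun p _ => by positivity

/-- The total weight of the subsets of `s`. -/
noncomputable def totalWt (a : ℝ) (s : Finset ℕ) : ℝ := ∏ p ∈ s, (1 + a / p)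

theorem sum_wt (a : ℝ) (s : Finset ℕ) : ∑ t ∈ s.powerset, wt a t = totalWt a s :=
  (prod_one_add _).symm

theorem totalWt_pos {a : ℝ} (ha : 0 ≤ a) (s : Finset ℕ) : 0 < totalWt a s :=
  prod_pos fun p _ => by positivity

theorem totalWt_le_exp {a : ℝ} (ha : 0 ≤ a) (s : Finset ℕ) :
    totalWt a s ≤ Real.exp (a * ∑ p ∈ s, (p : ℝ)⁻¹) := by
  rw [mul_sum, Real.exp_sum]
  refine prod_le_prod (fun p _ => by positivity) fun p _ => ?_
  have := Real.add_one_le_exp (a * (p : ℝ)⁻¹)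
  rw [div_eq_mul_inv]; linarith

theorem sum_wt_mul_prod (a : ℝ) (s : Finset ℕ) (h : ℕ → ℝ) :
    ∑ t ∈ s.powerset, wt a t * ∏ p ∈ t, h p = ∏ p ∈ s, (1 + a / p * h p) := by
  rw [prod_one_add]
  exact sum_congr rfl fun t _ => by rw [wt, prod_mul_distrib]

/-- Each factor 1 + a h/p is at most (1 + a/p)(1 + a(h - 1)/p). Only the excess of h over 1
therefore enters the exponential. -/
theorem sum_wt_mul_prod_le {a : ℝ} (ha : 0 ≤ a) (s : Finset ℕ) {h : ℕ → ℝ} (hh : ∀ p ∈ s, 1 ≤ h p) :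
    ∑ t ∈ s.powerset, wt a t * ∏ p ∈ t, h p ≤
      totalWt a s * Real.exp (a * ∑ p ∈ s, (h p - 1) / p) := by
  rw [sum_wt_mul_prod, mul_sum, Real.exp_sum, totalWt, ← prod_mul_distrib]
  refine prod_le_prod (fun p hp => ?_) fun p hp => ?_
  · have := hh p hp; positivity
  · have h1 := hh p hp
    have h2 := Real.add_one_le_exp (a * ((h p - 1) / p))
    have h3 : 0 ≤ a / p := by positivity
    have h4 : 0 ≤ a * ((h p - 1) / p) := mul_nonneg ha (div_nonneg (by linarith) (by positivity))
    calc 1 + a / p * h p = 1 + a / p + a * ((h p - 1) / p) := by ring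
      _ ≤ (1 + a / p) * (a * ((h p - 1) / p) + 1) := by nlinarith
      _ ≤ _ := by gcongr

/-- Uses log(1 + u) ≥ u/(1 + u) ≥ u - u² with u = a/p, then the lower Mertens bound for ∑ 1/p. -/
theorem le_totalWt {a : ℝ} (ha : 0 ≤ a) {z : ℝ} (hz : 0 < z) :
    Real.exp (-a - a ^ 2) * z ^ a ≤ totalWt a (primesLog z) := by
  have h1 : Real.exp (a * ∑ p ∈ primesLog z, (p : ℝ)⁻¹ - a ^ 2 * ∑ p ∈ primesLog z, ((p : ℝ) ^ 2)⁻¹)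
      ≤ totalWt a (primesLog z) := by
    rw [mul_sum, mul_sum, ← sum_sub_distrib, Real.exp_sum]
    refine prod_le_prod (fun p _ => (Real.exp_pos _).le) fun p _ => ?_
    rw [← inv_pow, div_eq_mul_inv, ← mul_pow]
    set u := a * (p : ℝ)⁻¹ with hu
    have hu0 : 0 ≤ u := by positivity
    rw [← Real.le_log_iff_exp_le (by positivity)]
    have h2 := Real.one_sub_inv_le_log_of_pos (show 0 < 1 + u by positivity)
    refine le_trans ?_ h2
    have h3 : 1 - (1 + u)⁻¹ = u / (1 + u) := by field_simp; ring
    rw [h3, le_div_iff₀ (by positivity)]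
    nlinarith [pow_nonneg hu0 3]
  refine le_trans ?_ h1
  have h4 := le_exp_sum_inv_primesLog z
  have h5 := sum_inv_sq_primesLog_le z
  rw [← Real.log_le_iff_le_exp hz] at h4
  rw [Real.rpow_def_of_pos hz, ← Real.exp_add, Real.exp_le_exp]
  nlinarith [mul_le_mul_of_nonneg_left h4 ha, mul_le_mul_of_nonneg_left h5 (sq_nonneg a)]

theorem exp_le_one_add_two_mul {u : ℝ} (h0 : 0 ≤ u) (h1 : u ≤ 1) : Real.exp u - 1 ≤ 2 * u := by
  have := Real.abs_exp_sub_one_le (x := u) (by rwa [abs_of_nonneg h0])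
  rw [abs_of_nonneg h0] at this
  exact (le_abs_self _).trans this

/-- Rankin's trick for the sets with ∑ log p > y: the exponential factor is at least 1 on them. For
log p ≤ z one has p^(1/z) - 1 ≤ 2 log p/z, and Mertens bounds the resulting sum independently of z.
-/
theorem rankin_sum_le {C a z y : ℝ} (hC : ∀ x : ℝ, 0 ≤ x →
    ∑ n ∈ upTo x, ArithmeticFunction.vonMangoldt n / n ≤ x + C) (hC0 : 0 ≤ C) (ha : 0 ≤ a)
    (hz : 1 ≤ z) :
    ∑ t ∈ (primesLog z).powerset, wt a t * Real.exp ((∑ p ∈ t, Real.log p - y) / z) ≤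
      Real.exp (-(y / z) + 2 * a * (1 + C)) * totalWt a (primesLog z) := by
  have hz0 : 0 < z := by linarith
  have h1 : ∀ t ∈ (primesLog z).powerset, wt a t * Real.exp ((∑ p ∈ t, Real.log p - y) / z) =
      Real.exp (-(y / z)) * (wt a t * ∏ p ∈ t, Real.exp (Real.log p / z)) := by
    intro t _
    rw [← Real.exp_sum, ← sum_div, sub_div, sub_eq_add_neg, Real.exp_add]; ring
  rw [sum_congr rfl h1, ← mul_sum, Real.exp_add, mul_assoc]
  refine mul_le_mul_of_nonneg_left ?_ (Real.exp_pos _).le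
  have h01 : ∀ p ∈ primesLog z, 0 ≤ Real.log p / z ∧ Real.log p / z ≤ 1 := fun p hp =>
    ⟨div_nonneg (Real.log_natCast_nonneg p) hz0.le, (div_le_one hz0).2 (mem_primesLog.1 hp).2⟩
  refine (sum_wt_mul_prod_le ha _ fun p hp => Real.one_le_exp (h01 p hp).1).trans ?_
  rw [mul_comm]
  refine mul_le_mul_of_nonneg_right (Real.exp_le_exp.2 ?_) (totalWt_pos ha _).le
  have h2 : ∑ p ∈ primesLog z, (Real.exp (Real.log p / z) - 1) / p ≤
      ∑ p ∈ primesLog z, 2 / z * (Real.log p / p) := by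
    refine sum_le_sum fun p hp => ?_
    rw [show 2 / z * (Real.log p / p) = 2 * (Real.log p / z) / p by ring]
    gcongr
    exact exp_le_one_add_two_mul (h01 p hp).1 (h01 p hp).2
  rw [← mul_sum] at h2
  have h3 := sum_log_div_primesLog_le hC hz0.le
  have h4 : 2 / z * ∑ p ∈ primesLog z, Real.log p / p ≤ 2 * (1 + C) := by
    calc 2 / z * ∑ p ∈ primesLog z, Real.log p / p ≤ 2 / z * (z + C) := by gcongr
      _ = 2 * (1 + C / z) := by field_simp
      _ ≤ _ := by gcongr; exact div_le_self hC0 hz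
  calc _ ≤ a * (2 * (1 + C)) := mul_le_mul_of_nonneg_left (h2.trans h4) ha
    _ = _ := by ring

theorem sum_part_inv_le (L z : ℝ) (j : ℕ) :
    ∑ p ∈ part L (primesLog z) j, (p : ℝ)⁻¹ ≤ VJ L j := by
  have hL : ∀ p ∈ part L (primesLog z) j, p ∈ upTo (cut L j) ∧ PJ L j p = 1 := by
    intro p hp
    have h := mem_filter.1 hp
    have hp' := (mem_primesLog.1 h.1).1
    exact ⟨mem_upTo.2 ⟨hp'.ne_zero, h.2.2⟩, rangeP_prime hp' h.2.1 h.2.2⟩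
  unfold VJ
  rw [ev_eq_sum' _ (logLen_PJ L j)]
  refine le_trans (le_of_eq ?_) (sum_le_sum_of_subset_of_nonneg (fun p hp => (hL p hp).1) ?_)
  · refine sum_congr rfl fun p hp => ?_
    rw [(hL p hp).2, one_smul, rchar_apply, Real.rpow_neg_one]
  · intro n _ _
    exact mul_nonneg (PJ_nonneg L j n) (by rw [rchar_apply]; positivity)

/-- A Chernoff bound for sets with more than ℓ primes in the j-th range. Doubling the weight of
these primes costs only exp(a V_j). -/
theorem count_sum_le {a : ℝ} (ha : 0 ≤ a) (z L : ℝ) (j ℓ : ℕ) :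
    ∑ t ∈ (primesLog z).powerset, wt a t * (2 ^ (part L t j).card * (1 / 2) ^ ℓ) ≤
      (1 / 2) ^ ℓ * Real.exp (a * VJ L j) * totalWt a (primesLog z) := by
  have h1 : ∀ t ∈ (primesLog z).powerset, wt a t * (2 ^ (part L t j).card * (1 / 2) ^ ℓ) =
      (1 / 2) ^ ℓ * (wt a t * ∏ p ∈ t,
        if cut L (j + 1) < Real.log p ∧ Real.log p ≤ cut L j then (2 : ℝ) else 1) := by
    intro t _
    rw [prod_ite, prod_const, prod_const_one, part]; ring
  rw [sum_congr rfl h1, ← mul_sum, mul_assoc]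
  refine mul_le_mul_of_nonneg_left ?_ (by positivity)
  refine (sum_wt_mul_prod_le ha _ fun p _ => by split_ifs <;> norm_num).trans ?_
  rw [mul_comm]
  refine mul_le_mul_of_nonneg_right (Real.exp_le_exp.2 ?_) (totalWt_pos ha _).le
  refine mul_le_mul_of_nonneg_left ?_ ha
  refine le_trans (le_of_eq ?_) (sum_part_inv_le L z j)
  rw [part, sum_filter]
  refine sum_congr rfl fun p _ => ?_
  split_ifs
  · rw [div_eq_mul_inv]; norm_num
  · simp

theorem sum_half_pow_deg_le {B : ℕ} (hB : 1 ≤ B) (J : ℕ) :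
    ∑ j ∈ range J, (1 / 2 : ℝ) ^ deg B j ≤ 2 * (1 / 2) ^ B := by
  have h1 : ∀ j ∈ range J, (1 / 2 : ℝ) ^ deg B j ≤ (1 / 2) ^ B * (1 / 2) ^ j := by
    intro j _
    rw [← pow_add]
    refine pow_le_pow_of_le_one (by norm_num) (by norm_num) ?_
    have : j + 1 ≤ 2 ^ j := Nat.lt_two_pow_self
    unfold deg
    nlinarith
  refine (sum_le_sum h1).trans ?_
  rw [← mul_sum, mul_comm]
  gcongr
  exact (Summable.sum_le_tsum _ (fun _ _ => by positivity) summable_geometric_two).trans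
    tsum_geometric_two.le

/-- Restricted to suitable squarefree n, the summand is at least (log n/k) ∏ k²/p. The sets of
primes with log p ≤ z = ηy have total weight of order y^(k²), and log n supplies the extra factor y.
Three kinds of bad sets are removed, each of weight at most a quarter of the total: product too
large, too many primes in some range, all primes below e^(εz). -/
theorem exists_le_sum_NK (k : ℝ) (hk : 0 < k) : ∃ B₀ : ℕ, ∃ c y₀ : ℝ, 0 < c ∧ 0 < y₀ ∧
    ∀ B : ℕ, B₀ ≤ B → ∀ (L y : ℝ) (J : ℕ), y₀ ≤ y → y ≤ L → cut L J < Real.log 2 →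
      c * y ^ (k ^ 2 + 1) ≤
        ∑ n ∈ upTo y, NK L J B k n * (LamL L * NK L J B k) n * (n : ℝ)⁻¹ := by
  obtain ⟨C1, hC1, hC⟩ := exists_sum_vonMangoldt_div_le
  obtain ⟨C2, hC2, hM⟩ := exists_exp_sum_inv_primesLog_le
  obtain ⟨V, hV, hVJ⟩ := exists_VJ_le
  set a := k ^ 2 with ha
  have ha0 : 0 < a := by positivity
  -- With this choice the overcrowded sets weigh at most 2·2^(-B1) exp(aV) ≤ 1/4 of the total.
  obtain ⟨B1, hB1⟩ := exists_pow_lt_of_lt_one (show (0 : ℝ) < (1 / 8) / Real.exp (a * V) by positivity)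
    (show (1 / 2 : ℝ) < 1 by norm_num)
  -- With y/z = 1/η the exponent in Rankin's bound becomes exactly -2, and e^(-2) ≤ 1/4.
  set η := 1 / (2 * a * (1 + C1) + 2) with hη
  have hη0 : 0 < η := by positivity
  have hη1 : η ≤ 1 := by
    rw [hη, div_le_one (by positivity)]
    have : 0 ≤ 2 * a * (1 + C1) := by positivity
    linarith
  set c1 := Real.exp (-a - a ^ 2) with hc1
  have hc10 : 0 < c1 := Real.exp_pos _
  -- Makes (C2 ε z)^a equal to a quarter of c1 z^a, the lower bound for the total weight.
  set ε := (c1 / 4) ^ (1 / a) / C2 with hε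
  have hε0 : 0 < ε := by positivity
  refine ⟨max 1 B1, ε * η / k * (c1 / 4 * η ^ a), 1 / η + 1 / (ε * η), by positivity, by positivity,
    fun B hB L y J hy hyL hJ => ?_⟩
  have hBB : B1 ≤ B := (le_max_right _ _).trans hB
  have hB1' : 1 ≤ B := (le_max_left _ _).trans hB
  have hηi : 0 < 1 / η := by positivity
  have hεηi : 0 < 1 / (ε * η) := by positivity
  have hy0 : 0 < y := by linarith
  set z := η * y with hz
  have hz1 : 1 ≤ z := by
    have : 1 / η ≤ y := by linarith
    rw [div_le_iff₀ hη0] at this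
    linarith
  have hz0 : 0 < z := by linarith
  have hzy : z ≤ y := mul_le_of_le_one_left hy0.le hη1
  have hεz : 1 ≤ ε * z := by
    have : 1 / (ε * η) ≤ y := by linarith
    rw [div_le_iff₀ (by positivity)] at this
    rw [hz]; linarith
  set S := primesLog z with hS
  set W := totalWt a S with hW
  have hW0 : 0 < W := totalWt_pos ha0.le S
  classical
  set good := S.powerset.filter fun t : Finset ℕ => (∑ p ∈ t, Real.log (p : ℕ) ≤ y) ∧
    (∀ j < J, (part L t j).card ≤ deg B j) ∧ ε * z ≤ ∑ p ∈ t, Real.log p with hgood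
  have hprime : ∀ t ∈ S.powerset, ∀ p ∈ t, p.Prime ∧ cut L J < Real.log p ∧ Real.log p ≤ L := by
    intro t ht p hp
    have h := mem_primesLog.1 (mem_powerset.1 ht hp)
    exact ⟨h.1, hJ.trans_le (Real.log_le_log (by norm_num) (by exact_mod_cast h.1.two_le)),
      h.2.trans (hzy.trans hyL)⟩
  -- the weight of the good sets
  have key : ∀ t ∈ S.powerset, wt a t ≤ (if t ∈ good then wt a t else 0) +
      wt a t * Real.exp ((∑ p ∈ t, Real.log p - y) / z) +
      ∑ j ∈ range J, wt a t * (2 ^ (part L t j).card * (1 / 2) ^ deg B j) +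
      (if t ⊆ primesLog (ε * z) then wt a t else 0) := by
    intro t ht
    have hw := wt_nonneg ha0.le t
    have e1 : 0 ≤ (if t ∈ good then wt a t else 0) := by split_ifs <;> simp [hw]
    have e2 : 0 ≤ wt a t * Real.exp ((∑ p ∈ t, Real.log p - y) / z) := by positivity
    have e3 : 0 ≤ ∑ j ∈ range J, wt a t * (2 ^ (part L t j).card * (1 / 2) ^ deg B j) :=
      sum_nonneg fun j _ => by positivity
    have e4 : 0 ≤ (if t ⊆ primesLog (ε * z) then wt a t else 0) := by split_ifs <;> simp [hw]
    by_cases h1 : ∑ p ∈ t, Real.log p ≤ y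
    · by_cases h2 : ∀ j < J, (part L t j).card ≤ deg B j
      · by_cases h3 : t ⊆ primesLog (ε * z)
        · rw [if_pos h3] at e4 ⊢; linarith
        · have : t ∈ good := by
            refine mem_filter.2 ⟨ht, h1, h2, ?_⟩
            obtain ⟨p, hp, hp'⟩ := not_subset.1 h3
            have h4 : ε * z < Real.log p := by
              by_contra h
              exact hp' (mem_primesLog.2 ⟨(hprime t ht p hp).1, not_lt.1 h⟩)
            exact h4.le.trans (single_le_sum (f := fun p : ℕ => Real.log p)
              (fun q _ => Real.log_natCast_nonneg q) hp)
          rw [if_pos this] at e1 ⊢; linarith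
      · push Not at h2
        obtain ⟨j, hj, hj'⟩ := h2
        have : wt a t ≤ ∑ j ∈ range J, wt a t * (2 ^ (part L t j).card * (1 / 2) ^ deg B j) := by
          refine le_trans ?_ (single_le_sum (f := fun j => wt a t * (2 ^ (part L t j).card *
            (1 / 2) ^ deg B j)) (fun j _ => by positivity) (mem_range.2 hj))
          refine le_mul_of_one_le_right hw ?_
          calc (1 : ℝ) = 2 ^ deg B j * (1 / 2) ^ deg B j := by rw [← mul_pow]; norm_num
            _ ≤ _ := by gcongr; norm_num
        linarith
    · have : wt a t ≤ wt a t * Real.exp ((∑ p ∈ t, Real.log p - y) / z) :=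
        le_mul_of_one_le_right hw (Real.one_le_exp (div_nonneg (by linarith) hz0.le))
      linarith
  have htot := sum_le_sum key
  rw [sum_wt, sum_add_distrib, sum_add_distrib, sum_add_distrib, sum_comm (t := range J),
    ← sum_filter, ← sum_filter] at htot
  have t1 : ∑ t ∈ S.powerset, wt a t * Real.exp ((∑ p ∈ t, Real.log p - y) / z) ≤ 1 / 4 * W := by
    refine (rankin_sum_le hC hC1 ha0.le hz1).trans ?_
    gcongr
    have : -(y / z) + 2 * a * (1 + C1) = -2 := by
      rw [hz, hη]; field_simp; ring
    rw [this, Real.exp_neg, show (1 / 4 : ℝ) = (4 : ℝ)⁻¹ by norm_num]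
    gcongr
    have := Real.exp_one_gt_d9
    rw [show (2 : ℝ) = 1 + 1 by norm_num, Real.exp_add]
    nlinarith
  have t2 : ∑ j ∈ range J, ∑ t ∈ S.powerset, wt a t * (2 ^ (part L t j).card * (1 / 2) ^ deg B j) ≤
      1 / 4 * W := by
    have h1 : ∀ j ∈ range J, ∑ t ∈ S.powerset, wt a t * (2 ^ (part L t j).card *
        (1 / 2) ^ deg B j) ≤ (1 / 2) ^ deg B j * (Real.exp (a * V) * W) := by
      intro j _
      refine (count_sum_le ha0.le z L j (deg B j)).trans ?_
      rw [mul_assoc]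
      gcongr
      exact hVJ L (by linarith) j
    refine (sum_le_sum h1).trans ?_
    rw [← sum_mul]
    have h2 := sum_half_pow_deg_le hB1' J
    have h3 : (1 / 2 : ℝ) ^ B ≤ (1 / 2) ^ B1 := pow_le_pow_of_le_one (by norm_num) (by norm_num) hBB
    rw [lt_div_iff₀ (Real.exp_pos _)] at hB1
    calc _ ≤ 2 * (1 / 2) ^ B1 * (Real.exp (a * V) * W) := by gcongr; linarith
      _ = 2 * ((1 / 2) ^ B1 * Real.exp (a * V)) * W := by ring
      _ ≤ 2 * (1 / 8) * W := by gcongr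
      _ = _ := by ring
  have t3 : ∑ t ∈ S.powerset with t ⊆ primesLog (ε * z), wt a t ≤ 1 / 4 * W := by
    calc ∑ t ∈ S.powerset with t ⊆ primesLog (ε * z), wt a t
        ≤ ∑ t ∈ (primesLog (ε * z)).powerset, wt a t :=
          sum_le_sum_of_subset_of_nonneg (fun t ht => mem_powerset.2 (mem_filter.1 ht).2)
            fun t _ _ => wt_nonneg ha0.le t
      _ ≤ Real.exp (a * ∑ p ∈ primesLog (ε * z), (p : ℝ)⁻¹) := by
          rw [sum_wt]; exact totalWt_le_exp ha0.le _
      _ = Real.exp (∑ p ∈ primesLog (ε * z), (p : ℝ)⁻¹) ^ a := by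
          rw [← Real.exp_mul, mul_comm]
      _ ≤ (C2 * (ε * z)) ^ a := by gcongr; exact hM _ hεz
      _ = 1 / 4 * (c1 * z ^ a) := by
          rw [hε, show C2 * ((c1 / 4) ^ (1 / a) / C2 * z) = (c1 / 4) ^ (1 / a) * z by field_simp,
            Real.mul_rpow (by positivity) hz0.le, ← Real.rpow_mul (by positivity),
            one_div_mul_cancel ha0.ne', Real.rpow_one]
          ring
      _ ≤ 1 / 4 * W := by gcongr; exact le_totalWt ha0.le hz0
  have hgw : c1 / 4 * z ^ a ≤ ∑ t ∈ good, wt a t := by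
    have h1 : S.powerset.filter (· ∈ good) = good := by
      ext t; simp only [mem_filter, hgood]; tauto
    rw [h1] at htot
    have h2 := le_totalWt ha0.le hz0
    linarith
  -- passing to integers
  have hinj : Set.InjOn (fun t : Finset ℕ => ∏ q ∈ t, q) (good : Set (Finset ℕ)) := by
    intro t ht t' ht' h
    have h1 := Nat.primeFactors_prod fun p hp => (hprime t (mem_filter.1 ht).1 p hp).1
    have h2 := Nat.primeFactors_prod fun p hp => (hprime t' (mem_filter.1 ht').1 p hp).1
    simp only at h
    rw [← h1, ← h2, h]
  have hlog : ∀ t ∈ S.powerset, Real.log ((∏ q ∈ t, q : ℕ) : ℝ) = ∑ p ∈ t, Real.log p := by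
    intro t ht
    rw [Nat.cast_prod, Real.log_prod]
    intro p hp
    exact_mod_cast (hprime t ht p hp).1.ne_zero
  calc ε * η / k * (c1 / 4 * η ^ a) * y ^ (a + 1) = ε * z / k * (c1 / 4 * z ^ a) := by
        rw [hz, Real.mul_rpow hη0.le hy0.le, Real.rpow_add hy0, Real.rpow_one]; ring
    _ ≤ ε * z / k * ∑ t ∈ good, wt a t := by gcongr
    _ ≤ ∑ t ∈ good, NK L J B k (∏ q ∈ t, q) * (LamL L * NK L J B k) (∏ q ∈ t, q) *
          ((∏ q ∈ t, q : ℕ) : ℝ)⁻¹ := by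
        rw [mul_sum]
        refine sum_le_sum fun t ht => ?_
        have ht' := mem_filter.1 ht
        have hp := hprime t ht'.1
        have h1 := pow_card_le_NK hk.le (fun p h => (hp p h).1) (fun p h => (hp p h).2.1)
          (fun p h => (hp p h).2.2) ht'.2.2.1
        have h2 := le_LamL_mul_NK hk (fun p h => (hp p h).1) (fun p h => (hp p h).2.1)
          (fun p h => (hp p h).2.2) ht'.2.2.1
        have h3 : k ^ t.card / k * (ε * z) ≤ (LamL L * NK L J B k) (∏ q ∈ t, q) :=
          le_trans (by gcongr; exact ht'.2.2.2) h2
        have h4 : wt a t = k ^ t.card * k ^ t.card * ((∏ q ∈ t, q : ℕ) : ℝ)⁻¹ := by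
          rw [wt, prod_div_distrib, prod_const, ha, Nat.cast_prod, div_eq_mul_inv]; ring
        rw [h4, show ε * z / k * (k ^ t.card * k ^ t.card * ((∏ q ∈ t, q : ℕ) : ℝ)⁻¹) =
          k ^ t.card * (k ^ t.card / k * (ε * z)) * ((∏ q ∈ t, q : ℕ) : ℝ)⁻¹ by ring]
        refine mul_le_mul_of_nonneg_right ?_ (by positivity)
        exact mul_le_mul h1 h3 (by positivity) (NK_nonneg L J B hk.le _)
    _ ≤ _ := by
        rw [← sum_image (f := fun n : ℕ => NK L J B k n * (LamL L * NK L J B k) n * (n : ℝ)⁻¹) hinj]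
        refine sum_le_sum_of_subset_of_nonneg (fun n hn => ?_) fun n _ _ => ?_
        · obtain ⟨t, ht, rfl⟩ := mem_image.1 hn
          have ht' := mem_filter.1 ht
          refine mem_upTo.2 ⟨prod_ne_zero_iff.2 fun q hq => (hprime t ht'.1 q hq).1.ne_zero, ?_⟩
          rw [hlog t ht'.1]
          exact ht'.2.1
        · exact mul_nonneg (mul_nonneg (NK_nonneg L J B hk.le n)
            (mul_nonneg' (LamL_nonneg L) (NK_nonneg L J B hk.le) n)) (by positivity)

/-! ### Mean squares of coefficients -/

/-- The mean square `∑ f(n)² / n`. -/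
noncomputable def nrm (f : AF) : ℝ := ev (rchar 1) (f.pmul f)

theorem LogLen.pmul {f g : AF} {N : ℝ} (hf : LogLen f N) : LogLen (f.pmul g) N := by
  intro n hn
  rw [ArithmeticFunction.pmul_apply] at hn
  exact hf n (left_ne_zero_of_mul hn)

theorem nrm_nonneg (f : AF) : 0 ≤ nrm f :=
  ev_rchar_nonneg (fun n => by rw [ArithmeticFunction.pmul_apply]; exact mul_self_nonneg _) 1

theorem rchar_nonneg (σ : ℝ) (n : ℕ) : 0 ≤ rchar σ n := by rw [rchar_apply]; positivity

theorem nrm_eq {f : AF} {N : ℝ} (hf : LogLen f N) :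
    nrm f = ∑ n ∈ upTo N, f n ^ 2 * rchar 1 n := by
  rw [nrm, ev_eq_sum' _ hf.pmul]
  exact sum_congr rfl fun n _ => by rw [ArithmeticFunction.pmul_apply, smul_eq_mul, sq]

theorem ev_sub_le_of_nonneg {u : AF} {N M : ℝ} (hu : ∀ n, 0 ≤ u n) (hN : LogLen u N) :
    ∑ n ∈ upTo M, u n * rchar 1 n ≤ ev (rchar 1) u := by
  rw [ev_eq_sum' _ (hN.mono (le_max_left N M))]
  refine sum_le_sum_of_subset_of_nonneg (fun n hn => ?_) fun n _ _ =>
    mul_nonneg (hu n) (rchar_nonneg 1 n)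
  rw [mem_upTo] at hn ⊢
  exact ⟨hn.1, hn.2.trans (le_max_right _ _)⟩

theorem logLen_prod_aeval {L : ℝ} (hL : 0 ≤ L) (J : ℕ) (q : ℕ → ℝ[X]) :
    LogLen (∏ j ∈ range J, aeval (PJ L j) (q j))
      (∑ j ∈ range J, ((q j).natDegree : ℝ) * cut L j) :=
  LogLen.prod fun j _ => LogLen.aeval (cut_nonneg hL j) (logLen_PJ L j) le_rfl

theorem ev_prod_fockPoly {L : ℝ} (hL : 0 ≤ L) (J : ℕ) (q : ℕ → ℝ[X]) :
    ev (rchar 1) (∏ j ∈ range J, aeval (PJ L j) (fockPoly (q j))) =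
      ∏ j ∈ range J, fock (q j) (VJ L j) := by
  rw [ev_prod _ fun j _ => LogLen.aeval (cut_nonneg hL j) (logLen_PJ L j) le_rfl]
  exact prod_congr rfl fun j _ => by
    rw [ev_aeval _ (cut_nonneg hL j) (logLen_PJ L j), ← aeval_fockPoly]; rfl

theorem exists_sqDom_prod_aeval (L : ℝ) (J : ℕ) (q : ℕ → ℝ[X]) : ∃ M : ℕ,
    SqDom (∏ j ∈ range J, aeval (PJ L j) (q j))
      (∏ j ∈ range J, aeval (PJ L j) (fockPoly (q j))) (expProd L J M) :=
  ⟨∑ j ∈ range J, (q j).natDegree, SqDom.prod fun j hj => sqDom_aeval (PJ_nonneg L j)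
    ((single_le_sum (f := fun j => (q j).natDegree) (fun _ _ => Nat.zero_le _) hj).trans
      (Nat.le_succ _))⟩

theorem fockPoly_prod_nonneg (L : ℝ) (J : ℕ) (q : ℕ → ℝ[X]) (n : ℕ) :
    0 ≤ (∏ j ∈ range J, aeval (PJ L j) (fockPoly (q j))) n :=
  prod_nonneg' (fun j _ => aeval_nonneg (PJ_nonneg L j)
    (fun r => by rw [coeff_fockPoly]; positivity)) n

/-- The basic mean-square estimate: the bound is what independent complex Gaussians of variance V_j
in place of the P_j would give. In Cauchy–Schwarz the factor independent of the q_j is a coefficient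
of `expProd`, at most 1; the other factor sums multiplicatively over j. -/
theorem nrm_prod_aeval_le {L : ℝ} (hL : 0 ≤ L) (J : ℕ) (q : ℕ → ℝ[X]) :
    nrm (∏ j ∈ range J, aeval (PJ L j) (q j)) ≤ ∏ j ∈ range J, fock (q j) (VJ L j) := by
  obtain ⟨M, hM⟩ := exists_sqDom_prod_aeval L J q
  rw [nrm_eq (logLen_prod_aeval hL J q), ← ev_prod_fockPoly hL J q]
  refine le_trans (sum_le_sum fun n _ => ?_) (ev_sub_le_of_nonneg (fockPoly_prod_nonneg L J q)
    (logLen_prod_aeval hL J fun j => fockPoly (q j)))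
  refine mul_le_mul_of_nonneg_right ((hM n).2.2.trans ?_) (rchar_nonneg 1 n)
  exact mul_le_of_le_one_right (hM n).1 (expProd_le_one hL J M n)

theorem logLen_LamL (L : ℝ) : LogLen (LamL L) L := by
  intro n hn
  rw [LamL, logD_apply] at hn
  exact logLen_rangeP 0 L n (right_ne_zero_of_mul hn)

theorem LamL_le (L : ℝ) (n : ℕ) : LamL L n ≤ ArithmeticFunction.vonMangoldt n := by
  rw [LamL, logD_rangeP]
  split_ifs
  · rfl
  · exact ArithmeticFunction.vonMangoldt_nonneg

theorem LamL_eq {L : ℝ} {n : ℕ} (hn : Real.log n ≤ L) :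
    LamL L n = ArithmeticFunction.vonMangoldt n := by
  rw [LamL, logD_rangeP]
  split_ifs with h
  · rfl
  · rcases Nat.lt_or_ge n 2 with h2 | h2
    · interval_cases n <;> simp
    · exact absurd ⟨Real.log_pos (by exact_mod_cast h2), hn⟩ h

theorem LamL_mul_le_log {a : AF} (L : ℝ) (ha : ∀ n, a n ≤ 1) (n : ℕ) :
    (LamL L * a) n ≤ Real.log n := by
  rw [← sum_divisorsAntidiagonal_vonMangoldt, ArithmeticFunction.mul_apply]
  exact sum_le_sum fun x _ => (mul_le_of_le_one_right (LamL_nonneg L _) (ha _)).trans (LamL_le L _)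

/-- The same Cauchy–Schwarz after convolving with Λ: the universal factor is now at most log n ≤ L,
and the other one sums to at most (L + C) times the product of norms. -/
theorem sum_LamL_mul_sq_le {C L : ℝ} (hC : ∀ x : ℝ, 0 ≤ x →
    ∑ n ∈ upTo x, ArithmeticFunction.vonMangoldt n / n ≤ x + C) (hL : 0 ≤ L) (J : ℕ)
    (q : ℕ → ℝ[X]) :
    ∑ n ∈ upTo L, (LamL L * ∏ j ∈ range J, aeval (PJ L j) (q j)) n ^ 2 * rchar 1 n ≤
      L * (L + C) * ∏ j ∈ range J, fock (q j) (VJ L j) := by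
  obtain ⟨M, hM⟩ := exists_sqDom_prod_aeval L J q
  set u := ∏ j ∈ range J, aeval (PJ L j) (fockPoly (q j)) with hu
  have hu0 : ∀ n, 0 ≤ u n := fockPoly_prod_nonneg L J q
  have hulen := logLen_prod_aeval hL J fun j => fockPoly (q j)
  have h2 := (SqDom.self (LamL_nonneg L)).mul hM
  have h3 : ∑ n ∈ upTo L, (LamL L * ∏ j ∈ range J, aeval (PJ L j) (q j)) n ^ 2 * rchar 1 n ≤
      L * ∑ n ∈ upTo L, (LamL L * u) n * rchar 1 n := by
    rw [mul_sum]
    refine sum_le_sum fun n hn => ?_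
    rw [← mul_assoc]
    refine mul_le_mul_of_nonneg_right ((h2 n).2.2.trans ?_) (rchar_nonneg 1 n)
    rw [mul_comm]
    refine mul_le_mul_of_nonneg_right ?_ (h2 n).1
    exact (LamL_mul_le_log L (expProd_le_one hL J M) n).trans
      (mem_upTo.1 hn).2
  refine h3.trans ?_
  rw [mul_assoc]
  refine mul_le_mul_of_nonneg_left ?_ hL
  refine (ev_sub_le_of_nonneg (mul_nonneg' (LamL_nonneg L) hu0)
    ((logLen_LamL L).mul hulen)).trans ?_
  rw [ev_mul _ (logLen_LamL L) hulen, ev_prod_fockPoly hL]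
  refine mul_le_mul_of_nonneg_right ?_ (prod_nonneg fun j _ => fock_nonneg _ (VJ_nonneg L j))
  refine le_trans ?_ (hC L hL)
  rw [ev_eq_sum' _ (logLen_LamL L)]
  refine sum_le_sum fun n _ => ?_
  rw [smul_eq_mul, rchar_apply, Real.rpow_neg_one, div_eq_mul_inv]
  exact mul_le_mul_of_nonneg_right (LamL_le L n) (by positivity)

/-- Degrees grow like 2^j while the ranges shrink like 4^(-j). The total length therefore converges
even though the degrees tend to infinity fast enough for the truncation errors to be summable. -/
theorem sum_deg_mul_cut_le {L : ℝ} (hL : 0 ≤ L) (B J : ℕ) :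
    ∑ j ∈ range J, (deg B j : ℝ) * cut L j ≤ 2 * B * L := by
  have h1 : ∀ j ∈ range J, (deg B j : ℝ) * cut L j = B * L * (1 / 2) ^ j := by
    intro j _
    unfold deg cut
    push_cast
    rw [show (4 : ℝ) = 2 * 2 by norm_num, mul_pow, div_pow, one_pow]
    field_simp
  rw [sum_congr rfl h1, ← mul_sum]
  have : ∑ j ∈ range J, (1 / 2 : ℝ) ^ j ≤ 2 :=
    (Summable.sum_le_tsum _ (fun _ _ => by positivity) summable_geometric_two).trans
      tsum_geometric_two.le
  calc B * L * ∑ j ∈ range J, (1 / 2 : ℝ) ^ j ≤ B * L * 2 := by gcongr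
    _ = _ := by ring

theorem logLen_prod_deg {L : ℝ} (hL : 0 ≤ L) (B J κ : ℕ) {q : ℕ → ℝ[X]}
    (hq : ∀ j, (q j).natDegree ≤ κ * deg B j) :
    LogLen (∏ j ∈ range J, aeval (PJ L j) (q j)) (2 * κ * B * L) := by
  refine (logLen_prod_aeval hL J q).mono ?_
  calc ∑ j ∈ range J, ((q j).natDegree : ℝ) * cut L j
      ≤ ∑ j ∈ range J, κ * (deg B j * cut L j) := by
        refine sum_le_sum fun j _ => ?_
        rw [← mul_assoc]
        exact mul_le_mul_of_nonneg_right (by exact_mod_cast hq j) (cut_nonneg hL j)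
    _ ≤ κ * (2 * B * L) := by
        rw [← mul_sum]; gcongr; exact sum_deg_mul_cut_le hL B J
    _ = _ := by ring

theorem logLen_NK {L : ℝ} (hL : 0 ≤ L) (J B : ℕ) (a : ℝ) : LogLen (NK L J B a) (2 * B * L) := by
  have := logLen_prod_deg hL B J 1 (q := fun j => texp (deg B j) a) fun j => by
    rw [one_mul]; exact natDegree_texp_le _ _
  simpa [NK] using this

theorem exp_sum_VJ_le {C L : ℝ} (hC : Real.exp (∑ j ∈ range J, VJ L j) ≤ C * L) {a : ℝ}
    (ha : 0 ≤ a) (hC0 : 0 ≤ C) (hL : 0 ≤ L) :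
    ∏ j ∈ range J, Real.exp (a * VJ L j) ≤ C ^ a * L ^ a := by
  rw [← Real.exp_sum, ← mul_sum, mul_comm, Real.exp_mul, ← Real.mul_rpow hC0 hL]
  exact Real.rpow_le_rpow (Real.exp_pos _).le hC ha

theorem exists_nrm_NK_le (k : ℝ) : ∃ C : ℝ, 0 < C ∧ ∀ L : ℝ, 1 ≤ L → ∀ J B : ℕ,
    nrm (NK L J B k) ≤ C * L ^ (k ^ 2) := by
  obtain ⟨C, hC, h⟩ := exists_exp_sum_VJ_le
  refine ⟨C ^ (k ^ 2), by positivity, fun L hL J B => ?_⟩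
  refine (nrm_prod_aeval_le (by linarith) J _).trans ?_
  refine le_trans (prod_le_prod (fun j _ => fock_nonneg _ (VJ_nonneg L j)) fun j _ =>
    fock_texp_le (deg B j) k (VJ_nonneg L j)) ?_
  exact exp_sum_VJ_le (h L hL J) (sq_nonneg k) hC.le (by linarith)

/-! ### The truncated approximation of the derivative -/

/-- The function `log n` restricted to `log n ≤ L`. -/
noncomputable def lgL (L : ℝ) : AF := ⟨fun n => if Real.log n ≤ L then Real.log n else 0, by simp⟩

theorem lgL_apply (L : ℝ) (n : ℕ) : lgL L n = if Real.log n ≤ L then Real.log n else 0 := rfl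

theorem logLen_lgL (L : ℝ) : LogLen (lgL L) L := by
  intro n hn
  rw [lgL_apply] at hn
  by_contra h
  exact hn (if_neg h)

/-- The coefficients of `(∑ log n n⁻ˢ) N₋₁ N_k`. -/
noncomputable def DD (L : ℝ) (J B : ℕ) (k : ℝ) : AF := lgL L * NK L J B (-1) * NK L J B k

/-- `DD` restricted to `log n ≤ L`. -/
noncomputable def rho (L : ℝ) (J B : ℕ) (k : ℝ) : AF :=
  ⟨fun n => if Real.log n ≤ L then DD L J B k n else 0, by simp⟩

theorem rho_apply (L : ℝ) (J B : ℕ) (k : ℝ) (n : ℕ) :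
    rho L J B k n = if Real.log n ≤ L then DD L J B k n else 0 := rfl

theorem logLen_rho (L : ℝ) (J B : ℕ) (k : ℝ) : LogLen (rho L J B k) L := by
  intro n hn
  rw [rho_apply] at hn
  by_contra h
  exact hn (if_neg h)

theorem log_le_of_dvd {L : ℝ} {d n : ℕ} (h : d ∣ n) (hn : n ≠ 0) (hL : Real.log n ≤ L) :
    Real.log d ≤ L := by
  refine le_trans (Real.log_le_log ?_ ?_) hL
  · exact_mod_cast Nat.pos_of_dvd_of_pos h (Nat.pos_of_ne_zero hn)
  · exact_mod_cast Nat.le_of_dvd (Nat.pos_of_ne_zero hn) h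

theorem mul_congr_log {f f' g : AF} {L : ℝ} (h : ∀ n : ℕ, n ≠ 0 → Real.log n ≤ L → f n = f' n) {n : ℕ}
    (hL : Real.log n ≤ L) : (f * g) n = (f' * g) n := by
  simp only [ArithmeticFunction.mul_apply]
  refine sum_congr rfl fun x hx => ?_
  rw [Nat.mem_divisorsAntidiagonal] at hx
  rw [h x.1 (left_ne_zero_of_mul (hx.1 ▸ hx.2)) (log_le_of_dvd ⟨x.2, hx.1.symm⟩ hx.2 hL)]

theorem LamL_mul_expProd {L : ℝ} (hL : 0 ≤ L) {J M n : ℕ} (hJ : cut L J < Real.log 2)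
    (hM : Real.exp L < 2 ^ (M + 1)) (hnL : Real.log n ≤ L) :
    (LamL L * expProd L J M) n = Real.log n := by
  rw [ArithmeticFunction.mul_apply, ← sum_divisorsAntidiagonal_vonMangoldt]
  refine sum_congr rfl fun x hx => ?_
  rw [Nat.mem_divisorsAntidiagonal] at hx
  rw [LamL_eq (log_le_of_dvd ⟨x.2, hx.1.symm⟩ hx.2 hnL), expProd_eq_one hL hJ hM, mul_one]
  exact mem_upTo.2 ⟨right_ne_zero_of_mul (hx.1 ▸ hx.2),
    log_le_of_dvd ⟨x.1, by rw [mul_comm]; exact hx.1.symm⟩ hx.2 hnL⟩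

/-- The product approximating `ζ · ζ⁻¹ · ζ^k`. -/
noncomputable def tripleProd (L : ℝ) (J B M : ℕ) (k : ℝ) : AF :=
  ∏ j ∈ range J, aeval (PJ L j) (texpTriple (M + 1) (deg B j) k)

/-- For log n ≤ L the logarithm is Λ * 1, and 1 is given by `expProd`. Its factors then merge range
by range with those of N_(-1) and N_k, reducing Y to the situation of `sum_LamL_mul_sq_le`. -/
theorem DD_eq {L : ℝ} (hL : 0 ≤ L) {J M n : ℕ} (B : ℕ) (k : ℝ) (hJ : cut L J < Real.log 2)
    (hM : Real.exp L < 2 ^ (M + 1)) (hnL : Real.log n ≤ L) :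
    DD L J B k n = (LamL L * tripleProd L J B M k) n := by
  have h1 : LamL L * tripleProd L J B M k =
      (LamL L * expProd L J M) * (NK L J B (-1) * NK L J B k) := by
    rw [mul_assoc, tripleProd, expProd, NK, NK, ← prod_mul_distrib, ← prod_mul_distrib]
    congr 1
    refine prod_congr rfl fun j _ => ?_
    rw [texpTriple, map_mul, map_mul, mul_assoc]
  rw [h1, DD, mul_assoc]
  refine mul_congr_log (fun m _ hmL => ?_) hnL
  rw [LamL_mul_expProd hL hJ hM hmL, lgL_apply, if_pos hmL]

theorem exists_exp_lt_two_pow (L : ℝ) : ∃ M : ℕ, Real.exp L < 2 ^ (M + 1) ∧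
    ⌊Real.exp L⌋₊ < 2 ^ (M + 1) := by
  obtain ⟨M, hM⟩ := pow_unbounded_of_one_lt (Real.exp L) (one_lt_two (α := ℝ))
  have h : Real.exp L < 2 ^ (M + 1) := hM.trans (by rw [pow_succ]; linarith [pow_pos (zero_lt_two (α := ℝ)) M])
  refine ⟨M, h, ?_⟩
  rw [Nat.floor_lt (Real.exp_pos L).le]
  exact_mod_cast h

/-- B even makes all truncation degrees even, so every factor of `tripleProd` dominates the
corresponding factor of N_k in all degrees visible below e^L. Convolution of nonnegative functions
preserves this. -/
theorem le_rho {L : ℝ} (hL : 0 ≤ L) {J B n : ℕ} (hB : Even B) {k : ℝ} (hk : 0 ≤ k)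
    (hJ : cut L J < Real.log 2) (hn : n ∈ upTo L) :
    (LamL L * NK L J B k) n ≤ rho L J B k n := by
  obtain ⟨M, hM, hM'⟩ := exists_exp_lt_two_pow L
  rw [rho_apply, if_pos (mem_upTo.1 hn).2, DD_eq hL B k hJ hM (mem_upTo.1 hn).2]
  refine (mul_le_mul_upTo (N := ⌊Real.exp L⌋₊) (fun n _ => ⟨LamL_nonneg L n, le_rfl⟩)
    (prod_le_prod_upTo fun j _ => aeval_le_upTo (PJ_nonneg L j) (PJ_one L j) hM'
      (coeff_texp_nonneg _ hk) fun r hr => le_coeff_texpTriple ?_ hk hr) n (mem_Icc.1 hn).2).2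
  exact hB.mul_right _

/-- Each norm is exp(k² V_j) up to a factor 1 + O(2^(-deg)). Since ∑ 2^(-deg) is bounded, the
product of these factors is bounded uniformly in the number of ranges. -/
theorem exists_prod_fock_texpTriple_le (k : ℝ) (hk : 0 ≤ k) : ∃ C : ℝ, 0 < C ∧ ∀ L : ℝ, 1 ≤ L →
    ∀ J B M : ℕ, 1 ≤ B → (∀ j < J, deg B j ≤ M + 1) →
    ∏ j ∈ range J, fock (texpTriple (M + 1) (deg B j) k) (VJ L j) ≤ C * L ^ (k ^ 2) := by
  obtain ⟨C, hC, h⟩ := exists_exp_sum_VJ_le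
  obtain ⟨V, hV, hVJ⟩ := exists_VJ_le
  set K := Real.exp (2 * (k + 2) ^ 2 * V) with hK
  refine ⟨Real.exp (K * 2) * C ^ (k ^ 2), by positivity, fun L hL J B M hB hM => ?_⟩
  have h1 : ∀ j ∈ range J, fock (texpTriple (M + 1) (deg B j) k) (VJ L j) ≤
      Real.exp (K * (1 / 2) ^ deg B j) * Real.exp (k ^ 2 * VJ L j) := by
    intro j hj
    refine (fock_texpTriple_le hk (hM j (mem_range.1 hj)) (VJ_nonneg L j)).trans ?_
    have h2 : Real.exp (2 * (k + 2) ^ 2 * VJ L j) ≤ K := by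
      rw [hK]; gcongr; exact hVJ L (by linarith) j
    have h3 : 1 ≤ Real.exp (k ^ 2 * VJ L j) :=
      Real.one_le_exp (mul_nonneg (sq_nonneg k) (VJ_nonneg L j))
    have h4 := Real.add_one_le_exp (K * (1 / 2 : ℝ) ^ deg B j)
    have h5 : 0 ≤ K * (1 / 2 : ℝ) ^ deg B j := by positivity
    calc _ ≤ Real.exp (k ^ 2 * VJ L j) + (1 / 2) ^ deg B j * K := by gcongr
      _ ≤ (K * (1 / 2 : ℝ) ^ deg B j + 1) * Real.exp (k ^ 2 * VJ L j) := by nlinarith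
      _ ≤ _ := by gcongr
  refine (prod_le_prod (fun j _ => fock_nonneg _ (VJ_nonneg L j)) h1).trans ?_
  rw [prod_mul_distrib, ← Real.exp_sum, ← mul_sum, mul_assoc]
  have h6 := exp_sum_VJ_le (h L hL J) (sq_nonneg k) hC.le (by linarith)
  have h7 : ∑ j ∈ range J, (1 / 2 : ℝ) ^ deg B j ≤ 2 :=
    (sum_half_pow_deg_le hB J).trans (by
      have : (1 / 2 : ℝ) ^ B ≤ 1 := pow_le_one₀ (by norm_num) (by norm_num)
      linarith)
  gcongr

theorem exists_nrm_rho_le (k : ℝ) (hk : 0 ≤ k) : ∃ C : ℝ, 0 < C ∧ ∀ L : ℝ, 1 ≤ L →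
    ∀ J B : ℕ, 1 ≤ B → cut L J < Real.log 2 → nrm (rho L J B k) ≤ C * L ^ (k ^ 2 + 2) := by
  obtain ⟨C1, hC1, hC⟩ := exists_sum_vonMangoldt_div_le
  obtain ⟨C2, hC2, hF⟩ := exists_prod_fock_texpTriple_le k hk
  refine ⟨(1 + C1) * C2, by positivity, fun L hL J B hB hJ => ?_⟩
  have hL0 : 0 < L := by linarith
  obtain ⟨M0, hM0, -⟩ := exists_exp_lt_two_pow L
  -- Large enough both for `expProd` to be exact below e^L and for M + 1 to exceed every truncation
  -- degree.
  set M := max M0 (deg B J) with hM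
  have hMexp : Real.exp L < 2 ^ (M + 1) :=
    hM0.trans_le (pow_le_pow_right₀ (by norm_num) (by omega))
  have hdeg : ∀ j < J, deg B j ≤ M + 1 := by
    intro j hj
    have : deg B j ≤ deg B J := Nat.mul_le_mul_left B (Nat.pow_le_pow_right (by norm_num) hj.le)
    omega
  rw [nrm_eq (logLen_rho L J B k)]
  have h1 : ∀ n ∈ upTo L, rho L J B k n ^ 2 * rchar 1 n =
      (LamL L * tripleProd L J B M k) n ^ 2 * rchar 1 n := by
    intro n hn
    rw [rho_apply, if_pos (mem_upTo.1 hn).2, DD_eq hL0.le B k hJ hMexp (mem_upTo.1 hn).2]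
  rw [sum_congr rfl h1]
  refine (sum_LamL_mul_sq_le hC hL0.le J _).trans ?_
  have h2 := hF L hL J B M hB hdeg
  calc L * (L + C1) * ∏ j ∈ range J, fock (texpTriple (M + 1) (deg B j) k) (VJ L j)
      ≤ L * (L + C1 * L) * (C2 * L ^ (k ^ 2)) := by
        have h3 : C1 ≤ C1 * L := le_mul_of_one_le_right hC1 hL
        refine mul_le_mul (by gcongr) h2 (prod_nonneg fun j _ => fock_nonneg _ (VJ_nonneg L j)) ?_
        positivity
    _ = _ := by
        rw [Real.rpow_add hL0, Real.rpow_two]; ring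

/-! ### Pointwise bounds for truncated exponentials -/

theorem aeval_texp_complex (ℓ : ℕ) (a : ℝ) (z : ℂ) :
    aeval z (texp ℓ a) = ∑ r ∈ range (ℓ + 1), ((a : ℂ) * z) ^ r / r.factorial := by
  unfold texp
  rw [map_sum]
  refine sum_congr rfl fun r _ => ?_
  rw [aeval_monomial]
  simp only [Complex.coe_algebraMap]
  push_cast
  rw [mul_pow]; ring

theorem pow_div_factorial_le (n : ℕ) : ((n : ℝ)) ^ n / n.factorial ≤ Real.exp n := by
  have := sum_exp_le (Nat.cast_nonneg (α := ℝ) n) {n}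
  simpa using this

/-- With n^n/n! ≤ e^n, the Taylor remainder is at most about exp(-3(ℓ+1)). This is small even
relative to |e^w| ≥ e^(-|w|), because |w| ≤ (ℓ+1)/2. -/
theorem norm_aeval_texp_sub_exp_le {ℓ : ℕ} {a : ℝ} {z : ℂ}
    (h : ‖(a : ℂ) * z‖ ≤ Real.exp (-4) * ℓ) :
    ‖aeval z (texp ℓ a) - Complex.exp (a * z)‖ ≤ Real.exp (-ℓ) * ‖Complex.exp (a * z)‖ := by
  rw [aeval_texp_complex]
  set w := (a : ℂ) * z
  have he4 : Real.exp (-4) ≤ 1 / 2 := by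
    rw [Real.exp_neg, one_div]
    gcongr
    have := Real.add_one_le_exp 4
    linarith
  have hn : (0 : ℝ) < ((ℓ + 1 : ℕ) : ℝ) := by positivity
  have h1 : ‖w‖ ≤ Real.exp (-4) * ((ℓ + 1 : ℕ) : ℝ) := by
    refine h.trans ?_; push_cast; gcongr; linarith
  have h2 : ‖w‖ / ((ℓ + 1).succ : ℕ) ≤ 1 / 2 := by
    rw [div_le_iff₀ (by positivity)]
    refine h1.trans ?_
    push_cast
    nlinarith [Real.exp_pos (-4)]
  have h3 := Complex.exp_bound' h2
  rw [norm_sub_rev]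
  refine h3.trans ?_
  have h4 : ‖w‖ ^ (ℓ + 1) / (ℓ + 1).factorial ≤ Real.exp (-3 * ((ℓ + 1 : ℕ) : ℝ)) := by
    calc ‖w‖ ^ (ℓ + 1) / (ℓ + 1).factorial
        ≤ (Real.exp (-4) * ((ℓ + 1 : ℕ) : ℝ)) ^ (ℓ + 1) / (ℓ + 1).factorial := by gcongr
      _ = Real.exp (-4) ^ (ℓ + 1) * (((ℓ + 1 : ℕ) : ℝ) ^ (ℓ + 1) / (ℓ + 1).factorial) := by
          rw [mul_pow]; ring
      _ ≤ Real.exp (-4) ^ (ℓ + 1) * Real.exp ((ℓ + 1 : ℕ) : ℝ) := by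
          gcongr; exact pow_div_factorial_le (ℓ + 1)
      _ = _ := by rw [← Real.exp_nat_mul, ← Real.exp_add]; congr 1; ring
  have h5 : Real.exp (-‖w‖) ≤ ‖Complex.exp w‖ := by
    rw [Complex.norm_exp]
    gcongr
    exact neg_le_of_abs_le (Complex.abs_re_le_norm w)
  have h6 : (2 : ℝ) ≤ Real.exp 1 := by have := Real.add_one_le_exp 1; linarith
  calc ‖w‖ ^ (ℓ + 1) / (ℓ + 1).factorial * 2
      ≤ Real.exp (-3 * ((ℓ + 1 : ℕ) : ℝ)) * Real.exp 1 := by gcongr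
    _ ≤ Real.exp (-ℓ) * Real.exp (-‖w‖) := by
        rw [← Real.exp_add, ← Real.exp_add]
        refine Real.exp_le_exp.2 ?_
        have : ‖w‖ ≤ 1 / 2 * (ℓ + 1 : ℕ) := h1.trans (by gcongr)
        push_cast at this ⊢
        have := Nat.cast_nonneg (α := ℝ) ℓ
        linarith
    _ ≤ _ := by gcongr

theorem norm_aeval_texp_le_of_small {ℓ : ℕ} {a : ℝ} {z : ℂ}
    (h : ‖(a : ℂ) * z‖ ≤ Real.exp (-4) * ℓ) :
    ‖aeval z (texp ℓ a)‖ ≤ (1 + Real.exp (-ℓ)) * ‖Complex.exp (a * z)‖ := by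
  have h1 := norm_aeval_texp_sub_exp_le h
  have h2 := norm_le_norm_add_norm_sub' (aeval z (texp ℓ a)) (Complex.exp (a * z))
  linarith

/-- When |z| ≥ cℓ, each power |z|^r with r ≤ ℓ is at most (|z|/(cℓ))^ℓ (cℓ)^r, and the remaining sum
is an exponential series. -/
theorem norm_aeval_texp_le_of_large {ℓ : ℕ} {a c : ℝ} {z : ℂ} (hc : 0 < c) (hℓ : 0 < ℓ)
    (h : c * ℓ ≤ ‖z‖) :
    ‖aeval z (texp ℓ a)‖ ≤ (‖z‖ / (c * ℓ)) ^ ℓ * Real.exp (|a| * (c * ℓ)) := by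
  have hcl : 0 < c * ℓ := by positivity
  rw [aeval_texp_complex]
  refine (norm_sum_le _ _).trans ?_
  refine le_trans (sum_le_sum (g := fun r => (‖z‖ / (c * ℓ)) ^ ℓ *
    ((|a| * (c * ℓ)) ^ r / r.factorial)) fun r hr => ?_) ?_
  · rw [norm_div, norm_pow, norm_mul, Complex.norm_real, Complex.norm_natCast, Real.norm_eq_abs]
    have h1 : 1 ≤ ‖z‖ / (c * ℓ) := by rw [le_div_iff₀ hcl]; linarith
    have h2 : (‖z‖ / (c * ℓ)) ^ r ≤ (‖z‖ / (c * ℓ)) ^ ℓ :=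
      pow_le_pow_right₀ h1 (by simpa [Nat.lt_succ_iff] using hr)
    calc (|a| * ‖z‖) ^ r / r.factorial
        = (‖z‖ / (c * ℓ)) ^ r * ((|a| * (c * ℓ)) ^ r / r.factorial) := by
          rw [← mul_div_assoc, ← mul_pow]; congr 2; field_simp
      _ ≤ _ := by gcongr
  · rw [← mul_sum]
    gcongr
    exact sum_exp_le (by positivity) _

/-! ### Majorising powers of the mollified product by squares of Dirichlet polynomials -/

/-- On this disc both polynomials are close to true exponentials, and |e^(kz)|^(q/k) |e^(-z)|^q = 1.
Only the square survives. -/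
theorem norm_aeval_texp_rpow_small {k v q : ℝ} (hk : 0 < k) (hq : 0 < q)
    (hvq : v * q = 2 + q / k) {ℓ : ℕ} {z : ℂ} (hz : ‖z‖ ≤ Real.exp (-4) / (k + 1) * ℓ) :
    ‖aeval z (texp ℓ k)‖ ^ (v * q) * ‖aeval z (texp ℓ (-1))‖ ^ q ≤
      (1 + Real.exp (-ℓ)) ^ (q / k + q) * ‖aeval z (texp ℓ k)‖ ^ 2 := by
  have hk1 : 0 < k + 1 := by linarith
  have hz1 : ‖z‖ * (k + 1) ≤ Real.exp (-4) * ℓ := by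
    rw [div_mul_eq_mul_div, le_div_iff₀ hk1] at hz; exact hz
  have hzk := mul_nonneg (norm_nonneg z) hk.le
  have h1 : ‖aeval z (texp ℓ k)‖ ≤ (1 + Real.exp (-ℓ)) * ‖Complex.exp (k * z)‖ := by
    refine norm_aeval_texp_le_of_small ?_
    rw [norm_mul, Complex.norm_real, Real.norm_eq_abs, abs_of_pos hk]
    nlinarith [norm_nonneg z]
  have h2 : ‖aeval z (texp ℓ (-1))‖ ≤ (1 + Real.exp (-ℓ)) * ‖Complex.exp (-z)‖ := by
    have h := norm_aeval_texp_le_of_small (ℓ := ℓ) (a := -1) (z := z) (by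
      rw [norm_mul, Complex.norm_real]; norm_num; nlinarith)
    simpa using h
  have hα : 0 < 1 + Real.exp (-ℓ) := by positivity
  rw [hvq, Real.rpow_add' (norm_nonneg _) (by positivity), Real.rpow_two]
  have h3 : ‖aeval z (texp ℓ k)‖ ^ (q / k) ≤
      (1 + Real.exp (-ℓ)) ^ (q / k) * Real.exp (q * z.re) := by
    calc _ ≤ ((1 + Real.exp (-ℓ)) * ‖Complex.exp (k * z)‖) ^ (q / k) := by gcongr
      _ = _ := by
        rw [Real.mul_rpow hα.le (norm_nonneg _), Complex.norm_exp, ← Real.exp_mul]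
        congr 2
        rw [Complex.re_ofReal_mul]
        field_simp
  have h4 : ‖aeval z (texp ℓ (-1))‖ ^ q ≤
      (1 + Real.exp (-ℓ)) ^ q * Real.exp (-(q * z.re)) := by
    calc _ ≤ ((1 + Real.exp (-ℓ)) * ‖Complex.exp (-z)‖) ^ q := by gcongr
      _ = _ := by
        rw [Real.mul_rpow hα.le (norm_nonneg _), Complex.norm_exp, ← Real.exp_mul]
        congr 2
        rw [Complex.neg_re]
        ring
  calc ‖aeval z (texp ℓ k)‖ ^ 2 * ‖aeval z (texp ℓ k)‖ ^ (q / k) * ‖aeval z (texp ℓ (-1))‖ ^ q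
      ≤ ‖aeval z (texp ℓ k)‖ ^ 2 * ((1 + Real.exp (-ℓ)) ^ (q / k) * Real.exp (q * z.re)) *
        ((1 + Real.exp (-ℓ)) ^ q * Real.exp (-(q * z.re))) := by gcongr
    _ = (1 + Real.exp (-ℓ)) ^ (q / k) * (1 + Real.exp (-ℓ)) ^ q * ‖aeval z (texp ℓ k)‖ ^ 2 *
        (Real.exp (q * z.re) * Real.exp (-(q * z.re))) := by ring
    _ = _ := by
        rw [← Real.exp_add, add_neg_cancel, Real.exp_zero, mul_one, ← Real.rpow_add hα]

/-- The polynomial dominating the truncated exponentials outside a disc of radius `c ℓ`. -/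
noncomputable def tailPoly (κ ℓ : ℕ) (c b : ℝ) : ℝ[X] :=
  monomial (κ * ℓ) (Real.exp (b * ℓ) / (c * ℓ) ^ (κ * ℓ))

theorem norm_aeval_tailPoly (κ ℓ : ℕ) {c : ℝ} (b : ℝ) (hc : 0 < c) (z : ℂ) :
    ‖aeval z (tailPoly κ ℓ c b)‖ = Real.exp (b * ℓ) * (‖z‖ / (c * ℓ)) ^ (κ * ℓ) := by
  rw [tailPoly, aeval_monomial, norm_mul, norm_pow, Complex.coe_algebraMap, Complex.norm_real,
    Real.norm_eq_abs, abs_of_nonneg (by positivity), div_pow]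
  ring

/-- Off the disc both factors are bounded by powers of |z|/(cℓ) ≥ 1. Degree κℓ suffices since (v+1)q
≤ 2κ, and the exponential constant is halved because the monomial is squared. -/
theorem norm_aeval_texp_rpow_large {k v q c : ℝ} (hk : 0 < k) (hv : 0 < v) (hq : 0 < q)
    (hc : 0 < c) {κ ℓ : ℕ} (hℓ : 0 < ℓ) (hκ : (v + 1) * q ≤ 2 * κ) {z : ℂ} (hz : c * ℓ ≤ ‖z‖) :
    ‖aeval z (texp ℓ k)‖ ^ (v * q) * ‖aeval z (texp ℓ (-1))‖ ^ q ≤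
      ‖aeval z (tailPoly κ ℓ c ((k * v + 1) * q * c / 2))‖ ^ 2 := by
  have hcl : 0 < c * ℓ := by positivity
  have h1 := norm_aeval_texp_le_of_large (a := k) hc hℓ hz
  have h2 := norm_aeval_texp_le_of_large (a := -1) hc hℓ hz
  rw [abs_of_pos hk] at h1
  rw [abs_neg, abs_one, one_mul] at h2
  rw [norm_aeval_tailPoly κ ℓ _ hc]
  set x := ‖z‖ / (c * ℓ) with hx
  have hx1 : 1 ≤ x := by rw [hx, le_div_iff₀ hcl]; linarith
  have hx0 : 0 < x := by linarith
  calc ‖aeval z (texp ℓ k)‖ ^ (v * q) * ‖aeval z (texp ℓ (-1))‖ ^ q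
      ≤ (x ^ ℓ * Real.exp (k * (c * ℓ))) ^ (v * q) * (x ^ ℓ * Real.exp (c * ℓ)) ^ q := by
        gcongr
    _ = x ^ (ℓ * ((v + 1) * q)) * Real.exp ((k * v + 1) * q * c * ℓ) := by
        rw [Real.mul_rpow (by positivity) (by positivity), Real.mul_rpow (by positivity)
          (by positivity), ← Real.rpow_natCast, ← Real.rpow_mul hx0.le, ← Real.rpow_mul hx0.le,
          ← Real.exp_mul, ← Real.exp_mul]
        rw [show (ℓ : ℝ) * ((v + 1) * q) = ℓ * (v * q) + ℓ * q by ring, Real.rpow_add hx0,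
          show (k * v + 1) * q * c * ℓ = k * (c * ℓ) * (v * q) + c * ℓ * q by ring, Real.exp_add]
        ring
    _ ≤ x ^ ((ℓ : ℝ) * (2 * κ)) * Real.exp ((k * v + 1) * q * c * ℓ) := by
        gcongr
    _ = _ := by
        rw [mul_pow, ← Real.exp_nat_mul, ← pow_mul, ← Real.rpow_natCast]
        rw [mul_comm]
        congr 2
        · push_cast; ring
        · push_cast; ring

/-- With (κℓ)! ≤ (κℓ)^(κℓ) the norm is at most e^(2bℓ) (κV/(c²ℓ))^(κℓ). The base is tiny once ℓ is
large compared with V. -/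
theorem fock_tailPoly_le {κ ℓ : ℕ} {c b V : ℝ} (hκ : 1 ≤ κ) (hc : 0 < c) (hV : 0 ≤ V) (hb : 0 ≤ b)
    (hℓ : 0 < ℓ) (h : κ * V / c ^ 2 * Real.exp (2 * b + 1) ≤ ℓ) :
    fock (tailPoly κ ℓ c b) V ≤ Real.exp (-ℓ) := by
  rw [tailPoly, fock_monomial]
  have hl : (0 : ℝ) < ℓ := by exact_mod_cast hℓ
  have h1 : ((κ * ℓ).factorial : ℝ) ≤ ((κ : ℝ) * ℓ) ^ (κ * ℓ) := by
    exact_mod_cast Nat.factorial_le_pow (κ * ℓ)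
  set r := κ * V / (c ^ 2 * ℓ) with hr
  have hr0 : 0 ≤ r := by positivity
  have hr1 : r ≤ Real.exp (-(2 * b + 1)) := by
    rw [Real.exp_neg, ← one_div, le_div_iff₀ (Real.exp_pos _), hr]
    have : κ * V / (c ^ 2 * ℓ) * Real.exp (2 * b + 1) =
      κ * V / c ^ 2 * Real.exp (2 * b + 1) / ℓ := by field_simp
    rw [this, div_le_one hl]
    exact h
  have hr2 : r ≤ 1 := hr1.trans (Real.exp_le_one_iff.2 (by linarith))
  calc ((κ * ℓ).factorial : ℝ) * (Real.exp (b * ℓ) / (c * ℓ) ^ (κ * ℓ)) ^ 2 * V ^ (κ * ℓ)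
      ≤ ((κ : ℝ) * ℓ) ^ (κ * ℓ) * (Real.exp (b * ℓ) / (c * ℓ) ^ (κ * ℓ)) ^ 2 * V ^ (κ * ℓ) := by
        gcongr
    _ = Real.exp (b * ℓ) ^ 2 * (κ * ℓ * V / ((c * ℓ) * (c * ℓ))) ^ (κ * ℓ) := by
        rw [div_pow, div_pow, mul_pow _ V, mul_pow (c * (ℓ : ℝ)) (c * ℓ)]; ring
    _ = Real.exp (2 * b) ^ ℓ * (r ^ κ) ^ ℓ := by
        rw [← Real.exp_nat_mul, ← Real.exp_nat_mul, ← pow_mul, hr]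
        congr 2
        · push_cast; ring
        · field_simp
    _ ≤ Real.exp (2 * b) ^ ℓ * (Real.exp (-(2 * b + 1))) ^ ℓ := by
        gcongr
        exact (pow_le_of_le_one hr0 hr2 (by omega)).trans hr1
    _ = Real.exp (-ℓ) := by
        rw [← mul_pow, ← Real.exp_add, ← Real.exp_nat_mul]
        congr 1; ring

/-- The factors of the Dirichlet polynomials dominating the mollified product. -/
noncomputable def majPoly (k m c b : ℝ) (κ B : ℕ) (U : Finset ℕ) (j : ℕ) : ℝ[X] :=
  if j ∈ U then C (√((1 + Real.exp (-(deg B j : ℕ))) ^ m)) * texp (deg B j) k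
  else tailPoly κ (deg B j) c b

/-- The Dirichlet polynomials dominating the mollified product. -/
noncomputable def majAF (L : ℝ) (J : ℕ) (k m c b : ℝ) (κ B : ℕ) (U : Finset ℕ) : AF :=
  ∏ j ∈ range J, aeval (PJ L j) (majPoly k m c b κ B U j)

theorem natDegree_majPoly_le (k m c b : ℝ) {κ : ℕ} (hκ : 1 ≤ κ) (B : ℕ) (U : Finset ℕ) (j : ℕ) :
    (majPoly k m c b κ B U j).natDegree ≤ κ * deg B j := by
  unfold majPoly
  split_ifs
  · exact (natDegree_C_mul_le _ _).trans ((natDegree_texp_le _ _).trans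
      (Nat.le_mul_of_pos_left _ hκ))
  · exact natDegree_monomial_le _

theorem ev_prod_aeval {R : Type*} [CommRing R] [Algebra ℝ R] (χ : ℕ →* R) {L : ℝ} (hL : 0 ≤ L)
    (J : ℕ) (q : ℕ → ℝ[X]) :
    ev χ (∏ j ∈ range J, aeval (PJ L j) (q j)) =
      ∏ j ∈ range J, aeval (ev χ (PJ L j)) (q j) := by
  rw [ev_prod _ fun j _ => LogLen.aeval (cut_nonneg hL j) (logLen_PJ L j) le_rfl]
  exact prod_congr rfl fun j _ => ev_aeval _ (cut_nonneg hL j) (logLen_PJ L j) _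

/-- Pointwise majorant and mean square estimate for `|N_k|^{vq} |N_{-1}|^q`. -/
theorem exists_majorant (k v q : ℝ) (hk : 0 < k) (hv : 0 < v) (hq : 0 < q)
    (hvq : v * q = 2 + q / k) : ∃ κ B₀ : ℕ, ∃ C m c b : ℝ, 1 ≤ κ ∧ 0 < C ∧
    ∀ B : ℕ, B₀ ≤ B → ∀ L : ℝ, 1 ≤ L → ∀ J : ℕ,
      (∀ s : ℂ, ‖ev (cchar s) (NK L J B k)‖ ^ (v * q) * ‖ev (cchar s) (NK L J B (-1))‖ ^ q ≤
        ∑ U ∈ (range J).powerset, ‖ev (cchar s) (majAF L J k m c b κ B U)‖ ^ 2) ∧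
      (∀ U, LogLen (majAF L J k m c b κ B U) (2 * κ * B * L)) ∧
      ∑ U ∈ (range J).powerset, nrm (majAF L J k m c b κ B U) ≤ C * L ^ (k ^ 2) := by
  obtain ⟨C1, hC1, hexp⟩ := exists_exp_sum_VJ_le
  obtain ⟨V, hV, hVJ⟩ := exists_VJ_le
  obtain ⟨κ, hκ⟩ := exists_nat_ge (max 1 ((v + 1) * q))
  have hκ1 : 1 ≤ κ := by exact_mod_cast (le_max_left _ _).trans hκ
  have hκ2 : (v + 1) * q ≤ 2 * κ := by
    have := (le_max_right _ _).trans hκ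
    linarith [Nat.cast_nonneg (α := ℝ) κ]
  set c := Real.exp (-4) / (k + 1) with hc
  have hc0 : 0 < c := by positivity
  set b := (k * v + 1) * q * c / 2 with hb
  have hb0 : 0 < b := by positivity
  set m := q / k + q with hm
  have hm0 : 0 < m := by positivity
  obtain ⟨B1, hB1⟩ := exists_nat_ge (κ * V / c ^ 2 * Real.exp (2 * b + 1))
  refine ⟨κ, max 1 B1, Real.exp ((m + 1) * 2) * C1 ^ (k ^ 2), m, c, b, hκ1, by positivity,
    fun B hB L hL J => ?_⟩
  have hL0 : 0 ≤ L := by linarith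
  have hB1' : 1 ≤ B := (le_max_left _ _).trans hB
  have hdeg : ∀ j, B ≤ deg B j := fun j => Nat.le_mul_of_pos_right B (by positivity)
  have hdeg0 : ∀ j, 0 < deg B j := fun j => lt_of_lt_of_le hB1' (hdeg j)
  have hdegB : ∀ j, κ * V / c ^ 2 * Real.exp (2 * b + 1) ≤ deg B j := fun j =>
    hB1.trans (by exact_mod_cast ((le_max_right _ _).trans hB).trans (hdeg j))
  refine ⟨fun s => ?_, fun U => logLen_prod_deg hL0 B J κ (natDegree_majPoly_le k m c b hκ1 B U), ?_⟩
  · have hsplit : ∀ U ∈ (range J).powerset, ‖ev (cchar s) (majAF L J k m c b κ B U)‖ ^ 2 =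
        (∏ j ∈ U, ((1 + Real.exp (-(deg B j : ℕ))) ^ m *
          ‖aeval (ev (cchar s) (PJ L j)) (texp (deg B j) k)‖ ^ 2)) *
        ∏ j ∈ range J \ U, ‖aeval (ev (cchar s) (PJ L j)) (tailPoly κ (deg B j) c b)‖ ^ 2 := by
      intro U hU
      rw [majAF, ev_prod_aeval _ hL0, norm_prod, ← prod_pow,
        ← prod_sdiff (mem_powerset.1 hU), mul_comm]
      congr 1
      · refine prod_congr rfl fun j hj => ?_
        rw [majPoly, if_pos hj, map_mul, aeval_C, norm_mul, mul_pow, Complex.coe_algebraMap,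
          Complex.norm_real, Real.norm_eq_abs, sq_abs, Real.sq_sqrt (by positivity)]
      · refine prod_congr rfl fun j hj => ?_
        rw [majPoly, if_neg (mem_sdiff.1 hj).2]
    -- The sum over U is the expanded product over j of (near term + tail term), so it suffices to
    -- majorise one range at a time.
    rw [sum_congr rfl hsplit, ← prod_add, NK, NK, ev_prod_aeval _ hL0, ev_prod_aeval _ hL0,
      norm_prod, norm_prod, ← Real.finsetProd_rpow _ _ fun _ _ => norm_nonneg _,
      ← Real.finsetProd_rpow _ _ fun _ _ => norm_nonneg _, ← prod_mul_distrib]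
    refine prod_le_prod (fun j _ => by positivity) fun j _ => ?_
    rcases le_total ‖ev (cchar s) (PJ L j)‖ (c * (deg B j : ℕ)) with h | h
    · refine (norm_aeval_texp_rpow_small hk hq hvq h).trans ?_
      exact le_add_of_nonneg_right (by positivity)
    · refine (norm_aeval_texp_rpow_large hk hv hq hc0 (hdeg0 j) hκ2 h).trans ?_
      exact le_add_of_nonneg_left (by positivity)
  · have h1 : ∀ U ∈ (range J).powerset, nrm (majAF L J k m c b κ B U) ≤
        (∏ j ∈ U, ((1 + Real.exp (-(deg B j : ℕ))) ^ m * Real.exp (k ^ 2 * VJ L j))) *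
        ∏ j ∈ range J \ U, Real.exp (-(deg B j : ℕ)) := by
      intro U hU
      refine (nrm_prod_aeval_le hL0 J _).trans ?_
      rw [← prod_sdiff (mem_powerset.1 hU), mul_comm]
      refine mul_le_mul ?_ ?_ (prod_nonneg fun j _ => fock_nonneg _ (VJ_nonneg L j))
        (prod_nonneg fun j _ => by positivity)
      · refine prod_le_prod (fun j _ => fock_nonneg _ (VJ_nonneg L j)) fun j hj => ?_
        rw [majPoly, if_pos hj, fock_smul, Real.sq_sqrt (by positivity)]
        gcongr
        exact fock_texp_le _ _ (VJ_nonneg L j)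
      · refine prod_le_prod (fun j _ => fock_nonneg _ (VJ_nonneg L j)) fun j hj => ?_
        rw [majPoly, if_neg (mem_sdiff.1 hj).2]
        refine fock_tailPoly_le hκ1 hc0 (VJ_nonneg L j) hb0.le (hdeg0 j) (le_trans ?_ (hdegB j))
        gcongr
        exact hVJ L (by linarith) j
    refine (sum_le_sum h1).trans ?_
    rw [← prod_add]
    -- The tail term e^(-deg) and the factor (1 + e^(-deg))^m are both absorbed into exp((m+1)
    -- 2^(-deg)), whose product over j is bounded.
    have h2 : ∀ j ∈ range J, (1 + Real.exp (-(deg B j : ℕ))) ^ m * Real.exp (k ^ 2 * VJ L j) +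
        Real.exp (-(deg B j : ℕ)) ≤
        Real.exp ((m + 1) * (1 / 2) ^ deg B j) * Real.exp (k ^ 2 * VJ L j) := by
      intro j _
      set e := Real.exp (-(deg B j : ℕ)) with he
      have he0 : 0 < e := Real.exp_pos _
      have he2 : e ≤ (1 / 2) ^ deg B j := by
        rw [he, show (-(deg B j : ℕ) : ℝ) = (deg B j : ℕ) * (-1) by ring, Real.exp_nat_mul]
        gcongr
        rw [Real.exp_neg, one_div]
        gcongr
        have := Real.add_one_le_exp 1; linarith
      have h3 : (1 + e) ^ m ≤ Real.exp (m * e) := by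
        rw [mul_comm, Real.exp_mul]
        gcongr
        have := Real.add_one_le_exp e; linarith
      have h4 : 1 ≤ Real.exp (m * e) := Real.one_le_exp (by positivity)
      have h5 : 1 ≤ Real.exp (k ^ 2 * VJ L j) :=
        Real.one_le_exp (mul_nonneg (sq_nonneg k) (VJ_nonneg L j))
      have h6 : 1 ≤ Real.exp (m * e) * Real.exp (k ^ 2 * VJ L j) := one_le_mul_of_one_le_of_one_le h4 h5
      calc (1 + e) ^ m * Real.exp (k ^ 2 * VJ L j) + e
          ≤ Real.exp (m * e) * Real.exp (k ^ 2 * VJ L j) +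
            e * (Real.exp (m * e) * Real.exp (k ^ 2 * VJ L j)) := by
            gcongr
            exact le_mul_of_one_le_right he0.le h6
        _ = Real.exp (m * e) * (e + 1) * Real.exp (k ^ 2 * VJ L j) := by ring
        _ ≤ Real.exp (m * e) * Real.exp e * Real.exp (k ^ 2 * VJ L j) := by
            gcongr; exact Real.add_one_le_exp e
        _ = Real.exp ((m + 1) * e) * Real.exp (k ^ 2 * VJ L j) := by
            rw [← Real.exp_add (m * e)]; congr 2; ring
        _ ≤ _ := by gcongr
    refine (prod_le_prod (fun j _ => by positivity) h2).trans ?_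
    rw [prod_mul_distrib, ← Real.exp_sum, ← mul_sum, mul_assoc]
    have h6 := exp_sum_VJ_le (hexp L hL J) (sq_nonneg k) hC1.le hL0
    have h7 : ∑ j ∈ range J, (1 / 2 : ℝ) ^ deg B j ≤ 2 :=
      (sum_half_pow_deg_le hB1' J).trans (by
        have : (1 / 2 : ℝ) ^ B ≤ 1 := pow_le_one₀ (by norm_num) (by norm_num)
        linarith)
    gcongr

open MeasureTheory

/-! ### Gaussian mean values of Dirichlet polynomials -/

/-- The Gaussian weight of centre `τ` and width `Δ`. -/
noncomputable def gw (τ Δ t : ℝ) : ℝ := Real.exp (-((t - τ) / Δ) ^ 2)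

theorem gw_pos (τ Δ t : ℝ) : 0 < gw τ Δ t := Real.exp_pos _

theorem continuous_gw (τ Δ : ℝ) : Continuous (gw τ Δ) := by unfold gw; fun_prop

theorem gw_eq {Δ : ℝ} (τ t : ℝ) : gw τ Δ t = Real.exp (-(1 / Δ ^ 2) * (t - τ) ^ 2) := by
  unfold gw; congr 1; rw [div_pow]; ring

theorem integrable_gw (τ : ℝ) {Δ : ℝ} (hΔ : 0 < Δ) : Integrable (gw τ Δ) := by
  have := (integrable_exp_neg_mul_sq (b := 1 / Δ ^ 2) (by positivity)).comp_sub_right τ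
  exact this.congr (Filter.Eventually.of_forall fun t => (gw_eq τ t).symm)

theorem integral_gw (τ : ℝ) {Δ : ℝ} (hΔ : 0 < Δ) : ∫ t, gw τ Δ t = √Real.pi * Δ := by
  simp_rw [gw_eq]
  rw [integral_sub_right_eq_self (fun t : ℝ => Real.exp (-(1 / Δ ^ 2) * t ^ 2)) τ,
    integral_gaussian, div_div_eq_mul_div, div_one, Real.sqrt_mul Real.pi_pos.le,
    Real.sqrt_sq hΔ.le]

theorem norm_integral_gw_mul_cexp (τ ξ : ℝ) {Δ : ℝ} (hΔ : 0 < Δ) :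
    ‖∫ t : ℝ, (gw τ Δ t : ℂ) * Complex.exp (-(t * ξ) * Complex.I)‖ =
      √Real.pi * Δ * Real.exp (-(Δ * ξ) ^ 2 / 4) := by
  have h1 : ∀ t : ℝ, (gw τ Δ t : ℂ) * Complex.exp (-(t * ξ) * Complex.I) =
      Complex.exp (-(τ * ξ) * Complex.I) * (fun u : ℝ => Complex.exp (Complex.I * (-ξ : ℝ) * u) *
        Complex.exp (-((1 / Δ ^ 2 : ℝ) : ℂ) * u ^ 2)) (t - τ) := by
    intro t
    rw [gw_eq]
    push_cast
    simp only [← Complex.exp_add]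
    congr 1
    ring
  simp_rw [h1]
  rw [integral_const_mul, integral_sub_right_eq_self (fun u : ℝ =>
    Complex.exp (Complex.I * (-ξ : ℝ) * u) * Complex.exp (-((1 / Δ ^ 2 : ℝ) : ℂ) * u ^ 2)) τ,
    fourierIntegral_gaussian (by rw [Complex.ofReal_re]; positivity), norm_mul, norm_mul]
  have e1 : ‖Complex.exp (-(τ * ξ) * Complex.I)‖ = 1 := by
    have := Complex.norm_exp_ofReal_mul_I (-(τ * ξ))
    push_cast at this; exact this
  have e2 : ((Real.pi : ℂ) / ((1 / Δ ^ 2 : ℝ) : ℂ)) ^ (1 / 2 : ℂ) = ((√Real.pi * Δ : ℝ) : ℂ) := by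
    rw [← Complex.ofReal_div, show (1 / 2 : ℂ) = ((1 / 2 : ℝ) : ℂ) by push_cast; rfl,
      ← Complex.ofReal_cpow (by positivity), ← Real.sqrt_eq_rpow, div_div_eq_mul_div, div_one,
      Real.sqrt_mul Real.pi_pos.le, Real.sqrt_sq hΔ.le]
  have e3 : (-((-ξ : ℝ) : ℂ) ^ 2 / (4 * ((1 / Δ ^ 2 : ℝ) : ℂ))) =
      ((-(Δ * ξ) ^ 2 / 4 : ℝ) : ℂ) := by
    push_cast
    have : (Δ : ℂ) ≠ 0 := by exact_mod_cast hΔ.ne'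
    field_simp
  rw [e1, e2, e3, one_mul, Complex.norm_real, Complex.norm_exp, Complex.ofReal_re, Real.norm_eq_abs,
    abs_of_nonneg (by positivity)]

theorem cchar_line (σ t : ℝ) {n : ℕ} (hn : n ≠ 0) : cchar (σ + t * Complex.I) n =
    (rchar σ n : ℂ) * Complex.exp (-(t * Real.log n) * Complex.I) := by
  have hn' : (n : ℂ) ≠ 0 := by exact_mod_cast hn
  have hpos : (0 : ℝ) < n := by positivity
  rw [cchar_apply, rchar_apply, Complex.cpow_def_of_ne_zero hn', Real.rpow_def_of_pos hpos,
    Complex.ofReal_exp, ← Complex.exp_add, ← Complex.natCast_log]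
  congr 1
  push_cast
  ring

theorem integrable_gw_mul {τ Δ : ℝ} (hΔ : 0 < Δ) {f : ℝ → ℂ} (hf : Continuous f) {C : ℝ}
    (hC : ∀ t, ‖f t‖ ≤ C) : Integrable fun t => (gw τ Δ t : ℂ) * f t :=
  (integrable_gw τ hΔ).ofReal.mul_bdd hf.aestronglyMeasurable (Filter.Eventually.of_forall hC)

/-- For n < m one has log(m/n) ≥ 1 - n/m ≥ 1/m ≥ e^(-N). This spacing makes the off-diagonal terms
negligible once Δ is much larger than e^N. -/
theorem abs_log_sub_log_ge {m n : ℕ} {N : ℝ} (hm : m ∈ upTo N) (hn : n ∈ upTo N) (h : m ≠ n) :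
    Real.exp (-N) ≤ |Real.log m - Real.log n| := by
  wlog hmn : n < m generalizing m n
  · rw [abs_sub_comm]
    exact this hn hm h.symm (by omega)
  have hn0 : (0 : ℝ) < n := by have := (mem_upTo.1 hn).1; positivity
  have hm0 : (0 : ℝ) < m := by have := (mem_upTo.1 hm).1; positivity
  refine le_trans ?_ (le_abs_self _)
  have h1 := Real.log_le_sub_one_of_pos (show (0 : ℝ) < n / m by positivity)
  rw [Real.log_div hn0.ne' hm0.ne'] at h1
  have h2 : (m : ℝ) ≤ Real.exp N := by
    rw [← Real.log_le_iff_le_exp hm0]; exact (mem_upTo.1 hm).2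
  have h3 : Real.exp (-N) ≤ 1 / m := by
    rw [Real.exp_neg, one_div]; gcongr
  have h4 : (n : ℝ) + 1 ≤ m := by exact_mod_cast hmn
  have h5 : (n : ℝ) / m ≤ 1 - 1 / m := by
    rw [div_le_iff₀ hm0, sub_mul, div_mul_cancel₀ _ hm0.ne']; linarith
  linarith

theorem card_upTo_le {N : ℝ} : ((upTo N).card : ℝ) ≤ Real.exp N := by
  unfold upTo
  rw [Nat.card_Icc, Nat.add_sub_cancel]
  exact Nat.floor_le (Real.exp_pos N).le

theorem sum_abs_le_sqrt {x : AF} {N σ : ℝ} (hx : LogLen x N) (hσ : 1 / 2 ≤ σ) :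
    ∑ n ∈ upTo N, |x n| * rchar σ n ≤ √(Real.exp N * nrm x) := by
  refine Real.le_sqrt_of_sq_le ((sq_sum_le_card_mul_sum_sq).trans ?_)
  refine mul_le_mul card_upTo_le ?_ (sum_nonneg fun _ _ => sq_nonneg _) (Real.exp_pos _).le
  rw [nrm_eq hx]
  refine sum_le_sum fun n hn => ?_
  rw [mul_pow, sq_abs]
  refine mul_le_mul_of_nonneg_left ?_ (sq_nonneg _)
  have : rchar σ n ^ 2 = rchar (2 * σ) n := by
    rw [rchar_apply, rchar_apply, ← Real.rpow_natCast, ← Real.rpow_mul (Nat.cast_nonneg n)]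
    congr 1; push_cast; ring
  rw [this]
  exact rchar_anti (by linarith) n (mem_upTo.1 hn).1

/-- Approximate orthogonality of Dirichlet polynomials for a Gaussian weight. -/
theorem norm_integral_gw_mul_sub_le {x y : AF} {N σ τ Δ : ℝ} (hx : LogLen x N) (hy : LogLen y N)
    (hσ : 1 / 2 ≤ σ) (hΔ : 0 < Δ) :
    ‖(∫ t : ℝ, (gw τ Δ t : ℂ) * (ev (cchar (σ + t * Complex.I)) x *
        (starRingEnd ℂ) (ev (cchar (σ + t * Complex.I)) y))) -
      ((√Real.pi * Δ * ∑ n ∈ upTo N, x n * y n * rchar (2 * σ) n : ℝ) : ℂ)‖ ≤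
    √Real.pi * Δ * (Real.exp (-(Δ * Real.exp (-N)) ^ 2 / 4) * Real.exp N *
      √(nrm x * nrm y)) := by
  set e : ℕ → ℕ → ℝ → ℂ := fun m n t =>
    Complex.exp (-(t * ((Real.log m - Real.log n : ℝ) : ℂ)) * Complex.I) with he
  have hexp : ∀ t : ℝ, (gw τ Δ t : ℂ) * (ev (cchar (σ + t * Complex.I)) x *
      (starRingEnd ℂ) (ev (cchar (σ + t * Complex.I)) y)) =
      ∑ m ∈ upTo N, ∑ n ∈ upTo N, ((x m * y n * (rchar σ m * rchar σ n) : ℝ) : ℂ) *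
        ((gw τ Δ t : ℂ) * e m n t) := by
    intro t
    rw [ev_eq_sum' _ hx, ev_eq_sum' _ hy, map_sum, sum_mul_sum, mul_sum]
    refine sum_congr rfl fun m hm => ?_
    rw [mul_sum]
    refine sum_congr rfl fun n hn => ?_
    rw [cchar_line σ t (mem_upTo.1 hm).1, cchar_line σ t (mem_upTo.1 hn).1, Complex.real_smul,
      Complex.real_smul, map_mul, map_mul, Complex.conj_ofReal, Complex.conj_ofReal,
      ← Complex.exp_conj, map_mul, Complex.conj_I, map_neg, map_mul, Complex.conj_ofReal,
      Complex.conj_ofReal]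
    have : e m n t = Complex.exp (-(t * Real.log m) * Complex.I) *
        Complex.exp (-(t * Real.log n) * -Complex.I) := by
      rw [he, ← Complex.exp_add]
      push_cast
      ring_nf
    rw [this]
    push_cast
    ring
  have hint : ∀ m n, Integrable fun t : ℝ => (gw τ Δ t : ℂ) * e m n t := fun m n =>
    integrable_gw_mul (C := 1) hΔ (by rw [he]; fun_prop) fun t => by
      have := Complex.norm_exp_ofReal_mul_I (-(t * (Real.log m - Real.log n)))
      rw [he]
      push_cast at this ⊢
      exact this.le
  simp_rw [hexp]
  rw [integral_finsetSum _ fun m _ => integrable_finsetSum _ fun n _ => (hint m n).const_mul _]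
  have h2 : ∀ m ∈ upTo N, ∫ t : ℝ, ∑ n ∈ upTo N,
      ((x m * y n * (rchar σ m * rchar σ n) : ℝ) : ℂ) * ((gw τ Δ t : ℂ) * e m n t) =
      ∑ n ∈ upTo N, ((x m * y n * (rchar σ m * rchar σ n) : ℝ) : ℂ) *
        ∫ t : ℝ, (gw τ Δ t : ℂ) * e m n t := by
    intro m _
    rw [integral_finsetSum _ fun n _ => (hint m n).const_mul _]
    exact sum_congr rfl fun n _ => integral_const_mul _ _
  rw [sum_congr rfl h2]
  have hdiag : ((√Real.pi * Δ * ∑ n ∈ upTo N, x n * y n * rchar (2 * σ) n : ℝ) : ℂ) =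
      ∑ m ∈ upTo N, ∑ n ∈ upTo N, if m = n then
        ((x m * y n * (rchar σ m * rchar σ n) : ℝ) : ℂ) * ∫ t : ℝ, (gw τ Δ t : ℂ) * e m n t
        else 0 := by
    rw [mul_sum, Complex.ofReal_sum]
    refine sum_congr rfl fun m hm => ?_
    rw [sum_ite_eq, if_pos hm]
    have h3 : ∫ t : ℝ, (gw τ Δ t : ℂ) * e m m t = ((√Real.pi * Δ : ℝ) : ℂ) := by
      rw [← integral_gw τ hΔ, ← integral_complex_ofReal]
      refine integral_congr_ae (Filter.Eventually.of_forall fun t => ?_)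
      simp [he]
    have h4 : rchar (2 * σ) m = rchar σ m * rchar σ m := by
      have hm0 := (mem_upTo.1 hm).1
      rw [rchar_apply, rchar_apply, ← Real.rpow_add (by positivity)]
      congr 1; ring
    rw [h3, h4]
    push_cast
    ring
  rw [hdiag, ← sum_sub_distrib]
  simp_rw [← sum_sub_distrib]
  -- Off the diagonal the Fourier transform of the Gaussian is evaluated at a frequency of size at
  -- least e^(-N).
  have hoff : ∀ m ∈ upTo N, ∀ n ∈ upTo N,
      ‖((x m * y n * (rchar σ m * rchar σ n) : ℝ) : ℂ) * (∫ t : ℝ, (gw τ Δ t : ℂ) * e m n t) -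
        (if m = n then ((x m * y n * (rchar σ m * rchar σ n) : ℝ) : ℂ) *
          ∫ t : ℝ, (gw τ Δ t : ℂ) * e m n t else 0)‖ ≤
      (|x m| * rchar σ m) * (|y n| * rchar σ n) *
        (√Real.pi * Δ * Real.exp (-(Δ * Real.exp (-N)) ^ 2 / 4)) := by
    intro m hm n hn
    have hpos : 0 ≤ (|x m| * rchar σ m) * (|y n| * rchar σ n) := by
      have := rchar_nonneg σ m; have := rchar_nonneg σ n; positivity
    split_ifs with h
    · rw [sub_self, norm_zero]; positivity
    · rw [sub_zero, norm_mul, norm_integral_gw_mul_cexp τ _ hΔ, Complex.norm_real,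
        Real.norm_eq_abs, abs_mul, abs_mul, abs_of_nonneg (mul_nonneg (rchar_nonneg σ m)
          (rchar_nonneg σ n))]
      have h5 := abs_log_sub_log_ge hm hn h
      have h6 : (Δ * Real.exp (-N)) ^ 2 ≤ (Δ * (Real.log m - Real.log n)) ^ 2 := by
        rw [mul_pow, mul_pow, ← sq_abs (Real.log m - Real.log n)]
        gcongr
      calc _ = (|x m| * rchar σ m) * (|y n| * rchar σ n) *
            (√Real.pi * Δ * Real.exp (-(Δ * (Real.log m - Real.log n)) ^ 2 / 4)) := by ring
        _ ≤ _ := by gcongr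
  refine (norm_sum_le _ _).trans ((sum_le_sum fun m hm => (norm_sum_le _ _).trans
    (sum_le_sum fun n hn => hoff m hm n hn)).trans ?_)
  simp_rw [← sum_mul, ← mul_sum]
  rw [← sum_mul]
  have hxs := sum_abs_le_sqrt hx hσ
  have hys := sum_abs_le_sqrt hy hσ
  have h7 : √(Real.exp N * nrm x) * √(Real.exp N * nrm y) = Real.exp N * √(nrm x * nrm y) := by
    rw [Real.sqrt_mul (Real.exp_pos N).le, Real.sqrt_mul (Real.exp_pos N).le,
      Real.sqrt_mul (nrm_nonneg x)]
    have := Real.mul_self_sqrt (Real.exp_pos N).le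
    linear_combination (√(nrm x) * √(nrm y)) * this
  calc _ ≤ (√(Real.exp N * nrm x) * √(Real.exp N * nrm y)) *
        (√Real.pi * Δ * Real.exp (-(Δ * Real.exp (-N)) ^ 2 / 4)) := by
        gcongr
        exact sum_nonneg fun n _ => mul_nonneg (abs_nonneg _) (rchar_nonneg σ n)
    _ = _ := by rw [h7]; ring

theorem continuous_ev_cchar {f : AF} {N : ℝ} (hf : LogLen f N) :
    Continuous fun s : ℂ => ev (cchar s) f := by
  have : (fun s : ℂ => ev (cchar s) f) = fun s => ∑ n ∈ upTo N, f n • (n : ℂ) ^ (-s) := by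
    ext s; exact ev_eq_sum' _ hf
  rw [this]
  refine continuous_finsetSum _ fun n hn => Continuous.fun_const_smul ?_ _
  have : (n : ℂ) ≠ 0 := by exact_mod_cast (mem_upTo.1 hn).1
  exact (continuous_neg.const_cpow (Or.inl this))

theorem differentiable_ev_cchar {f : AF} {N : ℝ} (hf : LogLen f N) :
    Differentiable ℂ fun s : ℂ => ev (cchar s) f := by
  have : (fun s : ℂ => ev (cchar s) f) = fun s => ∑ n ∈ upTo N, f n • (n : ℂ) ^ (-s) := by
    ext s; exact ev_eq_sum' _ hf
  rw [this]
  refine Differentiable.fun_sum fun n hn => Differentiable.fun_const_smul ?_ _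
  have : (n : ℂ) ≠ 0 := by exact_mod_cast (mem_upTo.1 hn).1
  exact differentiable_neg.const_cpow (Or.inl this)

/-- Mean square of a short Dirichlet polynomial. -/
theorem integral_gw_mul_norm_sq_le {x : AF} {N σ τ Δ : ℝ} (hx : LogLen x N) (hσ : 1 / 2 ≤ σ)
    (hΔ : 0 < Δ) (hN : Real.exp (-(Δ * Real.exp (-N)) ^ 2 / 4) * Real.exp N ≤ 1) :
    ∫ t : ℝ, gw τ Δ t * ‖ev (cchar (σ + t * Complex.I)) x‖ ^ 2 ≤ 2 * (√Real.pi * Δ) * nrm x := by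
  have h1 := norm_integral_gw_mul_sub_le (τ := τ) hx hx hσ hΔ
  have h2 : (∫ t : ℝ, (gw τ Δ t : ℂ) * (ev (cchar (σ + t * Complex.I)) x *
      (starRingEnd ℂ) (ev (cchar (σ + t * Complex.I)) x))) =
      ((∫ t : ℝ, gw τ Δ t * ‖ev (cchar (σ + t * Complex.I)) x‖ ^ 2 : ℝ) : ℂ) := by
    rw [← integral_complex_ofReal]
    refine integral_congr_ae (Filter.Eventually.of_forall fun t => ?_)
    simp only
    rw [Complex.mul_conj, Complex.normSq_eq_norm_sq]
    push_cast
    rfl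
  rw [h2, ← Complex.ofReal_sub, Complex.norm_real, Real.sqrt_mul_self (nrm_nonneg x)] at h1
  have h3 := (le_abs_self _).trans h1
  have h4 : ∑ n ∈ upTo N, x n * x n * rchar (2 * σ) n ≤ nrm x := by
    rw [nrm_eq hx]
    refine sum_le_sum fun n hn => ?_
    rw [sq]
    exact mul_le_mul_of_nonneg_left (rchar_anti (by linarith) n (mem_upTo.1 hn).1)
      (mul_self_nonneg _)
  have h5 : √Real.pi * Δ * (Real.exp (-(Δ * Real.exp (-N)) ^ 2 / 4) * Real.exp N * nrm x) ≤
      √Real.pi * Δ * (1 * nrm x) := by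
    gcongr
    exact nrm_nonneg x
  have h6 : √Real.pi * Δ * ∑ n ∈ upTo N, x n * x n * rchar (2 * σ) n ≤ √Real.pi * Δ * nrm x := by
    gcongr
  linarith

/-! ### Subharmonicity of powers of the modulus -/

/-- Jensen's formula: the zeros in the disc contribute nonnegative multiples of log(r/|c - u|). -/
theorem log_norm_le_circleAverage {f : ℂ → ℂ} {c : ℂ} {r : ℝ} (hr : 0 < r)
    (hf : AnalyticOnNhd ℂ f (Metric.closedBall c r)) (hc : f c ≠ 0) :
    Real.log ‖f c‖ ≤ Real.circleAverage (fun z => Real.log ‖f z‖) c r := by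
  rw [← abs_of_pos hr] at hf
  rw [hf.circleAverage_log_norm hr.ne' hc]
  refine le_add_of_nonneg_left (finsum_nonneg fun u => ?_)
  by_cases hu : u ∈ Metric.closedBall c |r|
  · refine mul_nonneg (by exact_mod_cast MeromorphicOn.AnalyticOnNhd.divisor_nonneg hf u) ?_
    by_cases h : c = u
    · simp [h]
    · have h0 : 0 < ‖c - u‖ := norm_pos_iff.2 (sub_ne_zero.2 h)
      refine Real.log_nonneg ?_
      rw [← div_eq_mul_inv, le_div_iff₀ h0, one_mul, ← dist_eq_norm, dist_comm]
      rwa [Metric.mem_closedBall, abs_of_pos hr] at hu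
  · rw [Function.locallyFinsuppWithin.apply_eq_zero_of_notMem _ hu]; simp

/-- Subharmonicity of |f|^p, from that of log|f| and the convexity of x ↦ e^(px): the tangent line
at log|f(c)| is integrated over the circle. -/
theorem norm_rpow_le_circleAverage {f : ℂ → ℂ} {c : ℂ} {r p : ℝ} (hr : 0 < r) (hp : 0 < p)
    (hf : AnalyticOnNhd ℂ f (Metric.closedBall c r)) :
    ‖f c‖ ^ p ≤ Real.circleAverage (fun z => ‖f z‖ ^ p) c r := by
  have habs : |r| = r := abs_of_pos hr
  by_cases hc : f c = 0
  · rw [hc, norm_zero, Real.zero_rpow hp.ne', Real.circleAverage, smul_eq_mul]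
    exact mul_nonneg (by positivity)
      (intervalIntegral.integral_nonneg (by positivity) fun θ _ => by positivity)
  have hfs : AnalyticOnNhd ℂ f (Metric.sphere c |r|) :=
    hf.mono (by rw [habs]; exact Metric.sphere_subset_closedBall)
  set A := Real.log ‖f c‖ with hA
  -- Since `Real.log 0 = 0`, the tangent-line inequality may fail at zeros of f. The function is
  -- modified there to meet the tangent; the zeros are too sparse to affect the circle average.
  set K := Real.exp (p * A) with hK
  set g : ℂ → ℝ := fun z => if f z = 0 then K - K * p * A else ‖f z‖ ^ p with hg
  have hcod : ∀ᶠ z in Filter.codiscreteWithin (Metric.closedBall c r), f z ≠ 0 := by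
    rcases hf.eqOn_zero_or_eventually_ne_zero_of_preconnected
      (convex_closedBall c r).isPreconnected with h | h
    · exact absurd (h (Metric.mem_closedBall_self hr.le)) hc
    · exact h
  have hfg : (fun z => ‖f z‖ ^ p) =ᶠ[Filter.codiscreteWithin (Metric.sphere c |r|)] g := by
    refine Filter.codiscreteWithin_mono (U := Metric.closedBall c r)
      (by rw [habs]; exact Metric.sphere_subset_closedBall) ?_
    filter_upwards [hcod] with z hz
    simp [hg, hz]
  have hint : CircleIntegrable (fun z => ‖f z‖ ^ p) c r := by
    refine ContinuousOn.circleIntegrable' ?_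
    exact (hfs.continuousOn.norm).rpow_const fun _ _ => Or.inr hp.le
  rw [Real.circleAverage_congr_codiscreteWithin hfg hr.ne']
  have hlog : CircleIntegrable (fun z => Real.log ‖f z‖) c r :=
    hfs.meromorphicOn.circleIntegrable_log_norm
  have hE : ‖f c‖ ^ p = Real.exp (p * A) := by
    rw [Real.rpow_def_of_pos (norm_pos_iff.2 hc), mul_comm]
  have hlin : CircleIntegrable (fun z => (K - K * p * A) + (K * p) * Real.log ‖f z‖) c r :=
    (circleIntegrable_const _ _ _).add (hlog.const_fun_smul (a := K * p))
  have hmono := Real.circleAverage_mono hlin (hint.congr_codiscreteWithin hfg) fun z _ => by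
    by_cases hz : f z = 0
    · simp [hg, hz]
    · simp only [hg, if_neg hz]
      rw [Real.rpow_def_of_pos (norm_pos_iff.2 hz)]
      have h1 := Real.add_one_le_exp (p * (Real.log ‖f z‖ - A))
      have h2 : Real.exp (Real.log ‖f z‖ * p) =
          K * Real.exp (p * (Real.log ‖f z‖ - A)) := by
        rw [hK, ← Real.exp_add]; congr 1; ring
      rw [h2]
      have h3 : 0 < K := Real.exp_pos _
      nlinarith
  have hlin' : Real.circleAverage (fun z => (K - K * p * A) + (K * p) * Real.log ‖f z‖) c r =
      (K - K * p * A) + K * p * Real.circleAverage (fun z => Real.log ‖f z‖) c r := by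
    have h1 := Real.circleAverage_add (circleIntegrable_const (K - K * p * A) c r)
      (hlog.const_fun_smul (a := K * p))
    have h2 := Real.circleAverage_fun_smul (a := K * p) (f := fun z => Real.log ‖f z‖) (c := c)
      (R := r)
    rw [h2, Real.circleAverage_const] at h1
    exact h1
  have h3 : 0 < K * p := mul_pos (Real.exp_pos _) hp
  have h4 := mul_le_mul_of_nonneg_left (log_norm_le_circleAverage hr hf hc) h3.le
  rw [hE]
  linarith

/-! ### The maximum principle for mean values on vertical lines -/

/-- The mean of `|H|^p` on the line `Re s = σ`. -/
noncomputable def lineMean (H : ℂ → ℂ) (p σ : ℝ) : ℝ := ∫ t : ℝ, ‖H (σ + t * Complex.I)‖ ^ p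

theorem re_add_mul_I (x y : ℝ) : ((x : ℂ) + y * Complex.I).re = x := by simp

theorem im_add_mul_I (x y : ℝ) : ((x : ℂ) + y * Complex.I).im = y := by simp

theorem lineMean_nonneg (H : ℂ → ℂ) (p σ : ℝ) : 0 ≤ lineMean H p σ :=
  integral_nonneg fun t => by positivity

theorem integrable_line {H : ℂ → ℂ} {p a b C : ℝ} (hp : 0 < p)
    (hH : ∀ s : ℂ, a ≤ s.re → s.re ≤ b → AnalyticAt ℂ H s)
    (hC : ∀ s : ℂ, a ≤ s.re → s.re ≤ b → ‖H s‖ ^ p ≤ C * (1 + s.im ^ 2)⁻¹) {σ : ℝ} (h1 : a ≤ σ)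
    (h2 : σ ≤ b) : Integrable fun t : ℝ => ‖H (σ + t * Complex.I)‖ ^ p := by
  refine Integrable.mono' (integrable_inv_one_add_sq.const_mul C) ?_
    (Filter.Eventually.of_forall fun t => ?_)
  · refine Continuous.aestronglyMeasurable ?_
    refine Continuous.rpow_const ?_ fun _ => Or.inr hp.le
    refine Continuous.norm (continuous_iff_continuousAt.2 fun t => ?_)
    exact ContinuousAt.comp (f := fun t : ℝ => (σ : ℂ) + t * Complex.I)
      (hH _ (by simpa using h1) (by simpa using h2)).continuousAt (by fun_prop)
  · rw [Real.norm_eq_abs, abs_of_nonneg (by positivity)]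
    have := hC (σ + t * Complex.I) (by simpa using h1) (by simpa using h2)
    simpa using this

theorem continuousOn_lineMean {H : ℂ → ℂ} {p a b C : ℝ} (hp : 0 < p)
    (hH : ∀ s : ℂ, a ≤ s.re → s.re ≤ b → AnalyticAt ℂ H s)
    (hC : ∀ s : ℂ, a ≤ s.re → s.re ≤ b → ‖H s‖ ^ p ≤ C * (1 + s.im ^ 2)⁻¹) :
    ContinuousOn (lineMean H p) (Set.Icc a b) := by
  unfold lineMean
  refine continuousOn_of_dominated (bound := fun t => C * (1 + t ^ 2)⁻¹) (fun σ hσ => ?_)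
    (fun σ hσ => Filter.Eventually.of_forall fun t => ?_) (integrable_inv_one_add_sq.const_mul C)
    (Filter.Eventually.of_forall fun t => ?_)
  · exact (integrable_line hp hH hC hσ.1 hσ.2).aestronglyMeasurable
  · rw [Real.norm_eq_abs, abs_of_nonneg (by positivity)]
    have := hC (σ + t * Complex.I) (by simpa using hσ.1) (by simpa using hσ.2)
    simpa using this
  · intro σ hσ
    refine ContinuousAt.continuousWithinAt ?_
    refine ContinuousAt.rpow_const ?_ (Or.inr hp.le)
    refine ContinuousAt.norm ?_
    exact ContinuousAt.comp (f := fun σ : ℝ => (σ : ℂ) + t * Complex.I)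
      (hH _ (by simpa using hσ.1) (by simpa using hσ.2)).continuousAt (by fun_prop)

/-- The sub-mean-value inequality is integrated along the line. After Fubini, translation invariance
in t removes the vertical displacement r sin θ and leaves only the horizontal one. -/
theorem lineMean_le_average {H : ℂ → ℂ} {p a b C : ℝ} (hp : 0 < p)
    (hH : ∀ s : ℂ, a ≤ s.re → s.re ≤ b → AnalyticAt ℂ H s)
    (hC : ∀ s : ℂ, a ≤ s.re → s.re ≤ b → ‖H s‖ ^ p ≤ C * (1 + s.im ^ 2)⁻¹) {σ r : ℝ} (hr : 0 < r)
    (h1 : a ≤ σ - r) (h2 : σ + r ≤ b) :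
    lineMean H p σ ≤ (2 * Real.pi)⁻¹ *
      ∫ θ in (0 : ℝ)..2 * Real.pi, lineMean H p (σ + r * Real.cos θ) := by
  have hcos : ∀ θ : ℝ, a ≤ σ + r * Real.cos θ ∧ σ + r * Real.cos θ ≤ b := fun θ =>
    ⟨by nlinarith [Real.neg_one_le_cos θ], by nlinarith [Real.cos_le_one θ]⟩
  have hpt : ∀ t θ : ℝ, circleMap (σ + t * Complex.I) r θ =
      ((σ + r * Real.cos θ : ℝ) : ℂ) + ((t + r * Real.sin θ : ℝ) : ℂ) * Complex.I := by
    intro t θ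
    rw [circleMap, Complex.exp_mul_I, ← Complex.ofReal_cos, ← Complex.ofReal_sin]
    push_cast; ring
  set F : ℝ → ℝ → ℝ := fun t θ => ‖H (circleMap (σ + t * Complex.I) r θ)‖ ^ p with hF
  have hFcont : Continuous (Function.uncurry F) := by
    refine Continuous.rpow_const ?_ fun _ => Or.inr hp.le
    refine Continuous.norm (continuous_iff_continuousAt.2 fun x => ?_)
    refine ContinuousAt.comp (f := fun x : ℝ × ℝ => circleMap (σ + x.1 * Complex.I) r x.2)
      (AnalyticAt.continuousAt (hH _ ?_ ?_)) ?_
    · rw [hpt, re_add_mul_I]; exact (hcos x.2).1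
    · rw [hpt, re_add_mul_I]; exact (hcos x.2).2
    · unfold circleMap; fun_prop
  have hFint : ∀ θ : ℝ, Integrable (fun t => F t θ) ∧
      ∫ t, F t θ = lineMean H p (σ + r * Real.cos θ) := by
    intro θ
    have e : (fun t => F t θ) = fun t => (fun u : ℝ =>
        ‖H (((σ + r * Real.cos θ : ℝ) : ℂ) + u * Complex.I)‖ ^ p) (t + r * Real.sin θ) := by
      ext t; simp only [hF]; rw [hpt]
    rw [e]
    refine ⟨(integrable_line hp hH hC (hcos θ).1 (hcos θ).2).comp_add_right _, ?_⟩
    exact integral_add_right_eq_self (fun u : ℝ =>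
      ‖H (((σ + r * Real.cos θ : ℝ) : ℂ) + u * Complex.I)‖ ^ p) _
  have hUcont : Continuous fun θ : ℝ => lineMean H p (σ + r * Real.cos θ) :=
    (continuousOn_lineMean hp hH hC).comp_continuous (by fun_prop) hcos
  have hprod : Integrable (Function.uncurry F)
      (volume.prod (volume.restrict (Set.Ioc 0 (2 * Real.pi)))) := by
    rw [integrable_prod_iff' hFcont.aestronglyMeasurable]
    refine ⟨Filter.Eventually.of_forall fun θ => (hFint θ).1, ?_⟩
    have : (fun θ => ∫ t, ‖Function.uncurry F (t, θ)‖) =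
        fun θ : ℝ => lineMean H p (σ + r * Real.cos θ) := by
      ext θ
      rw [← (hFint θ).2]
      refine integral_congr_ae (Filter.Eventually.of_forall fun t => ?_)
      simp only [Function.uncurry, hF]
      rw [Real.norm_eq_abs, abs_of_nonneg (by positivity)]
    rw [this]
    exact (hUcont.integrableOn_Icc (a := 0) (b := 2 * Real.pi)).mono_set Set.Ioc_subset_Icc_self
  have hpi : (0 : ℝ) ≤ 2 * Real.pi := by positivity
  calc lineMean H p σ ≤ ∫ t : ℝ, (2 * Real.pi)⁻¹ * ∫ θ in Set.Ioc 0 (2 * Real.pi), F t θ := by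
        refine integral_mono (integrable_line hp hH hC (by linarith) (by linarith))
          (hprod.integral_prod_left.const_mul _) fun t => ?_
        have := norm_rpow_le_circleAverage (f := H) (c := σ + t * Complex.I) hr hp fun s hs => by
          rw [Metric.mem_closedBall, dist_eq_norm] at hs
          have h3 := (Complex.abs_re_le_norm _).trans hs
          rw [abs_le] at h3
          simp at h3
          exact hH s (by linarith) (by linarith)
        rw [Real.circleAverage, intervalIntegral.integral_of_le hpi, smul_eq_mul] at this
        exact this
    _ = _ := by
        rw [integral_const_mul, integral_integral_swap hprod, intervalIntegral.integral_of_le hpi]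
        simp_rw [(hFint _).2]

theorem integral_add_mul_cos_sq (σ r : ℝ) :
    ∫ θ in (0 : ℝ)..2 * Real.pi, (σ + r * Real.cos θ) ^ 2 =
      2 * Real.pi * (σ ^ 2 + r ^ 2 / 2) := by
  have h : ∀ θ : ℝ, (σ + r * Real.cos θ) ^ 2 =
      σ ^ 2 + (2 * σ * r * Real.cos θ + r ^ 2 * Real.cos θ ^ 2) := fun θ => by ring
  simp_rw [h]
  rw [intervalIntegral.integral_add, intervalIntegral.integral_add,
    intervalIntegral.integral_const, intervalIntegral.integral_const_mul,
    intervalIntegral.integral_const_mul, integral_cos, integral_cos_sq]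
  · simp; ring
  all_goals exact Continuous.intervalIntegrable (by fun_prop) _ _

/-- The maximum principle for means of `|H|^p` on the lines of a vertical strip. -/
theorem lineMean_le_max {H : ℂ → ℂ} {p a b C : ℝ} (hp : 0 < p)
    (hH : ∀ s : ℂ, a ≤ s.re → s.re ≤ b → AnalyticAt ℂ H s)
    (hC : ∀ s : ℂ, a ≤ s.re → s.re ≤ b → ‖H s‖ ^ p ≤ C * (1 + s.im ^ 2)⁻¹) {σ : ℝ}
    (h1 : a ≤ σ) (h2 : σ ≤ b) :
    lineMean H p σ ≤ max (lineMean H p a) (lineMean H p b) := by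
  have hU := continuousOn_lineMean hp hH hC
  have key : ∀ ε : ℝ, 0 < ε → lineMean H p σ ≤
      max (lineMean H p a) (lineMean H p b) + ε * (a ^ 2 + b ^ 2) := by
    intro ε hε
    -- The term εx² makes the sub-mean-value inequality strict: its circle average exceeds its
    -- central value by εr²/2, which rules out an interior maximum. Then ε tends to 0.
    set V : ℝ → ℝ := fun x => lineMean H p x + ε * x ^ 2 with hV
    have hVc : ContinuousOn V (Set.Icc a b) := hU.add (by fun_prop)
    obtain ⟨x, hx, hmax⟩ := isCompact_Icc.exists_isMaxOn ⟨σ, h1, h2⟩ hVc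
    have hVx : V x ≤ max (lineMean H p a) (lineMean H p b) + ε * (a ^ 2 + b ^ 2) := by
      rcases hx.1.eq_or_lt with h | h
      · rw [← h]
        have := le_max_left (lineMean H p a) (lineMean H p b)
        simp only [hV]
        nlinarith [sq_nonneg b]
      rcases hx.2.eq_or_lt with h' | h'
      · rw [h']
        have := le_max_right (lineMean H p a) (lineMean H p b)
        simp only [hV]
        nlinarith [sq_nonneg a]
      exfalso
      set r := min (x - a) (b - x) with hr
      have hr0 : 0 < r := lt_min (by linarith) (by linarith)
      have hra : a ≤ x - r := by linarith [min_le_left (x - a) (b - x)]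
      have hrb : x + r ≤ b := by linarith [min_le_right (x - a) (b - x)]
      have hav := lineMean_le_average hp hH hC hr0 hra hrb
      have hcos : ∀ θ : ℝ, x + r * Real.cos θ ∈ Set.Icc a b := fun θ =>
        ⟨by nlinarith [Real.neg_one_le_cos θ], by nlinarith [Real.cos_le_one θ]⟩
      have hle : ∫ θ in (0 : ℝ)..2 * Real.pi, lineMean H p (x + r * Real.cos θ) ≤
          ∫ θ in (0 : ℝ)..2 * Real.pi, (V x - ε * (x + r * Real.cos θ) ^ 2) := by
        refine intervalIntegral.integral_mono (by positivity) ?_ ?_ fun θ => ?_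
        · exact (hU.comp_continuous (by fun_prop) hcos).intervalIntegrable _ _
        · exact Continuous.intervalIntegrable (by fun_prop) _ _
        · have := hmax (hcos θ)
          simp only [hV, Set.mem_ofPred_eq] at this ⊢
          linarith
      rw [intervalIntegral.integral_sub (by simp) (Continuous.intervalIntegrable (by fun_prop) _ _),
        intervalIntegral.integral_const, intervalIntegral.integral_const_mul,
        integral_add_mul_cos_sq, sub_zero, smul_eq_mul] at hle
      have hpi : 0 < 2 * Real.pi := by positivity
      have h3 : lineMean H p x ≤ V x - ε * (x ^ 2 + r ^ 2 / 2) := by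
        refine hav.trans ((mul_le_mul_of_nonneg_left hle (by positivity)).trans (le_of_eq ?_))
        field_simp
      simp only [hV] at h3
      nlinarith [mul_pos hε (pow_pos hr0 2)]
    have := hmax (show σ ∈ Set.Icc a b from ⟨h1, h2⟩)
    simp only [hV, Set.mem_ofPred_eq] at this hVx
    nlinarith [mul_nonneg hε.le (sq_nonneg σ)]
  refine le_of_forall_pos_le_add fun δ hδ => ?_
  have := key (δ / (a ^ 2 + b ^ 2 + 1)) (by positivity)
  refine this.trans ?_
  gcongr
  rw [div_mul_eq_mul_div, div_le_iff₀ (by positivity)]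
  nlinarith

/-! ### Growth of the zeta function -/

/-- The `n`-th term of the series for `(s - 1) ζ(s) - 1`. -/
noncomputable def zterm (n : ℕ) (s : ℂ) : ℂ :=
  (s - 1) * ((n + 1 : ℕ) : ℂ) ^ (-s) -
    (((n + 1 : ℕ) : ℂ) ^ (1 - s) - ((n + 2 : ℕ) : ℂ) ^ (1 - s))

/-- The term is a first-order Taylor remainder of x^(1-s) on [n+1, n+2]. Applying the mean value
inequality twice gains a full power of n, so the series converges past Re s = 1. -/
theorem norm_zterm_le {s : ℂ} (hs : 0 ≤ s.re) (n : ℕ) :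
    ‖zterm n s‖ ≤ ‖s - 1‖ * ‖s‖ * ((n + 1 : ℕ) : ℝ) ^ (-s.re - 1) := by
  set N : ℝ := ((n + 1 : ℕ) : ℝ) with hN
  have hN0 : 0 < N := by positivity
  have hpos : ∀ x ∈ Set.Icc (0 : ℝ) 1, 0 < N + x := fun x hx => by linarith [hx.1]
  have hder : ∀ (w : ℂ) (x : ℝ), x ∈ Set.Icc (0 : ℝ) 1 →
      HasDerivAt (fun x : ℝ => ((N + x : ℝ) : ℂ) ^ w) (w * ((N + x : ℝ) : ℂ) ^ (w - 1)) x := by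
    intro w x hx
    have h1 : HasDerivAt (fun z : ℂ => ((N : ℂ) + z) ^ w)
        (w * ((N : ℂ) + x) ^ (w - 1) * 1) (x : ℂ) := by
      refine HasDerivAt.cpow_const ((hasDerivAt_id (x : ℂ)).const_add (N : ℂ)) (Or.inl ?_)
      have := hpos x hx
      simpa using this
    have h2 := h1.comp_ofReal
    rw [mul_one] at h2
    simpa using h2
  set M := ‖s - 1‖ * ‖s‖ * N ^ (-s.re - 1) with hM
  have hbound : ∀ x ∈ Set.Icc (0 : ℝ) 1, ∀ w : ℂ, w.re ≤ 0 →
      ‖((N + x : ℝ) : ℂ) ^ w‖ ≤ N ^ w.re := by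
    intro x hx w hw
    rw [Complex.norm_cpow_eq_rpow_re_of_pos (hpos x hx)]
    exact Real.rpow_le_rpow_of_nonpos hN0 (by linarith [hx.1]) hw
  have hfirst : ∀ x ∈ Set.Icc (0 : ℝ) 1,
      ‖(1 - s) * ((N + x : ℝ) : ℂ) ^ (-s) - (1 - s) * ((N + (0 : ℝ) : ℝ) : ℂ) ^ (-s)‖ ≤ M := by
    intro x hx
    have h := Convex.norm_image_sub_le_of_norm_hasDerivWithin_le
      (f := fun x : ℝ => (1 - s) * ((N + x : ℝ) : ℂ) ^ (-s))
      (f' := fun x : ℝ => (1 - s) * (-s * ((N + x : ℝ) : ℂ) ^ (-s - 1)))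
      (s := Set.Icc (0 : ℝ) 1) (C := M) (x := 0) (y := x)
      (fun y hy => ((hder (-s) y hy).const_mul (1 - s)).hasDerivWithinAt) (fun y hy => ?_)
      (convex_Icc 0 1) (by simp) hx
    · refine h.trans ?_
      rw [sub_zero, Real.norm_eq_abs, abs_of_nonneg hx.1]
      exact mul_le_of_le_one_right (by positivity) hx.2
    · rw [norm_mul, norm_mul, norm_neg, norm_sub_rev 1 s, ← mul_assoc]
      refine mul_le_mul_of_nonneg_left ?_ (by positivity)
      have := hbound y hy (-s - 1) (by simp; linarith)
      simpa using this
  have h := Convex.norm_image_sub_le_of_norm_hasDerivWithin_le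
    (f := fun x : ℝ => ((N + x : ℝ) : ℂ) ^ (1 - s) - (x : ℂ) * ((1 - s) * ((N + (0 : ℝ) : ℝ) : ℂ) ^ (-s)))
    (f' := fun x : ℝ => (1 - s) * ((N + x : ℝ) : ℂ) ^ (-s) - (1 - s) * ((N + (0 : ℝ) : ℝ) : ℂ) ^ (-s))
    (s := Set.Icc (0 : ℝ) 1) (C := M) (x := 0) (y := 1)
    (fun y hy => ?_) hfirst (convex_Icc 0 1) (by simp) (by simp)
  · refine le_trans (le_of_eq ?_) (h.trans (le_of_eq (by simp)))
    rw [zterm]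
    congr 1
    simp only [hN]
    push_cast
    ring_nf
  · have h1 := hder (1 - s) y hy
    rw [show (1 : ℂ) - s - 1 = -s by ring] at h1
    have h2 := (Complex.ofRealCLM.hasDerivAt (x := y)).mul_const
      ((1 - s) * ((N + (0 : ℝ) : ℝ) : ℂ) ^ (-s))
    have h3 := h1.sub h2
    simp only [Complex.ofRealCLM_apply, Complex.ofReal_one, one_mul] at h3
    exact h3.hasDerivWithinAt

theorem summable_nat_rpow_succ {a : ℝ} (ha : a < -1) :
    Summable fun n : ℕ => ((n + 1 : ℕ) : ℝ) ^ a :=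
  (summable_nat_add_iff 1).2 (Real.summable_nat_rpow.2 ha)

theorem norm_zterm_le' {s : ℂ} (hs : 1 / 4 < s.re) (n : ℕ) :
    ‖zterm n s‖ ≤ ‖s - 1‖ * ‖s‖ * ((n + 1 : ℕ) : ℝ) ^ (-(5 / 4) : ℝ) := by
  refine (norm_zterm_le (by linarith) n).trans ?_
  gcongr
  · push_cast; linarith [n.cast_nonneg (α := ℝ)]
  · linarith

theorem summable_zterm {s : ℂ} (hs : 1 / 4 < s.re) : Summable fun n => zterm n s :=
  Summable.of_norm_bounded ((summable_nat_rpow_succ (by norm_num)).mul_left _) (norm_zterm_le' hs)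

/-- The differences of n^(1-s) telescope to 1, leaving (s - 1)ζ(s) - 1. -/
theorem tsum_zterm {s : ℂ} (hs : 1 < s.re) : ∑' n, zterm n s = (s - 1) * riemannZeta₀ s := by
  have hs1 : s ≠ 1 := by rintro rfl; simp at hs
  have h1 := summable_zterm (s := s) (by linarith)
  have h2 : Summable fun n : ℕ => (s - 1) * ((n + 1 : ℕ) : ℂ) ^ (-s) := by
    refine Summable.mul_left _ ?_
    refine Summable.of_norm_bounded (summable_nat_rpow_succ (a := -s.re) (by linarith)) fun n => ?_
    rw [Complex.norm_natCast_cpow_of_pos (by omega)]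
    simp
  have h3 := h2.hasSum.sub h1.hasSum
  have h4 : ∀ n : ℕ, (s - 1) * ((n + 1 : ℕ) : ℂ) ^ (-s) - zterm n s =
      ((n + 1 : ℕ) : ℂ) ^ (1 - s) - ((n + 1 + 1 : ℕ) : ℂ) ^ (1 - s) := fun n => by
    rw [zterm]; ring
  simp_rw [h4] at h3
  have h5 := h3.tendsto_sum_nat
  simp_rw [sum_range_sub' (fun n : ℕ => ((n + 1 : ℕ) : ℂ) ^ (1 - s))] at h5
  have h6 : Filter.Tendsto (fun n : ℕ => ((0 + 1 : ℕ) : ℂ) ^ (1 - s) - ((n + 1 : ℕ) : ℂ) ^ (1 - s))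
      Filter.atTop (nhds (1 - 0)) := by
    refine Filter.Tendsto.sub (by simp) ?_
    rw [tendsto_zero_iff_norm_tendsto_zero]
    have h7 : ∀ n : ℕ, ‖((n + 1 : ℕ) : ℂ) ^ (1 - s)‖ = ((n + 1 : ℕ) : ℝ) ^ (-(s.re - 1)) := fun n => by
      rw [Complex.norm_natCast_cpow_of_pos (by omega)]; simp
    simp_rw [h7]
    exact (tendsto_rpow_neg_atTop (by linarith)).comp
      ((Filter.tendsto_add_atTop_iff_nat 1).2 tendsto_natCast_atTop_atTop)
  have h8 := tendsto_nhds_unique h5 h6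
  rw [tsum_mul_left] at h8
  have h9 : ∑' n : ℕ, ((n + 1 : ℕ) : ℂ) ^ (-s) = riemannZeta s := by
    rw [zeta_eq_tsum_one_div_nat_add_one_cpow hs]
    refine tsum_congr fun n => ?_
    rw [Complex.cpow_neg, one_div]; push_cast; rfl
  rw [h9, riemannZeta_eq_inv_sub_add hs1, mul_add, mul_inv_cancel₀ (sub_ne_zero.2 hs1)] at h8
  linear_combination -h8

theorem isOpen_halfPlane (a : ℝ) : IsOpen {s : ℂ | a < s.re} :=
  isOpen_lt continuous_const Complex.continuous_re

theorem differentiable_zterm (n : ℕ) : Differentiable ℂ (zterm n) := by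
  have h1 : ((n + 1 : ℕ) : ℂ) ≠ 0 := by exact_mod_cast (by omega : n + 1 ≠ 0)
  have h2 : ((n + 2 : ℕ) : ℂ) ≠ 0 := by exact_mod_cast (by omega : n + 2 ≠ 0)
  intro s
  unfold zterm
  refine DifferentiableAt.sub (DifferentiableAt.mul (by fun_prop) ?_) (DifferentiableAt.sub ?_ ?_)
  · exact (differentiableAt_id.neg).const_cpow (Or.inl h1)
  · exact (differentiableAt_id.const_sub 1).const_cpow (Or.inl h1)
  · exact (differentiableAt_id.const_sub 1).const_cpow (Or.inl h2)

theorem differentiableOn_tsum_zterm :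
    DifferentiableOn ℂ (fun s => ∑' n, zterm n s) {s : ℂ | 1 / 4 < s.re} := by
  intro s hs
  refine DifferentiableAt.differentiableWithinAt ?_
  have hopen : IsOpen ({s : ℂ | 1 / 4 < s.re} ∩ Metric.ball 0 (‖s‖ + 1)) :=
    (isOpen_halfPlane _).inter Metric.isOpen_ball
  refine (Complex.differentiableOn_tsum_of_summable_norm
    (u := fun n : ℕ => ((‖s‖ + 2) * (‖s‖ + 1)) * ((n + 1 : ℕ) : ℝ) ^ (-(5 / 4) : ℝ))
    ((summable_nat_rpow_succ (by norm_num)).mul_left _)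
    (fun n => (differentiable_zterm n).differentiableOn) hopen fun n w hw => ?_).differentiableAt
    (hopen.mem_nhds ⟨hs, by simp⟩)
  have hw2 : ‖w‖ ≤ ‖s‖ + 1 := (mem_ball_zero_iff.1 hw.2).le
  refine (norm_zterm_le' hw.1 n).trans ?_
  have hw3 : ‖w - 1‖ ≤ ‖s‖ + 2 := by
    have := norm_sub_le w 1
    rw [norm_one] at this; linarith
  gcongr

/-- Analytic continuation by the identity theorem from Re s > 1, giving a formula with explicit
polynomial growth in the strip. -/
theorem tsum_zterm_eq {s : ℂ} (hs : 1 / 4 < s.re) :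
    ∑' n, zterm n s = (s - 1) * riemannZeta₀ s := by
  have h1 := differentiableOn_tsum_zterm.analyticOnNhd (isOpen_halfPlane _)
  have h2 : AnalyticOnNhd ℂ (fun s : ℂ => (s - 1) * riemannZeta₀ s) {s : ℂ | 1 / 4 < s.re} := by
    refine DifferentiableOn.analyticOnNhd (Differentiable.differentiableOn ?_) (isOpen_halfPlane _)
    exact (differentiable_id.sub_const 1).mul differentiable_riemannZeta₀
  have h3 : IsPreconnected {s : ℂ | 1 / 4 < s.re} :=
    (convex_halfSpace_re_gt (1 / 4)).isPreconnected
  refine h1.eqOn_of_preconnected_of_eventuallyEq h2 h3 (z₀ := 2) (by simp; norm_num) ?_ hs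
  filter_upwards [(isOpen_halfPlane 1).mem_nhds (by simp : (2 : ℂ) ∈ {s : ℂ | 1 < s.re})] with w hw
  exact tsum_zterm hw

theorem exists_norm_riemannZeta₀_le : ∃ C : ℝ, 0 < C ∧ ∀ s : ℂ, 1 / 4 < s.re →
    ‖riemannZeta₀ s‖ ≤ C * (1 + ‖s‖) := by
  set K := ∑' n : ℕ, ((n + 1 : ℕ) : ℝ) ^ (-(5 / 4) : ℝ) with hK
  have hK0 : 0 ≤ K := tsum_nonneg fun n => by positivity
  refine ⟨K + ‖riemannZeta₀ 1‖ + 1, by positivity, fun s hs => ?_⟩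
  by_cases h1 : s = 1
  · subst h1
    have : 0 ≤ ‖riemannZeta₀ 1‖ := norm_nonneg _
    rw [norm_one]; linarith
  · have h2 : ‖∑' n, zterm n s‖ ≤ ‖s - 1‖ * ‖s‖ * K := by
      rw [hK, ← tsum_mul_left]
      exact tsum_of_norm_bounded ((summable_nat_rpow_succ (by norm_num)).mul_left _).hasSum
        (norm_zterm_le' hs)
    rw [tsum_zterm_eq hs, norm_mul, mul_assoc] at h2
    have h3 := le_of_mul_le_mul_left h2 (norm_pos_iff.2 (sub_ne_zero.2 h1))
    have : 0 ≤ ‖riemannZeta₀ 1‖ := norm_nonneg _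
    nlinarith [norm_nonneg s]

/-- Cauchy's estimate on a circle of radius 1/8, which stays inside Re s > 1/4. -/
theorem exists_norm_deriv_riemannZeta₀_le : ∃ C : ℝ, 0 < C ∧ ∀ s : ℂ, 1 / 2 ≤ s.re →
    ‖deriv riemannZeta₀ s‖ ≤ C * (1 + ‖s‖) := by
  obtain ⟨C, hC, h⟩ := exists_norm_riemannZeta₀_le
  refine ⟨C * 2 * 8, by positivity, fun s hs => ?_⟩
  have h1 := Complex.norm_deriv_le_of_forall_mem_sphere_norm_le (c := s) (R := 1 / 8)
    (C := C * 2 * (1 + ‖s‖)) (f := riemannZeta₀) (by norm_num)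
    differentiable_riemannZeta₀.diffContOnCl fun w hw => by
      rw [mem_sphere_iff_norm] at hw
      have h2 := Complex.abs_re_le_norm (w - s)
      rw [hw, abs_le, Complex.sub_re] at h2
      refine (h w (by linarith)).trans ?_
      have h3 := norm_sub_norm_le w s
      have := norm_nonneg s
      nlinarith
  refine h1.trans (le_of_eq ?_)
  ring

/-- The entire function `(s - 1)² ζ'(s)`. -/
noncomputable def zetaD (s : ℂ) : ℂ := -1 + (s - 1) ^ 2 * deriv riemannZeta₀ s

theorem zetaD_eq {s : ℂ} (hs : s ≠ 1) : zetaD s = (s - 1) ^ 2 * deriv riemannZeta s := by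
  rw [deriv_riemannZeta_eq_neg_inv_sub_sq_add hs, zetaD, mul_add]
  have := sub_ne_zero.2 hs
  field_simp

theorem differentiable_zetaD : Differentiable ℂ zetaD := by
  have := differentiable_riemannZeta₀.deriv
  unfold zetaD
  fun_prop

theorem exists_norm_zetaD_le : ∃ C : ℝ, 0 < C ∧ ∀ s : ℂ, 1 / 2 ≤ s.re →
    ‖zetaD s‖ ≤ C * (1 + ‖s‖) ^ 3 := by
  obtain ⟨C, hC, h⟩ := exists_norm_deriv_riemannZeta₀_le
  refine ⟨1 + C, by positivity, fun s hs => ?_⟩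
  have h0 := norm_nonneg s
  have h1 : ‖zetaD s‖ ≤ 1 + ‖s - 1‖ ^ 2 * ‖deriv riemannZeta₀ s‖ := by
    unfold zetaD
    refine (norm_add_le _ _).trans ?_
    rw [norm_neg, norm_one, norm_mul, norm_pow]
  have h2 : ‖s - 1‖ ≤ 1 + ‖s‖ := by
    have := norm_sub_le s 1
    rw [norm_one] at this; linarith
  calc ‖zetaD s‖ ≤ 1 + (1 + ‖s‖) ^ 2 * (C * (1 + ‖s‖)) := by
        refine h1.trans ?_
        gcongr
        exact h s hs
    _ ≤ (1 + ‖s‖) ^ 3 + (1 + ‖s‖) ^ 2 * (C * (1 + ‖s‖)) := by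
        gcongr
        exact one_le_pow₀ (by linarith)
    _ = _ := by ring

/-! ### The Dirichlet series on a line of absolute convergence -/

/-- The difference is the tail over log n > L of the series for ζ', where log n · n^(-4) ≤ n^(-1)
n^(-2) ≤ e^(-L) n^(-2). -/
theorem exists_norm_deriv_zeta_add_le : ∃ C : ℝ, 0 < C ∧ ∀ (L : ℝ) (s : ℂ), s.re = 4 →
    ‖deriv riemannZeta s + ev (cchar s) (lgL L)‖ ≤ C * Real.exp (-L) := by
  have hsum2 : Summable fun n : ℕ => ((n : ℝ) ^ 2)⁻¹ :=
    Real.summable_nat_pow_inv.2 (by norm_num)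
  set K := ∑' n : ℕ, ((n : ℝ) ^ 2)⁻¹ with hK
  have hK0 : 0 ≤ K := tsum_nonneg fun n => by positivity
  refine ⟨K + 1, by positivity, fun L s hs => ?_⟩
  have hs1 : 1 < s.re := by rw [hs]; norm_num
  have habs : LSeries.abscissaOfAbsConv (1 : ℕ → ℂ) < s.re := by
    rw [LSeries.abscissaOfAbsConv_one]; exact_mod_cast hs1
  have hder : deriv riemannZeta s = -LSeries (LSeries.logMul (1 : ℕ → ℂ)) s := by
    rw [← LSeries_deriv habs]
    refine Filter.EventuallyEq.deriv_eq ?_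
    filter_upwards [(isOpen_halfPlane 1).mem_nhds hs1] with w hw
    exact (LSeries_one_eq_riemannZeta hw).symm
  have hS : LSeriesSummable (LSeries.logMul (1 : ℕ → ℂ)) s := LSeriesSummable_logMul_of_lt_re habs
  set a : ℕ → ℂ := LSeries.term (LSeries.logMul (1 : ℕ → ℂ)) s with ha
  have hterm : ∀ n : ℕ, n ≠ 0 → a n = (Real.log n : ℂ) * (n : ℂ) ^ (-s) := by
    intro n hn
    rw [ha, LSeries.term_of_ne_zero hn, LSeries.logMul, Complex.cpow_neg, div_eq_mul_inv]
    simp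
  have hfin : ev (cchar s) (lgL L) = ∑ n ∈ upTo L, a n := by
    rw [ev_eq_sum' _ (logLen_lgL L)]
    refine sum_congr rfl fun n hn => ?_
    rw [hterm n (mem_upTo.1 hn).1, lgL_apply, if_pos (mem_upTo.1 hn).2, cchar_apply,
      Complex.real_smul]
  have hsplit := hS.sum_add_tsum_compl (s := upTo L)
  have hdiff : deriv riemannZeta s + ev (cchar s) (lgL L) =
      -∑' n : ((upTo L : Set ℕ)ᶜ : Set ℕ), a n := by
    rw [hder, hfin, LSeries, ← hsplit]; ring
  rw [hdiff, norm_neg]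
  have hb : ∀ n : ((upTo L : Set ℕ)ᶜ : Set ℕ), ‖a n‖ ≤ Real.exp (-L) * (((n : ℕ) : ℝ) ^ 2)⁻¹ := by
    rintro ⟨n, hn⟩
    simp only
    by_cases hn0 : n = 0
    · simp [ha, hn0]
    · have hnpos : (0 : ℝ) < n := by positivity
      have hlog : L < Real.log n := by
        by_contra h
        exact hn (mem_coe.2 (mem_upTo.2 ⟨hn0, not_lt.1 h⟩))
      have hexp : Real.exp L ≤ n := by
        rw [← Real.exp_log hnpos]; exact Real.exp_le_exp.2 hlog.le
      rw [hterm n hn0, norm_mul, Complex.norm_real, Real.norm_eq_abs,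
        abs_of_nonneg (Real.log_natCast_nonneg n),
        Complex.norm_natCast_cpow_of_pos (Nat.pos_of_ne_zero hn0), Complex.neg_re, hs]
      have h4 : (n : ℝ) ^ (-4 : ℝ) = (n : ℝ)⁻¹ * (n : ℝ)⁻¹ * ((n : ℝ) ^ 2)⁻¹ := by
        rw [show (-4 : ℝ) = ((-4 : ℤ) : ℝ) by norm_num, Real.rpow_intCast, zpow_neg]
        rw [show (4 : ℤ) = ((4 : ℕ) : ℤ) by rfl, zpow_natCast]
        field_simp
      rw [h4]
      calc Real.log n * ((n : ℝ)⁻¹ * (n : ℝ)⁻¹ * ((n : ℝ) ^ 2)⁻¹)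
          ≤ n * ((n : ℝ)⁻¹ * (n : ℝ)⁻¹ * ((n : ℝ) ^ 2)⁻¹) := by
            gcongr; exact Real.log_le_self hnpos.le
        _ = (n : ℝ)⁻¹ * ((n : ℝ) ^ 2)⁻¹ := by field_simp
        _ ≤ _ := by
            rw [Real.exp_neg]
            gcongr
  have hs2 : Summable fun n : ((upTo L : Set ℕ)ᶜ : Set ℕ) =>
      Real.exp (-L) * (((n : ℕ) : ℝ) ^ 2)⁻¹ := (hsum2.subtype _).mul_left _
  refine (tsum_of_norm_bounded hs2.hasSum hb).trans ?_
  rw [tsum_mul_left, mul_comm]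
  gcongr
  have := hsum2.tsum_subtype_le (fun n : ℕ => ((n : ℝ) ^ 2)⁻¹) ((upTo L : Set ℕ)ᶜ) fun n => by positivity
  linarith

/-! ### Weighted Hölder inequality and Gaussian decay -/

/-- Hölder with weight W, obtained by integrating the weighted AM–GM inequality for f/M₁ and g/M₂.
Normalising by positive upper bounds instead of the integrals themselves avoids degenerate cases. -/
theorem integral_mul_le_of_le_rpow {W f g h : ℝ → ℝ} {a M₁ M₂ : ℝ} (ha : 0 < a) (ha1 : a < 1)
    (hW : ∀ t, 0 ≤ W t) (hf : ∀ t, 0 ≤ f t) (hg : ∀ t, 0 ≤ g t) (hh : ∀ t, 0 ≤ h t)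
    (hfg : ∀ t, h t ≤ f t ^ a * g t ^ (1 - a))
    (hfi : Integrable fun t => W t * f t) (hgi : Integrable fun t => W t * g t)
    (hM₁ : 0 < M₁) (hM₂ : 0 < M₂) (h1 : ∫ t, W t * f t ≤ M₁) (h2 : ∫ t, W t * g t ≤ M₂) :
    ∫ t, W t * h t ≤ M₁ ^ a * M₂ ^ (1 - a) := by
  set M := M₁ ^ a * M₂ ^ (1 - a) with hM
  have hM0 : 0 < M := by positivity
  have hpt : ∀ t, h t ≤ M * (a * (f t / M₁) + (1 - a) * (g t / M₂)) := by
    intro t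
    have h := Real.geom_mean_le_arith_mean2_weighted ha.le (by linarith : 0 ≤ 1 - a)
      (div_nonneg (hf t) hM₁.le) (div_nonneg (hg t) hM₂.le) (by ring)
    rw [Real.div_rpow (hf t) hM₁.le, Real.div_rpow (hg t) hM₂.le, div_mul_div_comm,
      div_le_iff₀ hM0] at h
    linarith [hfg t]
  calc ∫ t, W t * h t
      ≤ ∫ t, (M * a / M₁ * (W t * f t) + M * (1 - a) / M₂ * (W t * g t)) := by
        refine integral_mono_of_nonneg (Filter.Eventually.of_forall fun t => ?_)
          ((hfi.const_mul _).add (hgi.const_mul _)) (Filter.Eventually.of_forall fun t => ?_)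
        · exact mul_nonneg (hW t) (hh t)
        · refine (mul_le_mul_of_nonneg_left (hpt t) (hW t)).trans (le_of_eq ?_)
          ring
    _ = M * a / M₁ * (∫ t, W t * f t) + M * (1 - a) / M₂ * ∫ t, W t * g t := by
        rw [integral_add (hfi.const_mul _) (hgi.const_mul _), integral_const_mul,
          integral_const_mul]
    _ ≤ M * a / M₁ * M₁ + M * (1 - a) / M₂ * M₂ := by
        have : 0 < 1 - a := by linarith
        gcongr
    _ = M := by field_simp; ring

theorem gw_mul_pow_le (τ : ℝ) {Δ : ℝ} (hΔ : 0 < Δ) (n : ℕ) (t : ℝ) :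
    gw τ Δ t * (1 + |t|) ^ n ≤ (1 + |τ| + Δ) ^ n * n.factorial * Real.exp 2 := by
  set y := |t - τ| / Δ with hy
  have hy0 : 0 ≤ y := by positivity
  have h1 : 1 + |t| ≤ (1 + |τ| + Δ) * (1 + y) := by
    have h2 : |t| ≤ |τ| + |t - τ| := by
      have := abs_add_le τ (t - τ)
      rwa [add_sub_cancel] at this
    have h3 : |t - τ| = Δ * y := by rw [hy]; field_simp
    nlinarith [abs_nonneg τ, mul_nonneg (abs_nonneg τ) hy0]
  have h4 : (1 + y) ^ n ≤ n.factorial * Real.exp (1 + y) := by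
    have := sum_exp_le (show 0 ≤ 1 + y by positivity) {n}
    rw [sum_singleton, div_le_iff₀ (by positivity)] at this
    linarith
  have h5 : gw τ Δ t * Real.exp (1 + y) ≤ Real.exp 2 := by
    have : ((t - τ) / Δ) ^ 2 = y ^ 2 := by rw [hy, div_pow, div_pow, sq_abs]
    rw [gw, ← Real.exp_add, this]
    refine Real.exp_le_exp.2 ?_
    nlinarith [sq_nonneg (y - 1 / 2)]
  calc gw τ Δ t * (1 + |t|) ^ n ≤ gw τ Δ t * ((1 + |τ| + Δ) * (1 + y)) ^ n := by
        have := (gw_pos τ Δ t).le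
        gcongr
    _ = (1 + |τ| + Δ) ^ n * (gw τ Δ t * (1 + y) ^ n) := by rw [mul_pow]; ring
    _ ≤ (1 + |τ| + Δ) ^ n * (gw τ Δ t * (n.factorial * Real.exp (1 + y))) := by
        have := (gw_pos τ Δ t).le
        gcongr
    _ = (1 + |τ| + Δ) ^ n * n.factorial * (gw τ Δ t * Real.exp (1 + y)) := by ring
    _ ≤ _ := by gcongr

theorem gw_mul_pow_le_inv (τ : ℝ) {Δ : ℝ} (hΔ : 0 < Δ) (n : ℕ) (t : ℝ) :
    gw τ Δ t * (1 + |t|) ^ n ≤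
      (1 + |τ| + Δ) ^ (n + 2) * (n + 2).factorial * Real.exp 2 * (1 + t ^ 2)⁻¹ := by
  have h := gw_mul_pow_le τ hΔ (n + 2) t
  rw [← div_eq_mul_inv, le_div_iff₀ (by positivity)]
  refine le_trans ?_ h
  rw [pow_add, ← mul_assoc]
  have h1 : 1 + t ^ 2 ≤ (1 + |t|) ^ 2 := by
    rw [← sq_abs t]; nlinarith [abs_nonneg t]
  have := (gw_pos τ Δ t).le
  gcongr

theorem integrable_gw_mul_of_le (τ : ℝ) {Δ : ℝ} (hΔ : 0 < Δ) {f : ℝ → ℝ} (hf : Continuous f)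
    {K : ℝ} {n : ℕ} (h : ∀ t, |f t| ≤ K * (1 + |t|) ^ n) : Integrable fun t => gw τ Δ t * f t := by
  refine Integrable.mono' (integrable_inv_one_add_sq.const_mul
    (|K| * ((1 + |τ| + Δ) ^ (n + 2) * (n + 2).factorial * Real.exp 2)))
    ((continuous_gw τ Δ).mul hf).aestronglyMeasurable (Filter.Eventually.of_forall fun t => ?_)
  rw [Real.norm_eq_abs, abs_mul, abs_of_pos (gw_pos τ Δ t)]
  have h1 := gw_mul_pow_le_inv τ hΔ n t
  calc gw τ Δ t * |f t| ≤ gw τ Δ t * (|K| * (1 + |t|) ^ n) := by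
        refine mul_le_mul_of_nonneg_left ((h t).trans ?_) (gw_pos τ Δ t).le
        gcongr
        exact le_abs_self K
    _ = |K| * (gw τ Δ t * (1 + |t|) ^ n) := by ring
    _ ≤ |K| * ((1 + |τ| + Δ) ^ (n + 2) * (n + 2).factorial * Real.exp 2 * (1 + t ^ 2)⁻¹) := by
        gcongr
    _ = _ := by ring

/-! ### The holomorphic Gaussian weight -/

/-- The holomorphic weight whose `p`-th power has modulus a Gaussian on vertical lines. -/
noncomputable def wE (p τ Δ : ℝ) (s : ℂ) : ℂ :=
  Complex.exp ((s - τ * Complex.I) ^ 2 / ((p * Δ ^ 2 : ℝ) : ℂ))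

theorem norm_wE_rpow {p Δ : ℝ} (hp : 0 < p) (τ σ t : ℝ) :
    ‖wE p τ Δ (σ + t * Complex.I)‖ ^ p = Real.exp (σ ^ 2 / Δ ^ 2) * gw τ Δ t := by
  rw [wE, Complex.norm_exp, Complex.div_ofReal_re, ← Real.exp_mul, gw, ← Real.exp_add]
  have : (((σ : ℂ) + t * Complex.I - τ * Complex.I) ^ 2).re = σ ^ 2 - (t - τ) ^ 2 := by
    rw [show (σ : ℂ) + t * Complex.I - τ * Complex.I = σ + ((t - τ : ℝ) : ℂ) * Complex.I by
      push_cast; ring, sq, Complex.mul_re, re_add_mul_I, im_add_mul_I]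
    ring
  rw [this]
  congr 1
  rcases eq_or_ne Δ 0 with h | h
  · simp [h]
  · field_simp; ring

theorem differentiable_wE (p τ Δ : ℝ) : Differentiable ℂ (wE p τ Δ) := by
  unfold wE
  fun_prop

theorem exp_sq_div_sq_le {σ Δ : ℝ} (h0 : 0 ≤ σ) (h4 : σ ≤ 4) (hΔ : 4 ≤ Δ) :
    Real.exp (σ ^ 2 / Δ ^ 2) ≤ Real.exp 1 := by
  refine Real.exp_le_exp.2 ?_
  rw [div_le_one (by positivity)]
  gcongr
  linarith

theorem rpow_le_of_le_poly {x K p : ℝ} {t : ℝ} {n : ℕ} (hp : 0 < p) (hp1 : p ≤ 1) (hx : 0 ≤ x)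
    (h : x ≤ K * (1 + |t|) ^ n) : x ^ p ≤ (|K| + 1) * (1 + |t|) ^ n := by
  have h1 : (1 : ℝ) ≤ (1 + |t|) ^ n := one_le_pow₀ (by linarith [abs_nonneg t])
  have h2 : K * (1 + |t|) ^ n ≤ (|K| + 1) * (1 + |t|) ^ n := by
    gcongr; linarith [le_abs_self K]
  calc x ^ p ≤ ((|K| + 1) * (1 + |t|) ^ n) ^ p := Real.rpow_le_rpow hx (h.trans h2) hp.le
    _ ≤ ((|K| + 1) * (1 + |t|) ^ n) ^ (1 : ℝ) := by
        refine Real.rpow_le_rpow_of_exponent_le ?_ hp1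
        exact one_le_mul_of_one_le_of_one_le (by linarith [abs_nonneg K]) h1
    _ = _ := Real.rpow_one _

theorem exists_decay_wE_mul {p Δ K : ℝ} {n : ℕ} (hp : 0 < p) (hp1 : p ≤ 1) (hΔ : 4 ≤ Δ) (τ : ℝ)
    {f : ℂ → ℂ} (hf : ∀ s : ℂ, 1 / 2 ≤ s.re → s.re ≤ 4 → ‖f s‖ ≤ K * (1 + |s.im|) ^ n) :
    ∃ C : ℝ, ∀ s : ℂ, 1 / 2 ≤ s.re → s.re ≤ 4 →
      ‖wE p τ Δ s * f s‖ ^ p ≤ C * (1 + s.im ^ 2)⁻¹ := by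
  have hΔ0 : 0 < Δ := by linarith
  refine ⟨Real.exp 1 * (|K| + 1) *
    ((1 + |τ| + Δ) ^ (n + 2) * (n + 2).factorial * Real.exp 2), fun s h1 h2 => ?_⟩
  rw [norm_mul, Real.mul_rpow (norm_nonneg _) (norm_nonneg _)]
  have h3 := norm_wE_rpow (Δ := Δ) hp τ s.re s.im
  rw [Complex.re_add_im] at h3
  rw [h3]
  have h4 := rpow_le_of_le_poly hp hp1 (norm_nonneg _) (hf s h1 h2)
  have h5 := gw_mul_pow_le_inv τ hΔ0 n s.im
  have h6 := exp_sq_div_sq_le (by linarith : 0 ≤ s.re) h2 hΔ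
  calc _ ≤ Real.exp 1 * gw τ Δ s.im * ((|K| + 1) * (1 + |s.im|) ^ n) := by
        have := (gw_pos τ Δ s.im).le
        gcongr
    _ = Real.exp 1 * (|K| + 1) * (gw τ Δ s.im * (1 + |s.im|) ^ n) := by ring
    _ ≤ Real.exp 1 * (|K| + 1) *
        ((1 + |τ| + Δ) ^ (n + 2) * (n + 2).factorial * Real.exp 2 * (1 + s.im ^ 2)⁻¹) := by gcongr
    _ = _ := by ring

theorem analyticAt_wE_mul {p τ Δ : ℝ} {f : ℂ → ℂ}
    (hf : DifferentiableOn ℂ f {s : ℂ | 0 < s.re}) {s : ℂ} (hs : 1 / 2 ≤ s.re) :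
    AnalyticAt ℂ (fun s => wE p τ Δ s * f s) s :=
  ((differentiable_wE p τ Δ).differentiableOn.mul hf).analyticAt
    ((isOpen_halfPlane 0).mem_nhds (show 0 < s.re by linarith))

/-- Interpolation with an exponential weight between the lines `Re s = 1/2` and `Re s = 4`. -/
theorem lineMean_wE_le {p Δ K : ℝ} {n : ℕ} (hp : 0 < p) (hp1 : p ≤ 1) (hΔ : 4 ≤ Δ) (τ : ℝ)
    {f : ℂ → ℂ} (hfd : DifferentiableOn ℂ f {s : ℂ | 0 < s.re})
    (hf : ∀ s : ℂ, 1 / 2 ≤ s.re → s.re ≤ 4 → ‖f s‖ ≤ K * (1 + |s.im|) ^ n) {lam : ℝ}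
    (hlam : 0 ≤ lam) {σ : ℝ} (h1 : 1 / 2 ≤ σ) (h2 : σ ≤ 4) :
    lineMean (fun s => wE p τ Δ s * f s) p σ ≤
      Real.exp (-(lam * (σ - 1 / 2))) * lineMean (fun s => wE p τ Δ s * f s) p (1 / 2) +
      Real.exp (lam * (4 - σ)) * lineMean (fun s => wE p τ Δ s * f s) p 4 := by
  -- The p-th power of the modulus of the inserted exponential is e^(λ Re s), constant on each line,
  -- so it only rescales the two boundary means.
  set f' : ℂ → ℂ := fun s => f s * Complex.exp ((lam / p : ℝ) * s) with hf'
  have hfd' : DifferentiableOn ℂ f' {s : ℂ | 0 < s.re} := by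
    refine hfd.mul (Differentiable.differentiableOn ?_)
    fun_prop
  have hbound : ∀ s : ℂ, 1 / 2 ≤ s.re → s.re ≤ 4 →
      ‖f' s‖ ≤ (|K| * Real.exp (lam / p * 4)) * (1 + |s.im|) ^ n := by
    intro s hs1 hs2
    rw [hf', norm_mul, Complex.norm_exp, Complex.re_ofReal_mul]
    have h3 := hf s hs1 hs2
    have h4 : K * (1 + |s.im|) ^ n ≤ |K| * (1 + |s.im|) ^ n := by gcongr; exact le_abs_self K
    have h5 : 0 ≤ lam / p := by positivity
    calc ‖f s‖ * Real.exp (lam / p * s.re)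
        ≤ (|K| * (1 + |s.im|) ^ n) * Real.exp (lam / p * 4) := by
          gcongr
          exact h3.trans h4
      _ = _ := by ring
  obtain ⟨C, hC⟩ := exists_decay_wE_mul hp hp1 hΔ τ hbound
  have hmax := lineMean_le_max hp (fun s hs1 _ => analyticAt_wE_mul (p := p) (τ := τ) (Δ := Δ) hfd' hs1)
    hC h1 h2
  have hscale : ∀ x : ℝ, lineMean (fun s => wE p τ Δ s * f' s) p x =
      Real.exp (lam * x) * lineMean (fun s => wE p τ Δ s * f s) p x := by
    intro x
    unfold lineMean
    rw [← integral_const_mul]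
    refine integral_congr_ae (Filter.Eventually.of_forall fun t => ?_)
    simp only [hf']
    rw [← mul_assoc, norm_mul, Real.mul_rpow (norm_nonneg _) (norm_nonneg _), Complex.norm_exp,
      ← Real.exp_mul, mul_comm]
    congr 2
    rw [Complex.re_ofReal_mul, re_add_mul_I]
    field_simp
  rw [hscale, hscale, hscale] at hmax
  have e1 : Real.exp (-(lam * (σ - 1 / 2))) = Real.exp (lam * (1 / 2)) / Real.exp (lam * σ) := by
    rw [← Real.exp_sub]; congr 1; ring
  have e2 : Real.exp (lam * (4 - σ)) = Real.exp (lam * 4) / Real.exp (lam * σ) := by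
    rw [← Real.exp_sub]; congr 1; ring
  have hpos := Real.exp_pos (lam * σ)
  rw [e1, e2, div_mul_eq_mul_div, div_mul_eq_mul_div, ← add_div, le_div_iff₀ hpos, mul_comm]
  refine hmax.trans (max_le_add_of_nonneg ?_ ?_)
  · exact mul_nonneg (Real.exp_pos _).le (lineMean_nonneg _ _ _)
  · exact mul_nonneg (Real.exp_pos _).le (lineMean_nonneg _ _ _)

/-! ### The rational weight -/

/-- The rational function removing the pole of the derivative of zeta at `1`. -/
noncomputable def kap (s : ℂ) : ℂ := ((s - 1) / (s + 1)) ^ 2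

theorem add_one_ne_zero_of_re_pos {s : ℂ} (hs : 0 < s.re) : s + 1 ≠ 0 := by
  intro h
  have := congrArg Complex.re h
  simp at this
  linarith

theorem norm_kap_le_one {s : ℂ} (hs : 0 < s.re) : ‖kap s‖ ≤ 1 := by
  rw [kap, norm_pow, norm_div]
  refine pow_le_one₀ (by positivity) ?_
  rw [div_le_one (norm_pos_iff.2 (add_one_ne_zero_of_re_pos hs))]
  rw [← sq_le_sq₀ (norm_nonneg _) (norm_nonneg _), ← Complex.normSq_eq_norm_sq,
    ← Complex.normSq_eq_norm_sq, Complex.normSq_apply, Complex.normSq_apply]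
  simp
  nlinarith

/-- The quotient |s - 1|/|s + 1| is smallest at s = 3/4, where it equals 1/7. -/
theorem le_norm_kap {s : ℂ} (hs : 0 < s.re) (hs' : s.re ≤ 3 / 4) : 1 / 49 ≤ ‖kap s‖ := by
  have h0 := add_one_ne_zero_of_re_pos hs
  rw [kap, norm_pow, norm_div, div_pow, ← Complex.normSq_eq_norm_sq, ← Complex.normSq_eq_norm_sq,
    le_div_iff₀ (Complex.normSq_pos.2 h0), Complex.normSq_apply, Complex.normSq_apply]
  simp
  nlinarith [sq_nonneg s.im]

theorem kap_mul_deriv_zeta {s : ℂ} (hs : s ≠ 1) :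
    kap s * deriv riemannZeta s = ((s + 1) ^ 2)⁻¹ * zetaD s := by
  rw [zetaD_eq hs, kap, div_pow]; ring

theorem differentiableOn_inv_sq : DifferentiableOn ℂ (fun s : ℂ => ((s + 1) ^ 2)⁻¹)
    {s : ℂ | 0 < s.re} := by
  intro s hs
  refine DifferentiableAt.differentiableWithinAt ?_
  have h : Differentiable ℂ fun s : ℂ => (s + 1) ^ 2 := by fun_prop
  exact (h s).fun_inv (pow_ne_zero 2 (add_one_ne_zero_of_re_pos hs))

theorem differentiableOn_kap : DifferentiableOn ℂ kap {s : ℂ | 0 < s.re} := by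
  have h : DifferentiableOn ℂ (fun s : ℂ => (s - 1) ^ 2 * ((s + 1) ^ 2)⁻¹) {s : ℂ | 0 < s.re} := by
    refine DifferentiableOn.fun_mul (Differentiable.differentiableOn ?_) differentiableOn_inv_sq
    fun_prop
  refine h.congr fun s _ => ?_
  rw [kap, div_pow, div_eq_mul_inv]

theorem norm_inv_sq_le_one {s : ℂ} (hs : 0 < s.re) : ‖((s + 1) ^ 2)⁻¹‖ ≤ 1 := by
  rw [norm_inv, norm_pow]
  refine inv_le_one_of_one_le₀ (one_le_pow₀ ?_)
  have := (le_abs_self _).trans (Complex.abs_re_le_norm (s + 1))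
  simp at this
  linarith

theorem exists_norm_ev_cchar_le {f : AF} {N : ℝ} (hf : LogLen f N) : ∃ C : ℝ, 0 ≤ C ∧
    ∀ s : ℂ, 0 ≤ s.re → ‖ev (cchar s) f‖ ≤ C := by
  refine ⟨∑ n ∈ upTo N, |f n|, sum_nonneg fun _ _ => abs_nonneg _, fun s hs => ?_⟩
  rw [ev_eq_sum' _ hf]
  refine (norm_sum_le _ _).trans (sum_le_sum fun n hn => ?_)
  rw [norm_smul, norm_cchar _ (mem_upTo.1 hn).1, Real.norm_eq_abs]
  refine mul_le_of_le_one_right (abs_nonneg _) ?_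
  have := rchar_anti hs n (mem_upTo.1 hn).1
  rwa [rchar_apply 0, neg_zero, Real.rpow_zero] at this

/-! ### Estimates on the line `Re s = 4` -/

theorem ev_rchar_anti {f : AF} {N : ℝ} (hf : LogLen f N) (h : ∀ n, 0 ≤ f n) {σ τ : ℝ} (hστ : σ ≤ τ) :
    ev (rchar τ) f ≤ ev (rchar σ) f := by
  rw [ev_eq_sum' _ hf, ev_eq_sum' _ hf]
  refine sum_le_sum fun n hn => ?_
  rw [smul_eq_mul, smul_eq_mul]
  exact mul_le_mul_of_nonneg_left (rchar_anti hστ n (mem_upTo.1 hn).1) (h n)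

theorem norm_ev_NK_le {L : ℝ} (hL : 0 ≤ L) (J B : ℕ) (a : ℝ) {s : ℂ} (hs : 2 ≤ s.re) :
    ‖ev (cchar s) (NK L J B a)‖ ≤ Real.exp (2 * |a|) := by
  have hP : ∀ j, ‖ev (cchar s) (PJ L j)‖ ≤ ev (rchar 2) (PJ L j) := fun j =>
    (norm_ev_le (logLen_PJ L j) (logLen_PJ L j)
      (fun n => (abs_of_nonneg (PJ_nonneg L j n)).le) s).trans
      (ev_rchar_anti (logLen_PJ L j) (PJ_nonneg L j) hs)
  unfold NK
  rw [ev_prod_aeval _ hL, norm_prod]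
  calc ∏ j ∈ range J, ‖aeval (ev (cchar s) (PJ L j)) (texp (deg B j) a)‖
      ≤ ∏ j ∈ range J, Real.exp (|a| * ev (rchar 2) (PJ L j)) := by
        refine prod_le_prod (fun _ _ => norm_nonneg _) fun j _ => ?_
        rw [aeval_texp_complex]
        have h0 : 0 ≤ |a| * ev (rchar 2) (PJ L j) :=
          mul_nonneg (abs_nonneg a) (ev_rchar_nonneg (PJ_nonneg L j) 2)
        refine (norm_sum_le _ _).trans (le_trans (sum_le_sum fun r _ => ?_) (sum_exp_le h0 _))
        rw [norm_div, norm_pow, norm_mul, Complex.norm_real, Real.norm_eq_abs, Complex.norm_natCast]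
        gcongr
        exact hP j
    _ = Real.exp (|a| * ∑ j ∈ range J, ev (rchar 2) (PJ L j)) := by
        rw [mul_sum, Real.exp_sum]
    _ ≤ _ := by
        rw [mul_comm 2]
        gcongr
        exact sum_ev_PJ_le_two hL J

theorem ev_rchar_NK_le {L : ℝ} (hL : 0 ≤ L) (J B : ℕ) {a : ℝ} (ha : 0 ≤ a) {σ : ℝ} (hσ : 2 ≤ σ) :
    ev (rchar σ) (NK L J B a) ≤ Real.exp (2 * a) := by
  unfold NK
  rw [ev_prod_aeval _ hL]
  have hP0 : ∀ j, 0 ≤ a * ev (rchar σ) (PJ L j) := fun j =>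
    mul_nonneg ha (ev_rchar_nonneg (PJ_nonneg L j) σ)
  calc ∏ j ∈ range J, aeval (ev (rchar σ) (PJ L j)) (texp (deg B j) a)
      ≤ ∏ j ∈ range J, Real.exp (a * ev (rchar 2) (PJ L j)) := by
        refine prod_le_prod (fun j _ => ?_) fun j _ => ?_
        · rw [aeval_texp_real]
          exact sum_nonneg fun r _ => div_nonneg (pow_nonneg (hP0 j) r) (Nat.cast_nonneg _)
        · rw [aeval_texp_real]
          refine (sum_exp_le (hP0 j) _).trans (Real.exp_le_exp.2 ?_)
          exact mul_le_mul_of_nonneg_left (ev_rchar_anti (logLen_PJ L j) (PJ_nonneg L j) hσ) ha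
    _ = Real.exp (a * ∑ j ∈ range J, ev (rchar 2) (PJ L j)) := by
        rw [mul_sum, Real.exp_sum]
    _ ≤ _ := by
        rw [mul_comm 2]
        gcongr
        exact sum_ev_PJ_le_two hL J

theorem lgL_nonneg (L : ℝ) (n : ℕ) : 0 ≤ lgL L n := by
  rw [lgL_apply]
  split_ifs
  · exact Real.log_natCast_nonneg n
  · rfl

theorem ev_rchar_three_lgL_le (L : ℝ) : ev (rchar 3) (lgL L) ≤ 2 := by
  rw [ev_eq_sum' _ (logLen_lgL L)]
  have h := sum_rpow_le one_pos ⌊Real.exp L⌋₊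
  norm_num at h
  refine le_trans (sum_le_sum fun n hn => ?_) h
  have hn0 := (mem_upTo.1 hn).1
  have hnpos : (0 : ℝ) < n := by positivity
  rw [smul_eq_mul, rchar_apply, lgL_apply, if_pos (mem_upTo.1 hn).2,
    show (-3 : ℝ) = -1 + -2 by norm_num, Real.rpow_add hnpos, ← mul_assoc]
  norm_num
  refine mul_le_of_le_one_left (by positivity) ?_
  rw [Real.rpow_neg_one, ← div_eq_mul_inv]
  exact div_le_one_of_le₀ (Real.log_le_self hnpos.le) hnpos.le

theorem logLen_DD {L : ℝ} (hL : 0 ≤ L) (J B : ℕ) (k : ℝ) :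
    LogLen (DD L J B k) (L + 2 * B * L + 2 * B * L) :=
  ((logLen_lgL L).mul (logLen_NK hL J B (-1))).mul (logLen_NK hL J B k)

theorem abs_NK_le (L : ℝ) (J B : ℕ) {a b : ℝ} (hab : |a| ≤ b) (n : ℕ) :
    |NK L J B a n| ≤ NK L J B b n := by
  unfold NK
  refine abs_prod_le (fun j _ => abs_aeval_le (PJ_nonneg L j) fun r => ?_) n
  rw [coeff_texp, coeff_texp]
  split_ifs
  · rw [abs_div, abs_pow, Nat.abs_cast]
    gcongr
  · simp

/-- Only log n > L remains, where n^(-4) ≤ e^(-L) n^(-3). The coefficients are majorised by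
replacing N_(-1) with N_1, and the resulting series at 3 is bounded uniformly. -/
theorem norm_ev_DD_sub_rho_le {L : ℝ} (hL : 0 ≤ L) (J B : ℕ) {k : ℝ} (hk : 0 ≤ k) {s : ℂ}
    (hs : s.re = 4) :
    ‖ev (cchar s) (DD L J B k) - ev (cchar s) (rho L J B k)‖ ≤
      2 * Real.exp (2 + 2 * k) * Real.exp (-L) := by
  set M := L + 2 * B * L + 2 * B * L with hM
  have hLM : L ≤ M := by
    have : 0 ≤ 2 * B * L := by positivity
    linarith
  set D' : AF := lgL L * NK L J B 1 * NK L J B k with hD'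
  have hD'L : LogLen D' M := ((logLen_lgL L).mul (logLen_NK hL J B 1)).mul (logLen_NK hL J B k)
  have hNK1 : ∀ n, 0 ≤ NK L J B 1 n := NK_nonneg L J B zero_le_one
  have hD'0 : ∀ n, 0 ≤ D' n := mul_nonneg' (mul_nonneg' (lgL_nonneg L) hNK1) (NK_nonneg L J B hk)
  have hle : ∀ n, |DD L J B k n| ≤ D' n := by
    refine abs_mul_le (abs_mul_le (fun n => (abs_of_nonneg (lgL_nonneg L n)).le)
      (abs_NK_le L J B (by simp))) (abs_NK_le L J B (abs_of_nonneg hk).le)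
  have hDv : ev (rchar 3) D' ≤ 2 * Real.exp (2 + 2 * k) := by
    rw [hD', ev_mul _ ((logLen_lgL L).mul (logLen_NK hL J B 1)) (logLen_NK hL J B k),
      ev_mul _ (logLen_lgL L) (logLen_NK hL J B 1), Real.exp_add, mul_assoc]
    have h1 := ev_rchar_NK_le hL J B zero_le_one (σ := 3) (by norm_num)
    have h2 := ev_rchar_NK_le hL J B hk (σ := 3) (by norm_num)
    rw [mul_one] at h1
    have h1' := ev_rchar_nonneg hNK1 3
    have h2' := ev_rchar_nonneg (NK_nonneg L J B hk) 3
    exact mul_le_mul (ev_rchar_three_lgL_le L) (mul_le_mul h1 h2 h2' (Real.exp_pos _).le)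
      (mul_nonneg h1' h2') zero_le_two
  rw [ev_eq_sum' _ (logLen_DD hL J B k), ev_eq_sum' _ ((logLen_rho L J B k).mono hLM),
    ← sum_sub_distrib]
  calc _ ≤ ∑ n ∈ upTo M, Real.exp (-L) * (D' n * rchar 3 n) := by
        refine (norm_sum_le _ _).trans (sum_le_sum fun n hn => ?_)
        have hn0 := (mem_upTo.1 hn).1
        have hnpos : (0 : ℝ) < n := by positivity
        have hpos : 0 ≤ Real.exp (-L) * (D' n * rchar 3 n) :=
          mul_nonneg (Real.exp_pos _).le (mul_nonneg (hD'0 n) (rchar_nonneg 3 n))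
        rw [rho_apply, ← sub_smul]
        split_ifs with h
        · simpa using hpos
        · rw [sub_zero, norm_smul, norm_cchar _ hn0, hs, Real.norm_eq_abs]
          have he : (n : ℝ)⁻¹ ≤ Real.exp (-L) := by
            rw [Real.exp_neg]
            refine inv_anti₀ (Real.exp_pos _) ?_
            rw [← Real.le_log_iff_exp_le hnpos]
            exact (not_le.1 h).le
          have h4 : rchar 4 n = (n : ℝ)⁻¹ * rchar 3 n := by
            rw [rchar_apply, rchar_apply, show (-4 : ℝ) = -1 + -3 by norm_num,
              Real.rpow_add hnpos, Real.rpow_neg_one]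
          rw [h4]
          have := rchar_nonneg 3 n
          calc |DD L J B k n| * ((n : ℝ)⁻¹ * rchar 3 n)
              ≤ D' n * (Real.exp (-L) * rchar 3 n) := by
                gcongr
                · exact hD'0 n
                · exact hle n
            _ = _ := by ring
    _ = Real.exp (-L) * ev (rchar 3) D' := by
        rw [ev_eq_sum' _ hD'L, mul_sum]; rfl
    _ ≤ _ := by
        rw [mul_comm]
        gcongr

/-- The near cancellation driving the argument. The sum splits into the tail of ζ' times bounded
polynomials and the truncation error of Y, each O(e^(-L)). -/
theorem exists_norm_deriv_zeta_mul_add_le {k : ℝ} (hk : 0 ≤ k) : ∃ C : ℝ, 0 < C ∧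
    ∀ L : ℝ, 0 ≤ L → ∀ (J B : ℕ) (s : ℂ), s.re = 4 →
      ‖deriv riemannZeta s * ev (cchar s) (NK L J B (-1)) * ev (cchar s) (NK L J B k) +
        ev (cchar s) (rho L J B k)‖ ≤ C * Real.exp (-L) := by
  obtain ⟨C, hC, h⟩ := exists_norm_deriv_zeta_add_le
  refine ⟨C * (Real.exp 2 * Real.exp (2 * k)) + 2 * Real.exp (2 + 2 * k), by positivity,
    fun L hL J B s hs => ?_⟩
  have h1 := norm_ev_NK_le hL J B (-1) (s := s) (by rw [hs]; norm_num)
  have h2 := norm_ev_NK_le hL J B k (s := s) (by rw [hs]; norm_num)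
  rw [abs_neg, abs_one, mul_one] at h1
  rw [abs_of_nonneg hk] at h2
  have h3 := norm_ev_DD_sub_rho_le hL J B hk hs
  have hDD : ev (cchar s) (DD L J B k) = ev (cchar s) (lgL L) * ev (cchar s) (NK L J B (-1)) *
      ev (cchar s) (NK L J B k) := by
    rw [DD, ev_mul _ ((logLen_lgL L).mul (logLen_NK hL J B (-1))) (logLen_NK hL J B k),
      ev_mul _ (logLen_lgL L) (logLen_NK hL J B (-1))]
  have heq : deriv riemannZeta s * ev (cchar s) (NK L J B (-1)) * ev (cchar s) (NK L J B k) +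
        ev (cchar s) (rho L J B k) =
      (deriv riemannZeta s + ev (cchar s) (lgL L)) *
        (ev (cchar s) (NK L J B (-1)) * ev (cchar s) (NK L J B k)) -
      (ev (cchar s) (DD L J B k) - ev (cchar s) (rho L J B k)) := by
    rw [hDD]; ring
  rw [heq]
  refine (norm_sub_le _ _).trans ?_
  rw [norm_mul, norm_mul]
  calc _ ≤ C * Real.exp (-L) * (Real.exp 2 * Real.exp (2 * k)) +
        2 * Real.exp (2 + 2 * k) * Real.exp (-L) := by
        have := h L s hs
        gcongr
    _ = _ := by ring

theorem exists_norm_deriv_zeta_le : ∃ C : ℝ, 0 < C ∧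
    ∀ s : ℂ, s.re = 4 → ‖deriv riemannZeta s‖ ≤ C := by
  obtain ⟨C, hC, h⟩ := exists_norm_deriv_zeta_add_le
  refine ⟨C, hC, fun s hs => ?_⟩
  have := h 0 s hs
  have h0 : ev (cchar s) (lgL 0) = 0 := by
    rw [ev_eq_sum' _ (logLen_lgL 0)]
    refine sum_eq_zero fun n hn => ?_
    rw [lgL_apply, if_pos (mem_upTo.1 hn).2,
      le_antisymm (mem_upTo.1 hn).2 (Real.log_natCast_nonneg n), zero_smul]
  simpa [h0] using this

/-! ### Regular functions in the strip and interpolation for a sum -/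

/-- Holomorphic in the right half plane, of at most cubic growth in `1/2 ≤ Re s ≤ 4`. -/
def Reg (f : ℂ → ℂ) : Prop := DifferentiableOn ℂ f {s : ℂ | 0 < s.re} ∧
  ∃ K : ℝ, ∀ s : ℂ, 1 / 2 ≤ s.re → s.re ≤ 4 → ‖f s‖ ≤ K * (1 + |s.im|) ^ 3

theorem Reg.add {f g : ℂ → ℂ} (hf : Reg f) (hg : Reg g) : Reg fun s => f s + g s := by
  obtain ⟨hf, K, hK⟩ := hf
  obtain ⟨hg, K', hK'⟩ := hg
  refine ⟨hf.add hg, K + K', fun s h1 h2 => ?_⟩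
  rw [add_mul]
  exact (norm_add_le _ _).trans (add_le_add (hK s h1 h2) (hK' s h1 h2))

theorem Reg.neg {f : ℂ → ℂ} (hf : Reg f) : Reg fun s => -f s := by
  obtain ⟨hf, K, hK⟩ := hf
  refine ⟨hf.neg, K, fun s h1 h2 => ?_⟩
  rw [norm_neg]
  exact hK s h1 h2

theorem Reg.integrable {f : ℂ → ℂ} (hf : Reg f) {p Δ : ℝ} (hp : 0 < p) (hp1 : p ≤ 1) (hΔ : 4 ≤ Δ)
    (τ : ℝ) {σ : ℝ} (h1 : 1 / 2 ≤ σ) (h2 : σ ≤ 4) :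
    Integrable fun t : ℝ => ‖wE p τ Δ (σ + t * Complex.I) * f (σ + t * Complex.I)‖ ^ p := by
  obtain ⟨hf, K, hK⟩ := hf
  obtain ⟨C, hC⟩ := exists_decay_wE_mul hp hp1 hΔ τ hK
  exact integrable_line hp (fun s hs1 _ => analyticAt_wE_mul (p := p) (τ := τ) (Δ := Δ) hf hs1)
    hC h1 h2

/-- For p ≤ 1 the function x^p is subadditive, so means of p-th powers satisfy a triangle inequality
without taking roots. -/
theorem lineMean_wE_le_add {f g h : ℂ → ℂ} (hf : Reg f) (hg : Reg g) (hfg : ∀ s, h s = f s + g s)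
    {p Δ : ℝ} (hp : 0 < p) (hp1 : p ≤ 1) (hΔ : 4 ≤ Δ) (τ : ℝ) {σ : ℝ} (h1 : 1 / 2 ≤ σ)
    (h2 : σ ≤ 4) :
    lineMean (fun s => wE p τ Δ s * h s) p σ ≤
      lineMean (fun s => wE p τ Δ s * f s) p σ + lineMean (fun s => wE p τ Δ s * g s) p σ := by
  unfold lineMean
  have i1 := hf.integrable hp hp1 hΔ τ h1 h2
  have i2 := hg.integrable hp hp1 hΔ τ h1 h2
  rw [← integral_add i1 i2]
  refine integral_mono_of_nonneg (Filter.Eventually.of_forall fun t => by positivity) (i1.add i2)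
    (Filter.Eventually.of_forall fun t => ?_)
  simp only
  rw [hfg, mul_add]
  refine le_trans (Real.rpow_le_rpow (norm_nonneg _) (norm_add_le _ _) hp.le) ?_
  exact Real.rpow_add_le_add_rpow (norm_nonneg _) (norm_nonneg _) hp.le hp1

theorem lineMean_wE_neg (f : ℂ → ℂ) (p τ Δ σ : ℝ) :
    lineMean (fun s => wE p τ Δ s * -f s) p σ = lineMean (fun s => wE p τ Δ s * f s) p σ := by
  unfold lineMean
  simp only [mul_neg, norm_neg]

theorem lineMean_wE_interpolate {f g : ℂ → ℂ} (hf : Reg f) (hg : Reg g)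
    {p Δ : ℝ} (hp : 0 < p) (hp1 : p ≤ 1) (hΔ : 4 ≤ Δ) (τ : ℝ) {lam : ℝ} (hlam : 0 ≤ lam) {σ : ℝ}
    (h1 : 1 / 2 ≤ σ) (h2 : σ ≤ 4) :
    lineMean (fun s => wE p τ Δ s * g s) p σ ≤
      Real.exp (-(lam * (σ - 1 / 2))) * lineMean (fun s => wE p τ Δ s * g s) p (1 / 2) +
      2 * lineMean (fun s => wE p τ Δ s * f s) p (1 / 2) +
      lineMean (fun s => wE p τ Δ s * f s) p 4 +
      Real.exp (lam * (4 - σ)) * lineMean (fun s => wE p τ Δ s * (f s + g s)) p 4 := by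
  have a1 := lineMean_wE_le_add hf.neg (hf.add hg) (h := g) (fun s => by ring) hp hp1 hΔ τ h1 h2
  rw [lineMean_wE_neg] at a1
  have a2 := lineMean_wE_le_add hf hg (h := fun s => f s + g s) (fun s => rfl) hp hp1 hΔ τ le_rfl
    (by norm_num)
  obtain ⟨K, hK⟩ := hf.2
  obtain ⟨K', hK'⟩ := (hf.add hg).2
  have a3 := lineMean_wE_le hp hp1 hΔ τ hf.1 hK le_rfl h1 h2
  have a4 := lineMean_wE_le hp hp1 hΔ τ (hf.add hg).1 hK' hlam h1 h2
  simp only [zero_mul, neg_zero, Real.exp_zero, one_mul] at a3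
  have he : Real.exp (-(lam * (σ - 1 / 2))) ≤ 1 :=
    Real.exp_le_one_iff.2 (neg_nonpos.2 (mul_nonneg hlam (by linarith)))
  have hF := lineMean_nonneg (fun s => wE p τ Δ s * f s) p (1 / 2)
  have b1 := mul_le_mul_of_nonneg_left a2 (Real.exp_pos (-(lam * (σ - 1 / 2)))).le
  have b2 := mul_le_mul_of_nonneg_right he hF
  rw [mul_add] at b1
  linarith

theorem lineMean_wE_eq (f : ℂ → ℂ) {p : ℝ} (hp : 0 < p) (τ Δ σ : ℝ) :
    lineMean (fun s => wE p τ Δ s * f s) p σ =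
      Real.exp (σ ^ 2 / Δ ^ 2) * ∫ t, gw τ Δ t * ‖f (σ + t * Complex.I)‖ ^ p := by
  unfold lineMean
  rw [← integral_const_mul]
  refine integral_congr_ae (Filter.Eventually.of_forall fun t => ?_)
  simp only
  rw [norm_mul, Real.mul_rpow (norm_nonneg _) (norm_nonneg _), norm_wE_rpow hp, mul_assoc]

theorem lineMean_wE_le_const {f : ℂ → ℂ} {p Δ K σ : ℝ} (hp : 0 < p) (hΔ : 4 ≤ Δ)
    (τ : ℝ) (h1 : 0 ≤ σ) (h2 : σ ≤ 4) (hK : ∀ s : ℂ, s.re = σ → ‖f s‖ ≤ K) :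
    lineMean (fun s => wE p τ Δ s * f s) p σ ≤ Real.exp 1 * (√Real.pi * Δ) * K ^ p := by
  have hΔ0 : 0 < Δ := by linarith
  rw [lineMean_wE_eq f hp, mul_assoc]
  have hi : ∫ t, gw τ Δ t * ‖f (σ + t * Complex.I)‖ ^ p ≤ √Real.pi * Δ * K ^ p := by
    rw [← integral_gw τ hΔ0, ← integral_mul_const]
    refine integral_mono_of_nonneg (Filter.Eventually.of_forall fun t => ?_)
      ((integrable_gw τ hΔ0).mul_const _) (Filter.Eventually.of_forall fun t => ?_)
    · exact mul_nonneg (gw_pos _ _ _).le (by positivity)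
    · refine mul_le_mul_of_nonneg_left ?_ (gw_pos _ _ _).le
      exact Real.rpow_le_rpow (norm_nonneg _) (hK _ (by simp)) hp.le
  have h0 : 0 ≤ ∫ t, gw τ Δ t * ‖f (σ + t * Complex.I)‖ ^ p :=
    integral_nonneg fun t => mul_nonneg (gw_pos _ _ _).le (by positivity)
  exact mul_le_mul (exp_sq_div_sq_le h1 h2 hΔ) hi h0 (Real.exp_pos _).le

/-! ### The two functions compared -/

/-- `κ ζ' X^v X₁`, continued across `s = 1`. -/
noncomputable def mollF (v : ℕ) (x x₁ : AF) (s : ℂ) : ℂ :=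
  ((s + 1) ^ 2)⁻¹ * zetaD s * (ev (cchar s) x ^ v * ev (cchar s) x₁)

/-- `κ X^(v-1) Y`. -/
noncomputable def mollS (v : ℕ) (x y : AF) (s : ℂ) : ℂ :=
  kap s * (ev (cchar s) x ^ (v - 1) * ev (cchar s) y)

theorem mollF_eq (v : ℕ) (x x₁ : AF) {s : ℂ} (hs : s ≠ 1) : mollF v x x₁ s =
    kap s * deriv riemannZeta s * (ev (cchar s) x ^ v * ev (cchar s) x₁) := by
  rw [mollF, kap_mul_deriv_zeta hs]

theorem norm_le_four_add {s : ℂ} (h1 : 1 / 2 ≤ s.re) (h2 : s.re ≤ 4) : ‖s‖ ≤ 4 + |s.im| := by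
  refine (Complex.norm_le_abs_re_add_abs_im s).trans ?_
  rw [abs_of_nonneg (by linarith : 0 ≤ s.re)]
  linarith

theorem reg_mollF (v : ℕ) {x x₁ : AF} {N : ℝ} (hx : LogLen x N) (hx₁ : LogLen x₁ N) :
    Reg (mollF v x x₁) := by
  refine ⟨?_, ?_⟩
  · exact (differentiableOn_inv_sq.mul differentiable_zetaD.differentiableOn).mul
      (((differentiable_ev_cchar hx).pow v).mul (differentiable_ev_cchar hx₁)).differentiableOn
  · obtain ⟨C, hC, h⟩ := exists_norm_zetaD_le
    obtain ⟨C₁, hC₁, hb⟩ := exists_norm_ev_cchar_le hx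
    obtain ⟨C₂, hC₂, hb'⟩ := exists_norm_ev_cchar_le hx₁
    refine ⟨C * 5 ^ 3 * (C₁ ^ v * C₂), fun s h1 h2 => ?_⟩
    have hs : 0 < s.re := by linarith
    unfold mollF
    rw [norm_mul, norm_mul, norm_mul, norm_pow]
    have e1 := norm_inv_sq_le_one hs
    have e2 : ‖zetaD s‖ ≤ C * (5 * (1 + |s.im|)) ^ 3 := by
      refine (h s h1).trans ?_
      have := norm_le_four_add h1 h2
      have h0 := abs_nonneg s.im
      have : 1 + ‖s‖ ≤ 5 * (1 + |s.im|) := by linarith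
      gcongr
    calc _ ≤ 1 * (C * (5 * (1 + |s.im|)) ^ 3) * (C₁ ^ v * C₂) := by
          have := hb s hs.le
          have := hb' s hs.le
          gcongr
      _ = _ := by rw [mul_pow]; ring

theorem reg_mollS (v : ℕ) {x y : AF} {N : ℝ} (hx : LogLen x N) (hy : LogLen y N) :
    Reg (mollS v x y) := by
  refine ⟨?_, ?_⟩
  · exact differentiableOn_kap.mul
      (((differentiable_ev_cchar hx).pow (v - 1)).mul (differentiable_ev_cchar hy)).differentiableOn
  · obtain ⟨C₁, hC₁, hb⟩ := exists_norm_ev_cchar_le hx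
    obtain ⟨C₂, hC₂, hb'⟩ := exists_norm_ev_cchar_le hy
    refine ⟨C₁ ^ (v - 1) * C₂, fun s h1 h2 => ?_⟩
    have hs : 0 < s.re := by linarith
    unfold mollS
    rw [norm_mul, norm_mul, norm_pow]
    have e1 := norm_kap_le_one hs
    have e2 : (1 : ℝ) ≤ (1 + |s.im|) ^ 3 := one_le_pow₀ (by linarith [abs_nonneg s.im])
    calc _ ≤ 1 * (C₁ ^ (v - 1) * C₂) := by
          have := hb s hs.le
          have := hb' s hs.le
          gcongr
      _ ≤ _ := by
          rw [one_mul]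
          exact le_mul_of_one_le_right (by positivity) e2

/-! ### Zeta on the critical line -/

/-- `|ζ'(1/2 + it)|`. -/
noncomputable def zl (t : ℝ) : ℝ := ‖deriv riemannZeta (1 / 2 + (t : ℂ) * Complex.I)‖

theorem half_add_ne_one (t : ℝ) : (1 / 2 + (t : ℂ) * Complex.I) ≠ 1 := by
  intro h
  have := congrArg Complex.re h
  norm_num at this

theorem zl_nonneg (t : ℝ) : 0 ≤ zl t := norm_nonneg _

theorem continuous_zl : Continuous zl := by
  unfold zl
  refine Continuous.norm (continuous_iff_continuousAt.2 fun t => ?_)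
  have h1 : ContinuousAt (deriv riemannZeta) (1 / 2 + (t : ℂ) * Complex.I) := by
    have : DifferentiableOn ℂ riemannZeta {1}ᶜ := fun s hs =>
      (differentiableAt_riemannZeta hs).differentiableWithinAt
    exact ((this.deriv isOpen_compl_singleton).differentiableAt
      (isOpen_compl_singleton.mem_nhds (half_add_ne_one t))).continuousAt
  exact ContinuousAt.comp (f := fun t : ℝ => 1 / 2 + (t : ℂ) * Complex.I) h1 (by fun_prop)

theorem exists_zl_le : ∃ C : ℝ, 0 < C ∧ ∀ t : ℝ, zl t ≤ C * (1 + |t|) ^ 3 := by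
  obtain ⟨C, hC, h⟩ := exists_norm_zetaD_le
  refine ⟨4 * C * 5 ^ 3, by positivity, fun t => ?_⟩
  have h1 := h (1 / 2 + (t : ℂ) * Complex.I) (by norm_num)
  have h2 := norm_le_four_add (s := 1 / 2 + (t : ℂ) * Complex.I) (by norm_num) (by norm_num)
  have him : (1 / 2 + (t : ℂ) * Complex.I).im = t := by simp
  rw [him] at h2
  rw [zetaD_eq (half_add_ne_one t), norm_mul, norm_pow] at h1
  have h3 : 1 / 2 ≤ ‖(1 / 2 + (t : ℂ) * Complex.I) - 1‖ := by
    refine le_trans ?_ (Complex.abs_re_le_norm _)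
    norm_num [abs_le]
  have h4 : (1 / 2) ^ 2 * zl t ≤ ‖(1 / 2 + (t : ℂ) * Complex.I) - 1‖ ^ 2 * zl t := by
    have := zl_nonneg t
    gcongr
  have h5 : C * (1 + ‖(1 / 2 + (t : ℂ) * Complex.I)‖) ^ 3 ≤ C * (5 * (1 + |t|)) ^ 3 := by
    have h0 := abs_nonneg t
    have : 1 + ‖(1 / 2 + (t : ℂ) * Complex.I)‖ ≤ 5 * (1 + |t|) := by linarith
    gcongr
  rw [mul_pow] at h5
  unfold zl at h4 ⊢
  linarith

theorem exists_zl_rpow_le {r : ℝ} (hr : 0 ≤ r) : ∃ (C : ℝ) (n : ℕ), 0 < C ∧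
    ∀ t : ℝ, zl t ^ r ≤ C * (1 + |t|) ^ n := by
  obtain ⟨C, hC, h⟩ := exists_zl_le
  obtain ⟨n, hn⟩ := exists_nat_ge (3 * r)
  refine ⟨C ^ r, n, by positivity, fun t => ?_⟩
  have h0 : 0 ≤ 1 + |t| := by positivity
  calc zl t ^ r ≤ (C * (1 + |t|) ^ 3) ^ r := Real.rpow_le_rpow (zl_nonneg t) (h t) hr
    _ = C ^ r * (1 + |t|) ^ (3 * r) := by
        rw [Real.mul_rpow hC.le (by positivity), ← Real.rpow_natCast, ← Real.rpow_mul h0]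
        norm_num
    _ ≤ C ^ r * (1 + |t|) ^ n := by
        rw [← Real.rpow_natCast]
        have : 1 ≤ 1 + |t| := by linarith [abs_nonneg t]
        gcongr

theorem integrable_gw_mul_zl_rpow {r : ℝ} (hr : 0 ≤ r) (τ : ℝ) {Δ : ℝ} (hΔ : 0 < Δ) :
    Integrable fun t => gw τ Δ t * zl t ^ r := by
  obtain ⟨C, n, hC, h⟩ := exists_zl_rpow_le hr
  refine integrable_gw_mul_of_le τ hΔ (continuous_zl.rpow_const fun _ => Or.inr hr) (K := C) (n := n)
    fun t => ?_
  rw [abs_of_nonneg (Real.rpow_nonneg (zl_nonneg t) r)]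
  exact h t

/-! ### Hölder estimates on the lines -/

/-- The modulus of a Dirichlet polynomial on the line `Re s = σ`. -/
noncomputable def nl (x : AF) (σ t : ℝ) : ℝ := ‖ev (cchar (σ + t * Complex.I)) x‖

theorem nl_nonneg (x : AF) (σ t : ℝ) : 0 ≤ nl x σ t := norm_nonneg _

theorem continuous_nl {x : AF} {N : ℝ} (hx : LogLen x N) (σ : ℝ) : Continuous (nl x σ) :=
  ((continuous_ev_cchar hx).comp
    (by fun_prop : Continuous fun t : ℝ => (σ : ℂ) + t * Complex.I)).norm

theorem integrable_gw_mul_nl {x y : AF} {N : ℝ} (hx : LogLen x N) (hy : LogLen y N) {a b : ℝ}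
    (ha : 0 ≤ a) (hb : 0 ≤ b) {σ : ℝ} (hσ : 0 ≤ σ) (τ : ℝ) {Δ : ℝ} (hΔ : 0 < Δ) :
    Integrable fun t => gw τ Δ t * (nl x σ t ^ a * nl y σ t ^ b) := by
  obtain ⟨C₁, hC₁, h1⟩ := exists_norm_ev_cchar_le hx
  obtain ⟨C₂, hC₂, h2⟩ := exists_norm_ev_cchar_le hy
  refine integrable_gw_mul_of_le τ hΔ (((continuous_nl hx σ).rpow_const fun _ => Or.inr ha).mul
    ((continuous_nl hy σ).rpow_const fun _ => Or.inr hb)) (K := C₁ ^ a * C₂ ^ b) (n := 0) fun t => ?_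
  rw [pow_zero, mul_one, abs_of_nonneg (mul_nonneg (Real.rpow_nonneg (nl_nonneg _ _ _) _)
    (Real.rpow_nonneg (nl_nonneg _ _ _) _))]
  have e1 : nl x σ t ≤ C₁ := h1 _ (by simpa using hσ)
  have e2 : nl y σ t ≤ C₂ := h2 _ (by simpa using hσ)
  have := nl_nonneg x σ t
  have := nl_nonneg y σ t
  gcongr

theorem integrable_gw_mul_nl_sq {x : AF} {N : ℝ} (hx : LogLen x N) {σ : ℝ} (hσ : 0 ≤ σ) (τ : ℝ)
    {Δ : ℝ} (hΔ : 0 < Δ) : Integrable fun t => gw τ Δ t * nl x σ t ^ 2 := by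
  have := integrable_gw_mul_nl hx hx (a := 2) (b := 0) (by norm_num) le_rfl hσ τ hΔ
  refine this.congr (Filter.Eventually.of_forall fun t => ?_)
  simp

/-- Hölder with exponent vk on the factor ζ'. The exponent q of the polynomial factor is forced by
q(1 - 1/(vk)) = 2/v. -/
theorem lineMean_mollF_half_le {v : ℕ} (hv : 3 ≤ v) {Δ : ℝ} (hΔ : 4 ≤ Δ) (τ : ℝ) {x x₁ : AF}
    {N k M₁ M₂ : ℝ} (hk : 0 < k) (hvk : 1 < v * k) (hx : LogLen x N)
    (hx₁ : LogLen x₁ N) (hM₁ : 0 < M₁) (hM₂ : 0 < M₂)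
    (h1 : ∫ t, gw τ Δ t * zl t ^ (2 * k) ≤ M₁)
    (h2 : ∫ t, gw τ Δ t * (nl x (1 / 2) t ^ (v * (2 * k / (v * k - 1))) *
      nl x₁ (1 / 2) t ^ (2 * k / (v * k - 1))) ≤ M₂) :
    lineMean (fun s => wE (2 / v) τ Δ s * mollF v x x₁ s) (2 / v) (1 / 2) ≤
      Real.exp 1 * (M₁ ^ (1 / (v * k)) * M₂ ^ (1 - 1 / (v * k))) := by
  have hΔ0 : 0 < Δ := by linarith
  have hv0 : (0 : ℝ) < v := by positivity
  have hvk1 : 0 < v * k - 1 := by linarith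
  set q := 2 * k / (v * k - 1) with hq
  have hq0 : 0 < q := by positivity
  have hp : (0 : ℝ) < 2 / v := by positivity
  rw [lineMean_wE_eq _ hp]
  have ha : 0 < 1 / (v * k) := by positivity
  have ha1 : 1 / (v * k) < 1 := by rw [div_lt_one (by positivity)]; exact hvk
  have hqa : q * (1 - 1 / (v * k)) = 2 / v := by
    have h3 := hvk1.ne'
    rw [hq, one_sub_div (by positivity), div_mul_div_comm, div_eq_div_iff (by positivity) hv0.ne']
    ring
  have hi := integral_mul_le_of_le_rpow
    (h := fun t => ‖mollF v x x₁ ((1 / 2 : ℝ) + t * Complex.I)‖ ^ (2 / v : ℝ)) ha ha1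
    (fun t => (gw_pos τ Δ t).le) (fun t => Real.rpow_nonneg (zl_nonneg t) (2 * k))
    (fun t => mul_nonneg (Real.rpow_nonneg (nl_nonneg x (1 / 2) t) (v * q))
      (Real.rpow_nonneg (nl_nonneg x₁ (1 / 2) t) q)) (fun t => by positivity) (fun t => ?_)
    (integrable_gw_mul_zl_rpow (by positivity) τ hΔ0)
    (integrable_gw_mul_nl hx hx₁ (by positivity) hq0.le (by norm_num) τ hΔ0) hM₁ hM₂ h1 h2
  · refine mul_le_mul (exp_sq_div_sq_le (by norm_num) (by norm_num) hΔ) hi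
      (integral_nonneg fun t => mul_nonneg (gw_pos _ _ _).le (by positivity)) (Real.exp_pos _).le
  · have e0 : (((1 / 2 : ℝ) : ℂ) + t * Complex.I) = 1 / 2 + (t : ℂ) * Complex.I := by push_cast; rfl
    have e1 : ‖mollF v x x₁ ((1 / 2 : ℝ) + t * Complex.I)‖ ≤
        zl t * (nl x (1 / 2) t ^ v * nl x₁ (1 / 2) t) := by
      rw [mollF_eq v x x₁ (by rw [e0]; exact half_add_ne_one t), norm_mul, norm_mul, norm_mul,
        norm_pow, zl, ← e0, nl, nl]
      refine mul_le_mul_of_nonneg_right ?_ (by positivity)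
      exact mul_le_of_le_one_left (norm_nonneg _) (norm_kap_le_one (by simp))
    have n0 := nl_nonneg x (1 / 2) t
    have n1 := nl_nonneg x₁ (1 / 2) t
    have z0 := zl_nonneg t
    refine (Real.rpow_le_rpow (norm_nonneg _) e1 hp.le).trans (le_of_eq ?_)
    rw [Real.mul_rpow z0 (by positivity), Real.mul_rpow (by positivity) n1, ← Real.rpow_natCast,
      ← Real.rpow_mul n0, Real.mul_rpow (by positivity) (by positivity), ← Real.rpow_mul z0,
      ← Real.rpow_mul n0, ← Real.rpow_mul n1, mul_assoc (v : ℝ) q, hqa]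
    congr 2
    field_simp

/-- Hölder for |X^(v-1) Y|^(2/v) = (|X|²)^(1-1/v) (|Y|²)^(1/v). -/
theorem lineMean_mollS_half_le {v : ℕ} (hv : 3 ≤ v) {Δ : ℝ} (hΔ : 4 ≤ Δ) (τ : ℝ) {x y : AF}
    {N M₁ M₂ : ℝ} (hx : LogLen x N) (hy : LogLen y N) (hM₁ : 0 < M₁)
    (hM₂ : 0 < M₂) (h1 : ∫ t, gw τ Δ t * nl x (1 / 2) t ^ 2 ≤ M₁)
    (h2 : ∫ t, gw τ Δ t * nl y (1 / 2) t ^ 2 ≤ M₂) :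
    lineMean (fun s => wE (2 / v) τ Δ s * mollS v x y s) (2 / v) (1 / 2) ≤
      Real.exp 1 * (M₁ ^ (1 - 1 / v : ℝ) * M₂ ^ (1 / v : ℝ)) := by
  have hΔ0 : 0 < Δ := by linarith
  have hv0 : (0 : ℝ) < v := by positivity
  have hv3 : (3 : ℝ) ≤ v := by exact_mod_cast hv
  have hp : (0 : ℝ) < 2 / v := by positivity
  rw [lineMean_wE_eq _ hp]
  have ha : 0 < 1 - 1 / (v : ℝ) := by
    rw [sub_pos, div_lt_one hv0]; linarith
  have ha1 : 1 - 1 / (v : ℝ) < 1 := by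
    have : 0 < 1 / (v : ℝ) := by positivity
    linarith
  have hi := integral_mul_le_of_le_rpow
    (h := fun t => ‖mollS v x y ((1 / 2 : ℝ) + t * Complex.I)‖ ^ (2 / v : ℝ)) ha ha1
    (fun t => (gw_pos τ Δ t).le) (fun t => sq_nonneg (nl x (1 / 2) t))
    (fun t => sq_nonneg (nl y (1 / 2) t)) (fun t => by positivity) (fun t => ?_)
    (integrable_gw_mul_nl_sq hx (by norm_num) τ hΔ0)
    (integrable_gw_mul_nl_sq hy (by norm_num) τ hΔ0) hM₁ hM₂ h1 h2
  · rw [sub_sub_cancel] at hi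
    refine mul_le_mul (exp_sq_div_sq_le (by norm_num) (by norm_num) hΔ) hi
      (integral_nonneg fun t => mul_nonneg (gw_pos _ _ _).le (by positivity)) (Real.exp_pos _).le
  · have e1 : ‖mollS v x y ((1 / 2 : ℝ) + t * Complex.I)‖ ≤
        nl x (1 / 2) t ^ (v - 1) * nl y (1 / 2) t := by
      rw [mollS, norm_mul, norm_mul, norm_pow, nl, nl]
      exact mul_le_of_le_one_left (by positivity) (norm_kap_le_one (by simp))
    have n0 := nl_nonneg x (1 / 2) t
    have n1 := nl_nonneg y (1 / 2) t
    refine (Real.rpow_le_rpow (norm_nonneg _) e1 hp.le).trans (le_of_eq ?_)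
    rw [Real.mul_rpow (by positivity) n1, ← Real.rpow_natCast, ← Real.rpow_natCast,
      ← Real.rpow_natCast, ← Real.rpow_mul n0, ← Real.rpow_mul n0, ← Real.rpow_mul n1,
      Nat.cast_sub (by omega : 1 ≤ v)]
    push_cast
    congr 2 <;> field_simp
    ring

/-- Hölder in the opposite direction: |XY| is written as (|X|^(2-2/v)|Y|^(2/v))^a (|Y|²)^(1-a) with
a = v/(2v-2), so that a lower bound for the mean of |XY| yields one for S. The constant 49 undoes
the weight κ, which needs σ ≤ 3/4. -/
theorem integral_gw_mul_nl_mul_nl_le {v : ℕ} (hv : 3 ≤ v) {Δ : ℝ} (hΔ : 4 ≤ Δ) (τ : ℝ) {x y : AF}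
    {N M₀ M₂ σ : ℝ} (hx : LogLen x N) (hy : LogLen y N)
    (hσ : 1 / 2 ≤ σ) (hσ' : σ ≤ 3 / 4) (hM₀ : 0 < M₀) (hM₂ : 0 < M₂)
    (h1 : lineMean (fun s => wE (2 / v) τ Δ s * mollS v x y s) (2 / v) σ ≤ M₀)
    (h2 : ∫ t, gw τ Δ t * nl y σ t ^ 2 ≤ M₂) :
    ∫ t, gw τ Δ t * (nl x σ t * nl y σ t) ≤
      (49 * M₀) ^ (v / (2 * v - 2) : ℝ) * M₂ ^ (1 - v / (2 * v - 2) : ℝ) := by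
  have hΔ0 : 0 < Δ := by linarith
  have hv0 : (0 : ℝ) < v := by positivity
  have hv3 : (3 : ℝ) ≤ v := by exact_mod_cast hv
  have hp : (0 : ℝ) < 2 / v := by positivity
  have hp1 : (2 / v : ℝ) ≤ 1 := by rw [div_le_one hv0]; linarith
  have hv2 : (0 : ℝ) < 2 * v - 2 := by linarith
  have hσ0 : 0 ≤ σ := by linarith
  have hp2 : (0 : ℝ) ≤ 2 - 2 / v := by linarith
  have hM1 : ∫ t, gw τ Δ t * (nl x σ t ^ (2 - 2 / v : ℝ) * nl y σ t ^ (2 / v : ℝ)) ≤ 49 * M₀ := by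
    refine le_trans ?_ (mul_le_mul_of_nonneg_left h1 (by norm_num))
    unfold lineMean
    rw [← integral_const_mul]
    refine integral_mono_of_nonneg (Filter.Eventually.of_forall fun t => ?_)
      (((reg_mollS v hx hy).integrable hp hp1 hΔ τ hσ (by linarith)).const_mul 49)
      (Filter.Eventually.of_forall fun t => ?_)
    · exact mul_nonneg (gw_pos _ _ _).le (mul_nonneg (Real.rpow_nonneg (nl_nonneg _ _ _) _)
        (Real.rpow_nonneg (nl_nonneg _ _ _) _))
    · have n0 := nl_nonneg x σ t
      have n1 := nl_nonneg y σ t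
      have hre : ((σ : ℂ) + t * Complex.I).re = σ := re_add_mul_I σ t
      have e1 : ‖mollS v x y (σ + t * Complex.I)‖ ^ (2 / v : ℝ) =
          ‖kap (σ + t * Complex.I)‖ ^ (2 / v : ℝ) *
            (nl x σ t ^ (2 - 2 / v : ℝ) * nl y σ t ^ (2 / v : ℝ)) := by
        rw [mollS, norm_mul, norm_mul, norm_pow]
        change (_ * (nl x σ t ^ (v - 1) * nl y σ t)) ^ (2 / v : ℝ) = _
        rw [Real.mul_rpow (norm_nonneg _) (by positivity), Real.mul_rpow (by positivity) n1,
          ← Real.rpow_natCast, ← Real.rpow_mul n0, Nat.cast_sub (by omega : 1 ≤ v)]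
        push_cast
        congr 3
        field_simp
      have e2 : 1 / 49 ≤ ‖kap (σ + t * Complex.I)‖ ^ (2 / v : ℝ) := by
        have h3 := le_norm_kap (s := σ + t * Complex.I) (by rw [hre]; linarith) (by rw [hre]; exact hσ')
        have h4 := norm_kap_le_one (s := σ + t * Complex.I) (by rw [hre]; linarith)
        refine h3.trans ?_
        have := Real.rpow_le_rpow_of_exponent_ge (by linarith) h4 hp1
        rwa [Real.rpow_one] at this
      have e3 : 1 ≤ Real.exp (σ ^ 2 / Δ ^ 2) := Real.one_le_exp (by positivity)
      simp only
      rw [norm_mul, Real.mul_rpow (norm_nonneg _) (norm_nonneg _), norm_wE_rpow hp, e1]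
      have hg := (gw_pos τ Δ t).le
      have hr : 0 ≤ nl x σ t ^ (2 - 2 / v : ℝ) * nl y σ t ^ (2 / v : ℝ) := by positivity
      calc gw τ Δ t * (nl x σ t ^ (2 - 2 / v : ℝ) * nl y σ t ^ (2 / v : ℝ))
          = 49 * (1 * gw τ Δ t * (1 / 49 * (nl x σ t ^ (2 - 2 / v : ℝ) * nl y σ t ^ (2 / v : ℝ)))) := by
            ring
        _ ≤ _ := by gcongr
  refine integral_mul_le_of_le_rpow (f := fun t => nl x σ t ^ (2 - 2 / v : ℝ) * nl y σ t ^ (2 / v : ℝ))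
    (by positivity) ?_
    (fun t => (gw_pos τ Δ t).le) (fun t => mul_nonneg (Real.rpow_nonneg (nl_nonneg _ _ _) _)
        (Real.rpow_nonneg (nl_nonneg _ _ _) _))
    (fun t => sq_nonneg (nl y σ t)) (fun t => mul_nonneg (nl_nonneg _ _ _) (nl_nonneg _ _ _))
    (fun t => le_of_eq ?_) (integrable_gw_mul_nl hx hy hp2 hp.le hσ0 τ hΔ0)
    (integrable_gw_mul_nl_sq hy hσ0 τ hΔ0) (by positivity) hM₂ hM1 h2
  · rw [div_lt_one hv2]; linarith
  · have n0 := nl_nonneg x σ t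
    have n1 := nl_nonneg y σ t
    rcases n1.eq_or_lt with h0 | h0
    · rw [← h0, Real.zero_rpow hp.ne']
      have : (v / (2 * v - 2) : ℝ) ≠ 0 := by positivity
      simp [Real.zero_rpow this]
    · rw [Real.mul_rpow (by positivity) (by positivity), ← Real.rpow_natCast, ← Real.rpow_mul n0,
        ← Real.rpow_mul n1, ← Real.rpow_mul n1, mul_assoc, ← Real.rpow_add h0]
      have e1 : (2 - 2 / v : ℝ) * (v / (2 * v - 2)) = 1 := by
        rw [sub_div' hv0.ne', div_mul_div_comm, div_eq_one_iff_eq (by positivity)]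
        ring
      have e2 : (2 / v : ℝ) * (v / (2 * v - 2)) + ((2 : ℕ) : ℝ) * (1 - v / (2 * v - 2)) = 1 := by
        have h3 := hv2.ne'
        push_cast
        rw [one_sub_div h3, div_mul_div_comm, mul_div_assoc', div_add_div _ _ (by positivity) h3,
          div_eq_one_iff_eq (by positivity)]
        ring
      rw [e1, e2, Real.rpow_one, Real.rpow_one]

/-! ### Moment estimates for the Dirichlet polynomials -/

/-- For length e^N = √Δ the off-diagonal error is √Δ exp(-Δ/4), which tends to 0. -/
theorem exists_error_le {ε : ℝ} (hε : 0 < ε) : ∃ Δ₀ : ℝ, ∀ Δ : ℝ, Δ₀ ≤ Δ →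
    Real.exp (-(Δ * Real.exp (-(Real.log Δ / 2))) ^ 2 / 4) * Real.exp (Real.log Δ / 2) ≤ ε := by
  have h1 : Filter.Tendsto (fun x : ℝ => (x / 4) ^ 1 * Real.exp (-(x / 4))) Filter.atTop (nhds 0) :=
    (Real.tendsto_pow_mul_exp_neg_atTop_nhds_zero 1).comp
      (Filter.tendsto_id.atTop_div_const (by norm_num))
  obtain ⟨Δ₀, h⟩ := Filter.eventually_atTop.1 (h1.eventually (Iio_mem_nhds (by positivity : 0 < ε / 4)))
  refine ⟨max Δ₀ 1, fun Δ hΔ => ?_⟩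
  have h2 := h Δ ((le_max_left _ _).trans hΔ)
  have hΔ1 : 1 ≤ Δ := (le_max_right _ _).trans hΔ
  have hΔ0 : 0 < Δ := by linarith
  have e1 : (Δ * Real.exp (-(Real.log Δ / 2))) ^ 2 = Δ := by
    rw [mul_pow, ← Real.exp_nat_mul]
    push_cast
    rw [show 2 * -(Real.log Δ / 2) = -Real.log Δ by ring, Real.exp_neg, Real.exp_log hΔ0]
    field_simp
  have e2 : Real.exp (Real.log Δ / 2) ≤ Δ := by
    calc Real.exp (Real.log Δ / 2) ≤ Real.exp (Real.log Δ) :=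
          Real.exp_le_exp.2 (by linarith [Real.log_nonneg hΔ1])
      _ = Δ := Real.exp_log hΔ0
  rw [e1, neg_div]
  rw [pow_one] at h2
  have := mul_le_mul_of_nonneg_left e2 (Real.exp_pos (-(Δ / 4))).le
  linarith

theorem exists_cut_lt (L : ℝ) : ∃ J : ℕ, cut L J < Real.log 2 := by
  have h2 : 0 < Real.log 2 := Real.log_pos one_lt_two
  obtain ⟨J, hJ⟩ := pow_unbounded_of_one_lt (L / Real.log 2) (by norm_num : (1 : ℝ) < 4)
  refine ⟨J, ?_⟩
  rw [div_lt_iff₀ h2] at hJ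
  rw [cut, div_lt_iff₀ (by positivity)]
  linarith

theorem integral_gw_mul_majorant_le {ι : Type*} (S : Finset ι) {f : ι → AF} {x x₁ : AF}
    {a b N Δ K : ℝ} (hΔ : 0 < Δ) (τ : ℝ)
    (hf : ∀ U ∈ S, LogLen (f U) N)
    (h : ∀ s : ℂ, ‖ev (cchar s) x‖ ^ a * ‖ev (cchar s) x₁‖ ^ b ≤ ∑ U ∈ S, ‖ev (cchar s) (f U)‖ ^ 2)
    (hN : Real.exp (-(Δ * Real.exp (-N)) ^ 2 / 4) * Real.exp N ≤ 1)
    (hK : ∑ U ∈ S, nrm (f U) ≤ K) :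
    ∫ t, gw τ Δ t * (nl x (1 / 2) t ^ a * nl x₁ (1 / 2) t ^ b) ≤ 2 * (√Real.pi * Δ) * K := by
  have hi : ∀ U ∈ S, Integrable fun t => gw τ Δ t * nl (f U) (1 / 2) t ^ 2 := fun U hU =>
    integrable_gw_mul_nl_sq (hf U hU) (by norm_num) τ hΔ
  calc _ ≤ ∫ t, ∑ U ∈ S, gw τ Δ t * nl (f U) (1 / 2) t ^ 2 := by
        refine integral_mono_of_nonneg (Filter.Eventually.of_forall fun t => ?_)
          (integrable_finsetSum _ hi) (Filter.Eventually.of_forall fun t => ?_)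
        · exact mul_nonneg (gw_pos _ _ _).le (mul_nonneg (Real.rpow_nonneg (nl_nonneg _ _ _) _)
            (Real.rpow_nonneg (nl_nonneg _ _ _) _))
        · simp only
          rw [← mul_sum]
          exact mul_le_mul_of_nonneg_left (h _) (gw_pos _ _ _).le
    _ = ∑ U ∈ S, ∫ t, gw τ Δ t * nl (f U) (1 / 2) t ^ 2 := integral_finsetSum _ hi
    _ ≤ ∑ U ∈ S, 2 * (√Real.pi * Δ) * nrm (f U) := by
        refine sum_le_sum fun U hU => ?_
        exact integral_gw_mul_norm_sq_le (hf U hU) (by norm_num) hΔ hN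
    _ ≤ _ := by
        rw [← mul_sum]
        gcongr

theorem le_integral_gw_mul_nl_mul_nl {x y : AF} {N σ Δ S ε : ℝ} (hx : LogLen x N) (hy : LogLen y N)
    (hσ : 1 / 2 ≤ σ) (hΔ : 0 < Δ) (τ : ℝ)
    (hS : S ≤ ∑ n ∈ upTo N, x n * y n * rchar (2 * σ) n)
    (hε : Real.exp (-(Δ * Real.exp (-N)) ^ 2 / 4) * Real.exp N * √(nrm x * nrm y) ≤ ε) :
    √Real.pi * Δ * (S - ε) ≤ ∫ t, gw τ Δ t * (nl x σ t * nl y σ t) := by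
  have h1 := norm_integral_gw_mul_sub_le (τ := τ) hx hy hσ hΔ
  set I := ∫ t : ℝ, (gw τ Δ t : ℂ) * (ev (cchar (σ + t * Complex.I)) x *
        (starRingEnd ℂ) (ev (cchar (σ + t * Complex.I)) y)) with hI
  have h2 : ‖I‖ ≤ ∫ t, gw τ Δ t * (nl x σ t * nl y σ t) := by
    refine (norm_integral_le_integral_norm _).trans (le_of_eq ?_)
    refine integral_congr_ae (Filter.Eventually.of_forall fun t => ?_)
    simp only
    rw [norm_mul, norm_mul, RCLike.norm_conj, Complex.norm_real, Real.norm_eq_abs,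
      abs_of_pos (gw_pos _ _ _)]
    rfl
  have h3 := norm_sub_norm_le
    ((√Real.pi * Δ * ∑ n ∈ upTo N, x n * y n * rchar (2 * σ) n : ℝ) : ℂ) I
  rw [norm_sub_rev] at h3
  rw [Complex.norm_real] at h3
  have h4 := Real.le_norm_self (√Real.pi * Δ * ∑ n ∈ upTo N, x n * y n * rchar (2 * σ) n)
  have hp : 0 < √Real.pi * Δ := by have := Real.pi_pos; positivity
  have h5 := mul_le_mul_of_nonneg_left hS hp.le
  have h6 := mul_le_mul_of_nonneg_left hε hp.le
  rw [mul_sub]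
  linarith

theorem rho_nonneg {L : ℝ} (hL : 0 ≤ L) {J B : ℕ} (hB : Even B) {k : ℝ} (hk : 0 ≤ k)
    (hJ : cut L J < Real.log 2) (n : ℕ) : 0 ≤ rho L J B k n := by
  rcases Nat.eq_zero_or_pos n with rfl | hn
  · simp
  by_cases h : Real.log n ≤ L
  · exact (mul_nonneg' (LamL_nonneg L) (NK_nonneg L J B hk) n).trans
      (le_rho hL hB hk hJ (mem_upTo.2 ⟨hn.ne', h⟩))
  · rw [rho_apply, if_neg h]

/-- For log n ≤ L/A the shift to σ = 1/2 + A/L costs only n^(-2A/L) ≥ e^(-2). The remaining terms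
are nonnegative and are dropped. -/
theorem le_sum_NK_mul_rho {L A c k N : ℝ} {J B : ℕ} (hA : 1 ≤ A) (hL : 0 < L)
    (hB : Even B) (hk : 0 ≤ k) (hJ : cut L J < Real.log 2) (hLN : L ≤ N)
    (h : c ≤ ∑ n ∈ upTo (L / A), NK L J B k n * (LamL L * NK L J B k) n * (n : ℝ)⁻¹) :
    Real.exp (-2) * c ≤ ∑ n ∈ upTo N, NK L J B k n * rho L J B k n *
      rchar (2 * (1 / 2 + A / L)) n := by
  have hA0 : 0 < A := by linarith
  have hsub : L / A ≤ L := div_le_self hL.le hA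
  calc Real.exp (-2) * c
      ≤ ∑ n ∈ upTo (L / A), Real.exp (-2) * (NK L J B k n * (LamL L * NK L J B k) n * (n : ℝ)⁻¹) := by
        rw [← mul_sum]
        gcongr
    _ ≤ ∑ n ∈ upTo (L / A), NK L J B k n * rho L J B k n * rchar (2 * (1 / 2 + A / L)) n := by
        refine sum_le_sum fun n hn => ?_
        obtain ⟨hn0, hn1⟩ := mem_upTo.1 hn
        have hnpos : (0 : ℝ) < n := by positivity
        have e1 : Real.exp (-2) * (n : ℝ)⁻¹ ≤ rchar (2 * (1 / 2 + A / L)) n := by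
          rw [rchar_apply, Real.rpow_def_of_pos hnpos]
          conv_lhs => rw [← Real.exp_log hnpos, ← Real.exp_neg, ← Real.exp_add]
          refine Real.exp_le_exp.2 ?_
          have : Real.log n * (A / L) ≤ 1 := by
            calc Real.log n * (A / L) ≤ L / A * (A / L) := by gcongr
              _ = 1 := by field_simp
          linarith
        have e2 := le_rho hL.le hB hk hJ (mem_upTo.2 ⟨hn0, hn1.trans hsub⟩)
        have e3 := NK_nonneg L J B hk n
        have e4 := mul_nonneg' (LamL_nonneg L) (NK_nonneg L J B hk) n
        have e5 := rho_nonneg hL.le hB hk hJ n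
        calc _ = NK L J B k n * (LamL L * NK L J B k) n * (Real.exp (-2) * (n : ℝ)⁻¹) := by ring
          _ ≤ _ := by gcongr
    _ ≤ _ := by
        refine sum_le_sum_of_subset_of_nonneg (fun n hn => ?_) fun n _ _ => ?_
        · obtain ⟨hn0, hn1⟩ := mem_upTo.1 hn
          exact mem_upTo.2 ⟨hn0, hn1.trans (hsub.trans hLN)⟩
        · exact mul_nonneg (mul_nonneg (NK_nonneg L J B hk n) (rho_nonneg hL.le hB hk hJ n))
            (rchar_nonneg _ _)

theorem norm_mollF_four_le {C L k : ℝ} {J B v : ℕ} (hL : 0 ≤ L) (hk : 0 ≤ k) {s : ℂ} (hs : s.re = 4)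
    (hC : ‖deriv riemannZeta s‖ ≤ C) :
    ‖mollF v (NK L J B k) (NK L J B (-1)) s‖ ≤ C * (Real.exp (2 * k) ^ v * Real.exp 2) := by
  have h1 := norm_ev_NK_le hL J B (-1) (s := s) (by rw [hs]; norm_num)
  have h2 := norm_ev_NK_le hL J B k (s := s) (by rw [hs]; norm_num)
  rw [abs_neg, abs_one, mul_one] at h1
  rw [abs_of_nonneg hk] at h2
  rw [mollF_eq _ _ _ (by rintro rfl; norm_num at hs), norm_mul, norm_mul, norm_mul, norm_pow]
  have h3 := norm_kap_le_one (s := s) (by rw [hs]; norm_num)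
  have hC0 := (norm_nonneg _).trans hC
  calc _ ≤ 1 * C * (Real.exp (2 * k) ^ v * Real.exp 2) := by gcongr
    _ = _ := by ring

/-- The common factor κ X^(v-1) is bounded on this line; what it multiplies is the quantity that
nearly cancels. -/
theorem norm_mollF_add_mollS_four_le {C L k : ℝ} {J B v : ℕ} (hv : 1 ≤ v) (hL : 0 ≤ L) (hk : 0 ≤ k)
    {s : ℂ} (hs : s.re = 4)
    (hC : ‖deriv riemannZeta s * ev (cchar s) (NK L J B (-1)) * ev (cchar s) (NK L J B k) +
        ev (cchar s) (rho L J B k)‖ ≤ C) :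
    ‖mollF v (NK L J B k) (NK L J B (-1)) s + mollS v (NK L J B k) (rho L J B k) s‖ ≤
      C * Real.exp (2 * k) ^ v := by
  have h2 := norm_ev_NK_le hL J B k (s := s) (by rw [hs]; norm_num)
  rw [abs_of_nonneg hk] at h2
  rw [mollF_eq _ _ _ (by rintro rfl; norm_num at hs), mollS]
  obtain ⟨w, rfl⟩ : ∃ w, v = w + 1 := ⟨v - 1, by omega⟩
  rw [Nat.add_sub_cancel]
  have heq : kap s * deriv riemannZeta s *
      (ev (cchar s) (NK L J B k) ^ (w + 1) * ev (cchar s) (NK L J B (-1))) +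
      kap s * (ev (cchar s) (NK L J B k) ^ w * ev (cchar s) (rho L J B k)) =
      kap s * ev (cchar s) (NK L J B k) ^ w *
      (deriv riemannZeta s * ev (cchar s) (NK L J B (-1)) * ev (cchar s) (NK L J B k) +
        ev (cchar s) (rho L J B k)) := by ring
  rw [heq, norm_mul, norm_mul, norm_pow]
  have h3 := norm_kap_le_one (s := s) (by rw [hs]; norm_num)
  have hC0 := (norm_nonneg _).trans hC
  have h4 : (1 : ℝ) ≤ Real.exp (2 * k) := Real.one_le_exp (by positivity)
  calc _ ≤ 1 * Real.exp (2 * k) ^ w * C := by gcongr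
    _ ≤ 1 * Real.exp (2 * k) ^ (w + 1) * C := by
        gcongr ?_ * ?_ * ?_
        · exact pow_le_pow_right₀ h4 (Nat.le_succ w)
    _ = _ := by ring

/-! ### Comparison of the moments -/

/-- E stands for the common order Δ L^(k²). The lower bound for the mean of |S|^p near the critical
line meets the interpolated upper bound; after division by E a numerical inequality remains, which
fails if A is large and the moment constant μ small. -/
theorem moment_comparison {v : ℕ} (hv : 3 ≤ v) {Δ : ℝ} (hΔ : 4 ≤ Δ) (τ : ℝ) {x x₁ y : AF}
    {N k A L E C₁ C₂ C₃ C₄ c m μ : ℝ} (hk : 0 < k) (hvk : 1 < v * k) (hx : LogLen x N)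
    (hx₁ : LogLen x₁ N) (hy : LogLen y N) (hA : 1 ≤ A) (hAL : 4 * A ≤ L) (hC₁ : 0 < C₁)
    (hC₂ : 0 < C₂) (hC₃ : 0 < C₃) (hC₄ : 0 < C₄) (hm : 0 < m) (hμ : 0 < μ)
    (hE : √Real.pi * Δ ≤ E)
    (h1 : ∫ t, gw τ Δ t * nl x (1 / 2) t ^ 2 ≤ C₁ * E)
    (h2 : ∫ t, gw τ Δ t * nl y (1 / 2) t ^ 2 ≤ C₂ * (E * L ^ 2))
    (h2' : ∫ t, gw τ Δ t * nl y (1 / 2 + A / L) t ^ 2 ≤ C₂ * (E * L ^ 2))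
    (h3 : ∫ t, gw τ Δ t * (nl x (1 / 2) t ^ (v * (2 * k / (v * k - 1))) *
      nl x₁ (1 / 2) t ^ (2 * k / (v * k - 1))) ≤ C₃ * E)
    (h4 : ∀ s : ℂ, s.re = 4 → ‖mollF v x x₁ s‖ ≤ C₄)
    (h4' : ∀ s : ℂ, s.re = 4 → ‖mollF v x x₁ s + mollS v x y s‖ ≤ C₄ * Real.exp (-L))
    (h5 : c * (E * L) ≤ ∫ t, gw τ Δ t * (nl x (1 / 2 + A / L) t * nl y (1 / 2 + A / L) t))
    (hmc : m ^ (v / (2 * v - 2) : ℝ) * C₂ ^ (1 - v / (2 * v - 2) : ℝ) < c)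
    (h0 : ∫ t, gw τ Δ t * zl t ^ (2 * k) ≤ μ * (E * L ^ (2 * k))) :
    m / 49 * L ^ (2 / v : ℝ) <
      Real.exp (-(A / (2 * v))) * (Real.exp 1 * (C₁ ^ (1 - 1 / v : ℝ) * C₂ ^ (1 / v : ℝ))) *
        L ^ (2 / v : ℝ) +
      2 * (Real.exp 1 * (μ ^ (1 / (v * k)) * C₃ ^ (1 - 1 / (v * k)))) * L ^ (2 / v : ℝ) +
      2 * (Real.exp 1 * C₄ ^ (2 / v : ℝ)) := by
  have hΔ0 : 0 < Δ := by linarith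
  have hv0 : (0 : ℝ) < v := by positivity
  have hv3 : (3 : ℝ) ≤ v := by exact_mod_cast hv
  have hp : (0 : ℝ) < 2 / v := by positivity
  have hp1 : (2 / v : ℝ) ≤ 1 := by rw [div_le_one hv0]; linarith
  have hv2 : (0 : ℝ) < 2 * v - 2 := by linarith
  have hL : 0 < L := by linarith
  have hA0 : 0 < A := by linarith
  have hpi : 0 < √Real.pi := Real.sqrt_pos.2 Real.pi_pos
  have hE0 : 0 < E := lt_of_lt_of_le (by positivity) hE
  have hAL' : A / L ≤ 1 / 4 := by rw [div_le_iff₀ hL]; linarith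
  have hAL0 : 0 < A / L := by positivity
  set σ := 1 / 2 + A / L with hσ
  have hσ1 : 1 / 2 ≤ σ := by linarith
  have hσ2 : σ ≤ 3 / 4 := by linarith
  set p : ℝ := 2 / v with hpdef
  -- Were the mean of |S|^p smaller, Hölder would make the mean of |XY| smaller than orthogonality
  -- allows.
  have hlow : m / 49 * (E * L ^ p) < lineMean (fun s => wE p τ Δ s * mollS v x y s) p σ := by
    by_contra hcon
    rw [not_lt] at hcon
    have h6 := integral_gw_mul_nl_mul_nl_le hv hΔ τ hx hy hσ1 hσ2 (by positivity) (by positivity)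
      hcon h2'
    have h7 := h5.trans h6
    have h8 : (49 * (m / 49 * (E * L ^ p))) ^ (v / (2 * v - 2) : ℝ) *
        (C₂ * (E * L ^ 2)) ^ (1 - v / (2 * v - 2) : ℝ) =
        m ^ (v / (2 * v - 2) : ℝ) * C₂ ^ (1 - v / (2 * v - 2) : ℝ) * (E * L) := by
      rw [show 49 * (m / 49 * (E * L ^ p)) = m * (E * L ^ p) by ring,
        Real.mul_rpow hm.le (by positivity), Real.mul_rpow hE0.le (by positivity),
        Real.mul_rpow hC₂.le (by positivity), Real.mul_rpow hE0.le (by positivity),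
        ← Real.rpow_natCast, ← Real.rpow_mul hL.le, ← Real.rpow_mul hL.le]
      have e1 : E ^ (v / (2 * v - 2) : ℝ) * E ^ (1 - v / (2 * v - 2) : ℝ) = E := by
        rw [← Real.rpow_add hE0, add_sub_cancel, Real.rpow_one]
      have e2 : L ^ (p * (v / (2 * v - 2) : ℝ)) * L ^ (((2 : ℕ) : ℝ) * (1 - v / (2 * v - 2) : ℝ)) =
          L := by
        rw [← Real.rpow_add hL]
        conv_rhs => rw [← Real.rpow_one L]
        congr 1
        have h3 := hv2.ne'
        push_cast
        rw [hpdef, one_sub_div h3, div_mul_div_comm, mul_div_assoc',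
          div_add_div _ _ (by positivity) h3, div_eq_one_iff_eq (by positivity)]
        ring
      calc _ = m ^ (v / (2 * v - 2) : ℝ) * C₂ ^ (1 - v / (2 * v - 2) : ℝ) *
          ((E ^ (v / (2 * v - 2) : ℝ) * E ^ (1 - v / (2 * v - 2) : ℝ)) *
          (L ^ (p * (v / (2 * v - 2) : ℝ)) * L ^ (((2 : ℕ) : ℝ) * (1 - v / (2 * v - 2) : ℝ)))) := by
            ring
        _ = _ := by rw [e1, e2]
    rw [h8] at h7
    have h9 : 0 < E * L := by positivity
    exact absurd (le_of_mul_le_mul_right h7 h9) (not_le.2 hmc)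
  have hS := lineMean_mollS_half_le hv hΔ τ hx hy (by positivity) (by positivity) h1 h2
  have hF := lineMean_mollF_half_le hv hΔ τ hk hvk hx hx₁ (by positivity) (by positivity) h0 h3
  have hF4 := lineMean_wE_le_const hp hΔ τ (by norm_num) le_rfl h4
  have hG4 := lineMean_wE_le_const hp hΔ τ (by norm_num) le_rfl h4'
  have hlam : 0 ≤ p * L / 4 := by positivity
  have hint := lineMean_wE_interpolate (reg_mollF v hx hx₁) (reg_mollS v hx hy) hp hp1 hΔ τ hlam hσ1
    (by linarith)
  have e1 : p * L / 4 * (σ - 1 / 2) = A / (2 * v) := by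
    rw [hσ, hpdef]; field_simp; ring
  have e2 : (C₁ * E) ^ (1 - 1 / v : ℝ) * (C₂ * (E * L ^ 2)) ^ (1 / v : ℝ) =
      C₁ ^ (1 - 1 / v : ℝ) * C₂ ^ (1 / v : ℝ) * (E * L ^ p) := by
    rw [Real.mul_rpow hC₁.le hE0.le, Real.mul_rpow hC₂.le (by positivity),
      Real.mul_rpow hE0.le (by positivity), ← Real.rpow_natCast, ← Real.rpow_mul hL.le]
    have e3 : E ^ (1 - 1 / v : ℝ) * E ^ (1 / v : ℝ) = E := by
      rw [← Real.rpow_add hE0, sub_add_cancel, Real.rpow_one]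
    have e4 : ((2 : ℕ) : ℝ) * (1 / v) = p := by rw [hpdef]; push_cast; ring
    rw [e4]
    calc _ = C₁ ^ (1 - 1 / v : ℝ) * C₂ ^ (1 / v : ℝ) *
        (E ^ (1 - 1 / v : ℝ) * E ^ (1 / v : ℝ) * L ^ p) := by ring
      _ = _ := by rw [e3]
  have e5 : (μ * (E * L ^ (2 * k))) ^ (1 / (v * k)) * (C₃ * E) ^ (1 - 1 / (v * k)) =
      μ ^ (1 / (v * k)) * C₃ ^ (1 - 1 / (v * k)) * (E * L ^ p) := by
    rw [Real.mul_rpow hμ.le (by positivity), Real.mul_rpow hC₃.le hE0.le,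
      Real.mul_rpow hE0.le (by positivity), ← Real.rpow_mul hL.le]
    have e3 : E ^ (1 / (v * k)) * E ^ (1 - 1 / (v * k)) = E := by
      rw [← Real.rpow_add hE0, add_sub_cancel, Real.rpow_one]
    have e4 : 2 * k * (1 / (v * k)) = p := by rw [hpdef]; field_simp
    rw [e4]
    calc _ = μ ^ (1 / (v * k)) * C₃ ^ (1 - 1 / (v * k)) *
        (E ^ (1 / (v * k)) * E ^ (1 - 1 / (v * k)) * L ^ p) := by ring
      _ = _ := by rw [e3]
  rw [e2] at hS
  rw [e5] at hF
  have hC4p : 0 < C₄ ^ p := by positivity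
  have hF4' : lineMean (fun s => wE p τ Δ s * mollF v x x₁ s) p 4 ≤ Real.exp 1 * C₄ ^ p * E := by
    refine hF4.trans ?_
    calc Real.exp 1 * (√Real.pi * Δ) * C₄ ^ p ≤ Real.exp 1 * E * C₄ ^ p := by gcongr
      _ = _ := by ring
  have hG4' : Real.exp (p * L / 4 * (4 - σ)) *
      lineMean (fun s => wE p τ Δ s * (mollF v x x₁ s + mollS v x y s)) p 4 ≤
      Real.exp 1 * C₄ ^ p * E := by
    have e6 : (C₄ * Real.exp (-L)) ^ p = C₄ ^ p * Real.exp (-(p * L)) := by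
      rw [Real.mul_rpow hC₄.le (Real.exp_pos _).le, ← Real.exp_mul]
      congr 2; ring
    rw [e6] at hG4
    have e7 : Real.exp (p * L / 4 * (4 - σ)) * Real.exp (-(p * L)) ≤ 1 := by
      rw [← Real.exp_add, Real.exp_le_one_iff]
      have : 0 ≤ p * L / 4 * σ := mul_nonneg hlam (by linarith)
      linarith
    calc _ ≤ Real.exp (p * L / 4 * (4 - σ)) *
          (Real.exp 1 * (√Real.pi * Δ) * (C₄ ^ p * Real.exp (-(p * L)))) := by gcongr
      _ = Real.exp 1 * C₄ ^ p * (√Real.pi * Δ) *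
          (Real.exp (p * L / 4 * (4 - σ)) * Real.exp (-(p * L))) := by ring
      _ ≤ Real.exp 1 * C₄ ^ p * E * 1 := by gcongr
      _ = _ := mul_one _
  rw [e1] at hint
  have hS' := mul_le_mul_of_nonneg_left hS (Real.exp_pos (-(A / (2 * v)))).le
  refine lt_of_mul_lt_mul_right ?_ hE0.le
  calc m / 49 * L ^ p * E = m / 49 * (E * L ^ p) := by ring
    _ < _ := hlow
    _ ≤ _ := hint
    _ ≤ Real.exp (-(A / (2 * v))) *
        (Real.exp 1 * (C₁ ^ (1 - 1 / v : ℝ) * C₂ ^ (1 / v : ℝ) * (E * L ^ p))) +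
        2 * (Real.exp 1 * (μ ^ (1 / (v * k)) * C₃ ^ (1 - 1 / (v * k)) * (E * L ^ p))) +
        Real.exp 1 * C₄ ^ p * E + Real.exp 1 * C₄ ^ p * E := by linarith
    _ = _ := by ring

/-! ### The lower bound for Gaussian averages -/

theorem exists_exp_neg_mul_le {c C s b : ℝ} (hc : 0 < c) (hC : 0 < C) (hb : 0 < b) :
    ∃ A : ℝ, 1 ≤ A ∧ Real.exp (-(b * A)) * C ≤ c * A ^ (-s) := by
  have h := (tendsto_rpow_mul_exp_neg_mul_atTop_nhds_zero s b hb).eventually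
    (Iio_mem_nhds (by positivity : 0 < c / C))
  obtain ⟨A, hA, hA1⟩ := (h.and (Filter.eventually_ge_atTop 1)).exists
  refine ⟨A, hA1, ?_⟩
  have hA0 : 0 < A := by linarith
  rw [lt_div_iff₀ hC] at hA
  have hs : 0 < A ^ s := Real.rpow_pos_of_pos hA0 s
  rw [Real.rpow_neg hA0.le, ← div_eq_mul_inv, le_div_iff₀ hs]
  rw [neg_mul] at hA
  linarith

theorem sqrt_nrm_mul_nrm_le {x y : AF} {C C' L k : ℝ} (hC : 0 < C) (hC' : 0 < C') (hL : 0 < L)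
    (hx : nrm x ≤ C * L ^ (k ^ 2)) (hy : nrm y ≤ C' * L ^ (k ^ 2 + 2)) :
    √(nrm x * nrm y) ≤ √(C * C') * L ^ (k ^ 2 + 1) := by
  refine Real.sqrt_le_iff.2 ⟨by positivity, ?_⟩
  rw [mul_pow, Real.sq_sqrt (by positivity)]
  calc nrm x * nrm y ≤ C * L ^ (k ^ 2) * (C' * L ^ (k ^ 2 + 2)) :=
        mul_le_mul hx hy (nrm_nonneg y) (by positivity)
    _ = C * C' * (L ^ (k ^ 2) * L ^ (k ^ 2 + 2)) := by ring
    _ = C * C' * (L ^ (k ^ 2 + 1)) ^ 2 := by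
        rw [← Real.rpow_add hL, ← Real.rpow_natCast (L ^ (k ^ 2 + 1)), ← Real.rpow_mul hL.le]
        congr 2; push_cast; ring

/-- Only the order of choices is left: v and B fix the polynomials and θ; A is chosen so that the
exponential gain wins; then m, and finally μ. A moment smaller than μ E L^(2k) contradicts
`moment_comparison`. -/
theorem exists_le_integral_gw_mul_zl {k : ℝ} (hk : 0 < k) : ∃ c Δ₀ : ℝ, 0 < c ∧
    ∀ Δ : ℝ, Δ₀ ≤ Δ → ∀ τ : ℝ,
      c * (Δ * Real.log Δ ^ (k ^ 2 + 2 * k)) ≤ ∫ t, gw τ Δ t * zl t ^ (2 * k) := by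
  -- An integer v keeps X^v holomorphic; v ≥ 3 gives p ≤ 1 and vk > 1 is needed for Hölder.
  obtain ⟨w, hw⟩ := exists_nat_gt (1 / k)
  rw [div_lt_iff₀ hk] at hw
  obtain ⟨v, hv, hvk⟩ : ∃ v : ℕ, 3 ≤ v ∧ 1 < v * k :=
    ⟨w + 3, by omega, by push_cast; linarith⟩
  have hv0 : (0 : ℝ) < v := by positivity
  have hv3 : (3 : ℝ) ≤ v := by exact_mod_cast hv
  have hvk1 : 0 < v * k - 1 := by linarith
  have hv2 : (0 : ℝ) < 2 * v - 2 := by linarith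
  obtain ⟨κ, B₁, Cm, m', c', b', hκ, hCm, hmaj⟩ := exists_majorant k v (2 * k / (v * k - 1)) hk hv0
    (by positivity) (by have := hvk1.ne'; field_simp; ring)
  obtain ⟨CX, hCX, hX⟩ := exists_nrm_NK_le k
  obtain ⟨CY, hCY, hY⟩ := exists_nrm_rho_le k hk.le
  obtain ⟨B₂, c₀, y₀, hc₀, hy₀, hsum⟩ := exists_le_sum_NK k hk
  obtain ⟨Cz, hCz, hz⟩ := exists_norm_deriv_zeta_le
  obtain ⟨Cg, hCg, hg⟩ := exists_norm_deriv_zeta_mul_add_le hk.le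
  set B : ℕ := 2 * (B₁ + B₂ + 1) with hB
  have hBeven : Even B := even_two_mul _
  have hB1 : 1 ≤ B := by omega
  have hκ' : (1 : ℝ) ≤ κ := by exact_mod_cast hκ
  have hB' : (1 : ℝ) ≤ B := by exact_mod_cast hB1
  -- Chosen so that the longest polynomial, the majorant of length 2κBL, has length exactly log Δ/2.
  set θ : ℝ := 1 / (4 * κ * B) with hθ
  have hθ0 : 0 < θ := by positivity
  set C₄ : ℝ := Cz * (Real.exp (2 * k) ^ v * Real.exp 2) + Cg * Real.exp (2 * k) ^ v with hC₄
  have hC₄0 : 0 < C₄ := by positivity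
  set a : ℝ := v / (2 * v - 2) with ha
  have ha0 : 0 < a := by positivity
  set D : ℝ := k ^ 2 + 1 with hD
  set C₇ : ℝ := Real.exp 1 * ((2 * CX) ^ (1 - 1 / v : ℝ) * (2 * CY) ^ (1 / v : ℝ)) with hC₇
  have hC₇0 : 0 < C₇ := by positivity
  set C₉ : ℝ := 2 * (Real.exp 1 * C₄ ^ (2 / v : ℝ)) with hC₉
  set c₁ : ℝ := Real.exp (-2) * c₀ / 2 with hc₁
  have hc₁0 : 0 < c₁ := by positivity
  have hCYa : 0 < (2 * CY) ^ (1 - a) := by positivity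
  -- Solves m^a (2CY)^(1-a) = c₁ A^(-D)/2 for m = c₆ A^(-D/a), with a factor 2 to spare.
  set c₆ : ℝ := (c₁ / (2 * (2 * CY) ^ (1 - a))) ^ (1 / a) with hc₆
  have hc₆0 : 0 < c₆ := by positivity
  -- The gain e^(-A/(2v)) beats the power A^(-D/a) lost in the lower bound.
  obtain ⟨A, hA, hAexp⟩ := exists_exp_neg_mul_le (s := D * (1 / a)) (b := 1 / (2 * v))
    (by positivity : 0 < c₆ / 200) hC₇0 (by positivity)
  have hA0 : 0 < A := by linarith
  set m : ℝ := c₆ * A ^ (-(D * (1 / a))) with hm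
  have hm0 : 0 < m := by positivity
  have hmc : m ^ a * (2 * CY) ^ (1 - a) < c₁ * A ^ (-D) := by
    have e1 : m ^ a = c₁ / (2 * (2 * CY) ^ (1 - a)) * A ^ (-D) := by
      rw [hm, Real.mul_rpow hc₆0.le (by positivity), hc₆, ← Real.rpow_mul (by positivity),
        ← Real.rpow_mul hA0.le]
      have : 1 / a * a = 1 := by field_simp
      rw [neg_mul, mul_assoc, this, Real.rpow_one, mul_one]
    rw [e1]
    have h2 : 0 < c₁ * A ^ (-D) := by positivity
    calc _ = c₁ * A ^ (-D) / 2 := by field_simp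
      _ < _ := by linarith
  set C₈ : ℝ := Real.exp 1 * (2 * Cm) ^ (1 - 1 / (v * k)) with hC₈
  have hC₈0 : 0 < C₈ := by positivity
  set μ : ℝ := (m / (400 * C₈)) ^ (v * k) with hμ
  have hμ0 : 0 < μ := by positivity
  have hμb : 2 * (Real.exp 1 * (μ ^ (1 / (v * k)) * (2 * Cm) ^ (1 - 1 / (v * k)))) = m / 200 := by
    have e1 : μ ^ (1 / (v * k)) = m / (400 * C₈) := by
      rw [hμ, ← Real.rpow_mul (by positivity), mul_one_div_cancel (by positivity), Real.rpow_one]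
    rw [e1]
    calc _ = 2 * (m / (400 * C₈)) * C₈ := by rw [hC₈]; ring
      _ = _ := by field_simp; norm_num
  -- Keeps the off-diagonal error below half of the diagonal sum.
  set ε : ℝ := c₁ * A ^ (-D) / √(CX * CY) with hε
  have hs0 : 0 < √(CX * CY) := Real.sqrt_pos.2 (by positivity)
  have hε0 : 0 < ε := by positivity
  obtain ⟨Δ₁, hΔ₁⟩ := exists_error_le (lt_min one_pos hε0)
  have hlim := (tendsto_rpow_atTop (by positivity : (0 : ℝ) < 2 / v)).eventually_ge_atTop
    (200 * C₉ / m)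
  obtain ⟨L₁, hL₁⟩ := Filter.eventually_atTop.1 hlim
  set L₀ := max (max L₁ (4 * A)) (A * y₀) with hL₀
  refine ⟨μ * (√Real.pi * θ ^ (k ^ 2 + 2 * k)), max (max Δ₁ 4) (Real.exp (L₀ / θ)), ?_,
    fun Δ hΔ τ => ?_⟩
  · have := Real.sqrt_pos.2 Real.pi_pos
    positivity
  have hΔ1 : Δ₁ ≤ Δ := (le_max_left _ _).trans ((le_max_left _ _).trans hΔ)
  have hΔ4 : 4 ≤ Δ := (le_max_right _ _).trans ((le_max_left _ _).trans hΔ)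
  have hΔ0 : 0 < Δ := by linarith
  have herr := hΔ₁ Δ hΔ1
  set L := θ * Real.log Δ with hL
  have hLL : L₀ ≤ L := by
    have : L₀ / θ ≤ Real.log Δ := by
      rw [Real.le_log_iff_exp_le hΔ0]
      exact (le_max_right _ _).trans hΔ
    rw [div_le_iff₀ hθ0] at this
    rw [hL]; linarith
  have hL1 : L₁ ≤ L := (le_max_left _ _).trans ((le_max_left _ _).trans hLL)
  have hAL : 4 * A ≤ L := (le_max_right _ _).trans ((le_max_left _ _).trans hLL)
  have hyL : A * y₀ ≤ L := (le_max_right _ _).trans hLL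
  have hLone : 1 ≤ L := by linarith
  have hLpos : 0 < L := by linarith
  have hlogpos : 0 ≤ Real.log Δ := Real.log_nonneg (by linarith)
  obtain ⟨J, hJ⟩ := exists_cut_lt L
  set N := Real.log Δ / 2 with hN
  have hNL : N = 2 * κ * B * L := by
    rw [hN, hL, hθ]; field_simp; ring
  have hBκ : 2 * B * L ≤ N := by
    rw [hNL]
    have : 2 * (B : ℝ) * L ≤ κ * (2 * B * L) := le_mul_of_one_le_left (by positivity) hκ'
    linarith
  have hLN : L ≤ N := by
    refine le_trans ?_ hBκ
    have : L ≤ B * L := le_mul_of_one_le_left hLpos.le hB'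
    linarith
  have herr1 := herr.trans (min_le_left _ _)
  have herr2 := herr.trans (min_le_right _ _)
  have hx : LogLen (NK L J B k) N := (logLen_NK hLpos.le J B k).mono hBκ
  have hx₁ : LogLen (NK L J B (-1)) N := (logLen_NK hLpos.le J B (-1)).mono hBκ
  have hy : LogLen (rho L J B k) N := (logLen_rho L J B k).mono hLN
  have hpi : 0 < √Real.pi := Real.sqrt_pos.2 Real.pi_pos
  set E := √Real.pi * Δ * L ^ (k ^ 2) with hE
  have hXn := hX L hLone J B
  have hYn := hY L hLone J B hB1 hJ
  obtain ⟨hm1, hm2, hm3⟩ := hmaj B (by omega) L hLone J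
  have hE0 : √Real.pi * Δ ≤ E :=
    le_mul_of_one_le_right (by positivity) (Real.one_le_rpow hLone (by positivity))
  have h1 : ∫ t, gw τ Δ t * nl (NK L J B k) (1 / 2) t ^ 2 ≤ 2 * CX * E := by
    refine (integral_gw_mul_norm_sq_le hx (by norm_num) hΔ0 herr1).trans ?_
    calc _ ≤ 2 * (√Real.pi * Δ) * (CX * L ^ (k ^ 2)) := by gcongr
      _ = _ := by rw [hE]; ring
  have h2 : ∀ σ : ℝ, 1 / 2 ≤ σ →
      ∫ t, gw τ Δ t * nl (rho L J B k) σ t ^ 2 ≤ 2 * CY * (E * L ^ 2) := by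
    intro σ hσ
    refine (integral_gw_mul_norm_sq_le hy hσ hΔ0 herr1).trans ?_
    calc _ ≤ 2 * (√Real.pi * Δ) * (CY * L ^ (k ^ 2 + 2)) := by gcongr
      _ = _ := by
        rw [hE, Real.rpow_add hLpos, Real.rpow_two]; ring
  have h3 : ∫ t, gw τ Δ t * (nl (NK L J B k) (1 / 2) t ^ (v * (2 * k / (v * k - 1))) *
      nl (NK L J B (-1)) (1 / 2) t ^ (2 * k / (v * k - 1))) ≤ 2 * Cm * E := by
    refine (integral_gw_mul_majorant_le ((range J).powerset) hΔ0 τ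
      (fun U _ => hm2 U) hm1 (by rw [← hNL]; exact herr1) hm3).trans (le_of_eq ?_)
    rw [hE]; ring
  have h5 : c₁ * A ^ (-D) * (E * L) ≤ ∫ t, gw τ Δ t * (nl (NK L J B k) (1 / 2 + A / L) t *
      nl (rho L J B k) (1 / 2 + A / L) t) := by
    have hs := hsum B (by omega) L (L / A) J (by rw [le_div_iff₀ hA0]; linarith)
      (div_le_self hLpos.le hA) hJ
    have hS := le_sum_NK_mul_rho hA hLpos hBeven hk.le hJ hLN hs
    have hnn := sqrt_nrm_mul_nrm_le hCX hCY hLpos hXn hYn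
    have hP : (L / A) ^ (k ^ 2 + 1) = A ^ (-D) * L ^ D := by
      rw [Real.div_rpow hLpos.le hA0.le, ← hD, Real.rpow_neg hA0.le]
      field_simp
    have hLD : L ^ D = L ^ (k ^ 2) * L := by rw [hD, Real.rpow_add hLpos, Real.rpow_one]
    have he : Real.exp (-(Δ * Real.exp (-N)) ^ 2 / 4) * Real.exp N *
        √(nrm (NK L J B k) * nrm (rho L J B k)) ≤ c₁ * (A ^ (-D) * L ^ D) := by
      calc _ ≤ ε * (√(CX * CY) * L ^ D) :=
            mul_le_mul herr2 hnn (Real.sqrt_nonneg _) hε0.le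
        _ = _ := by rw [hε]; field_simp
    have hA_L : 0 ≤ A / L := by positivity
    refine le_trans (le_of_eq ?_)
      (le_integral_gw_mul_nl_mul_nl hx hy (by linarith) hΔ0 τ hS he)
    rw [hP, hE, hLD, hc₁]; ring
  by_contra hcon
  rw [not_le] at hcon
  have hEL : μ * (√Real.pi * θ ^ (k ^ 2 + 2 * k)) * (Δ * Real.log Δ ^ (k ^ 2 + 2 * k)) =
      μ * (E * L ^ (2 * k)) := by
    have e1 : E * L ^ (2 * k) = √Real.pi * Δ * L ^ (k ^ 2 + 2 * k) := by
      rw [hE, Real.rpow_add hLpos]; ring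
    rw [e1, hL, Real.mul_rpow hθ0.le hlogpos]; ring
  rw [hEL] at hcon
  have key := moment_comparison hv hΔ4 τ hk hvk hx hx₁ hy hA hAL (by positivity) (by positivity)
    (by positivity) hC₄0 hm0 hμ0 hE0 h1 (h2 _ le_rfl)
    (h2 _ (by have : 0 ≤ A / L := by positivity
              linarith)) h3 (fun s hs => ?_) (fun s hs => ?_) h5 hmc hcon.le
  -- Each of the three terms on the right is at most m/200 · L^(2/v), and 3/200 < 1/49.
  · rw [hμb] at key
    have hLp := hL₁ L hL1
    rw [div_le_iff₀ hm0] at hLp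
    have hLp0 : 0 < L ^ (2 / v : ℝ) := by positivity
    have e1 : Real.exp (-(A / (2 * v))) * C₇ ≤ m / 200 := by
      rw [show A / (2 * (v : ℝ)) = 1 / (2 * v) * A by ring]
      refine hAexp.trans (le_of_eq ?_)
      rw [hm]; ring
    have e2 := mul_le_mul_of_nonneg_right e1 hLp0.le
    have e3 : 0 < m * L ^ (2 / v : ℝ) := by positivity
    linarith
  · refine (norm_mollF_four_le hLpos.le hk.le hs (hz s hs)).trans ?_
    rw [hC₄]
    have : 0 ≤ Cg * Real.exp (2 * k) ^ v := by positivity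
    linarith
  · refine (norm_mollF_add_mollS_four_le (by omega) hLpos.le hk.le hs (hg L hLpos.le J B s hs)).trans ?_
    have h6 : 0 ≤ Cz * (Real.exp (2 * k) ^ v * Real.exp 2) * Real.exp (-L) := by positivity
    calc _ = Cg * Real.exp (2 * k) ^ v * Real.exp (-L) := by ring
      _ ≤ _ := by rw [hC₄, add_mul]; linarith

/-! ### Localization to `[1, T]` and averaging -/

/-- Outside (1, T] the distance to τ is at least T/4, that is (log T)/4 widths. A quarter of the
Gaussian exponent is kept for integrability and the rest gives the decay. -/
theorem gw_le_of_notMem {T τ t : ℝ} (hT : 12 ≤ T) (hτ : T / 3 ≤ τ) (hτ' : τ ≤ 2 * T / 3)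
    (ht : t ∉ Set.Ioc 1 T) : gw τ (T / Real.log T) t ≤
      gw τ (2 * (T / Real.log T)) t * Real.exp (-(Real.log T) ^ 2 / 32) := by
  have hlog : 0 < Real.log T := Real.log_pos (by linarith)
  have hT0 : 0 < T := by linarith
  have hd : (T / 4) ^ 2 ≤ (t - τ) ^ 2 := by
    rw [Set.mem_Ioc, not_and_or, not_lt, not_le] at ht
    rcases ht with h | h <;> nlinarith
  rw [gw, gw, ← Real.exp_add]
  refine Real.exp_le_exp.2 ?_
  have e1 : ((t - τ) / (2 * (T / Real.log T))) ^ 2 = ((t - τ) / (T / Real.log T)) ^ 2 / 4 := by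
    field_simp; ring
  have e2 : (Real.log T) ^ 2 / 16 ≤ ((t - τ) / (T / Real.log T)) ^ 2 := by
    rw [div_pow, le_div_iff₀ (by positivity), div_pow]
    calc Real.log T ^ 2 / 16 * (T ^ 2 / Real.log T ^ 2) = (T / 4) ^ 2 := by field_simp; norm_num
      _ ≤ _ := hd
  rw [e1]
  nlinarith [sq_nonneg (Real.log T)]

/-- The factor exp(-(log T)²/32) overwhelms the polynomial growth of ζ', so the weight may be
confined to [1, T] at bounded cost. -/
theorem exists_integral_gw_mul_zl_le {r : ℝ} (hr : 0 ≤ r) : ∃ T₁ : ℝ, ∀ T : ℝ, T₁ ≤ T →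
    ∀ τ : ℝ, T / 3 ≤ τ → τ ≤ 2 * T / 3 →
      ∫ t, gw τ (T / Real.log T) t * zl t ^ r ≤
        (∫ t in (1 : ℝ)..T, gw τ (T / Real.log T) t * zl t ^ r) + 1 := by
  obtain ⟨C, n, hC, hz⟩ := exists_zl_rpow_le hr
  set K : ℝ := C * ((n + 2).factorial * Real.exp 2) * 4 ^ (n + 2) * Real.pi with hK
  have hK0 : 0 < K := by have := Real.pi_pos; positivity
  refine ⟨max (max 12 K) (Real.exp (32 * (n + 3))), fun T hT τ hτ hτ' => ?_⟩
  have hT12 : 12 ≤ T := (le_max_left _ _).trans ((le_max_left _ _).trans hT)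
  have hTK : K ≤ T := (le_max_right _ _).trans ((le_max_left _ _).trans hT)
  have hT0 : 0 < T := by linarith
  have hlog : 32 * ((n : ℝ) + 3) ≤ Real.log T := by
    rw [Real.le_log_iff_exp_le hT0]; exact (le_max_right _ _).trans hT
  have hn : (0 : ℝ) ≤ n := Nat.cast_nonneg n
  have hlog1 : 1 ≤ Real.log T := by linarith
  have hlog0 : 0 < Real.log T := by linarith
  set Δ := T / Real.log T with hΔ
  have hΔ0 : 0 < Δ := by positivity
  have hΔT : Δ ≤ T := div_le_self hT0.le hlog1
  set e := Real.exp (-(Real.log T) ^ 2 / 32) with he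
  have hbase : 1 + |τ| + 2 * Δ ≤ 4 * T := by
    rw [abs_of_nonneg (by linarith)]; linarith
  have he1 : C * ((4 * T) ^ (n + 2) * (n + 2).factorial * Real.exp 2) * e * Real.pi ≤ 1 := by
    have e1 : T ^ (n + 2) * e ≤ T⁻¹ := by
      have : T ^ (n + 2) = Real.exp ((n + 2) * Real.log T) := by
        rw [← Real.exp_log hT0, ← Real.exp_nat_mul, Real.log_exp]; push_cast; rfl
      rw [this, he, ← Real.exp_add]
      conv_rhs => rw [← Real.exp_log hT0, ← Real.exp_neg]
      refine Real.exp_le_exp.2 ?_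
      nlinarith
    calc _ = K * (T ^ (n + 2) * e) := by rw [hK, mul_pow]; ring
      _ ≤ K * T⁻¹ := by gcongr
      _ ≤ 1 := by rw [← div_eq_mul_inv]; exact div_le_one_of_le₀ hTK hT0.le
  have hi := integrable_gw_mul_zl_rpow hr τ hΔ0
  have hpt : ∀ t, gw τ Δ t * zl t ^ r ≤
      Set.indicator (Set.Ioc 1 T) (fun t => gw τ Δ t * zl t ^ r) t +
      C * ((4 * T) ^ (n + 2) * (n + 2).factorial * Real.exp 2) * e * (1 + t ^ 2)⁻¹ := by
    intro t
    have hpos : 0 ≤ C * ((4 * T) ^ (n + 2) * (n + 2).factorial * Real.exp 2) * e * (1 + t ^ 2)⁻¹ := by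
      positivity
    by_cases ht : t ∈ Set.Ioc 1 T
    · rw [Set.indicator_of_mem ht]; linarith
    · rw [Set.indicator_of_notMem ht, zero_add]
      have h1 := gw_le_of_notMem hT12 hτ hτ' ht
      have h2 := gw_mul_pow_le_inv τ (by positivity : 0 < 2 * Δ) n t
      have h3 := (gw_pos τ (2 * Δ) t).le
      have h4 := Real.rpow_nonneg (zl_nonneg t) r
      calc gw τ Δ t * zl t ^ r ≤ (gw τ (2 * Δ) t * e) * (C * (1 + |t|) ^ n) :=
            mul_le_mul h1 (hz t) h4 (by positivity)
        _ = C * (gw τ (2 * Δ) t * (1 + |t|) ^ n) * e := by ring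
        _ ≤ C * ((1 + |τ| + 2 * Δ) ^ (n + 2) * (n + 2).factorial * Real.exp 2 * (1 + t ^ 2)⁻¹) * e := by
            gcongr
        _ ≤ C * ((4 * T) ^ (n + 2) * (n + 2).factorial * Real.exp 2 * (1 + t ^ 2)⁻¹) * e := by
            gcongr
        _ = _ := by ring
  have hind : Integrable (Set.indicator (Set.Ioc 1 T) (fun t => gw τ Δ t * zl t ^ r)) :=
    hi.indicator measurableSet_Ioc
  have hinv : Integrable fun t : ℝ =>
      C * ((4 * T) ^ (n + 2) * (n + 2).factorial * Real.exp 2) * e * (1 + t ^ 2)⁻¹ :=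
    integrable_inv_one_add_sq.const_mul _
  refine (integral_mono hi (hind.add hinv) hpt).trans ?_
  rw [integral_add' hind hinv, integral_indicator measurableSet_Ioc, integral_const_mul,
    integral_univ_inv_one_add_sq, intervalIntegral.integral_of_le (by linarith)]
  linarith

theorem gw_comm (τ Δ t : ℝ) : gw τ Δ t = gw t Δ τ := by
  rw [gw, gw, ← neg_sub τ t, neg_div, neg_sq]

/-- After Fubini the Gaussian is integrated in its centre, which gives at most its total mass. -/
theorem intervalIntegral_gw_mul_le {f : ℝ → ℝ} (hf : Continuous f) (hf0 : ∀ t, 0 ≤ f t) {Δ : ℝ}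
    (hΔ : 0 < Δ) {a b u v : ℝ} (hab : a ≤ b) (huv : u ≤ v) :
    ∫ τ in a..b, ∫ t in u..v, gw τ Δ t * f t ≤ √Real.pi * Δ * ∫ t in u..v, f t := by
  have hc : Continuous (Function.uncurry fun τ t : ℝ => gw τ Δ t * f t) := by
    unfold gw Function.uncurry
    fun_prop
  rw [intervalIntegral_intervalIntegral_swap]
  · rw [← intervalIntegral.integral_const_mul]
    refine intervalIntegral.integral_mono_on huv ?_ ?_ fun t ht => ?_
    · refine Continuous.intervalIntegrable ?_ _ _
      exact intervalIntegral.continuous_parametric_intervalIntegral_of_continuous'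
        (f := fun t τ => gw τ Δ t * f t) (hc.comp continuous_swap) a b
    · exact (hf.const_mul _).intervalIntegrable _ _
    · rw [intervalIntegral.integral_mul_const]
      refine mul_le_mul_of_nonneg_right ?_ (hf0 t)
      simp_rw [fun τ => gw_comm τ Δ t]
      rw [intervalIntegral.integral_of_le hab, ← integral_gw t hΔ]
      exact setIntegral_le_integral (integrable_gw t hΔ)
        (Filter.Eventually.of_forall fun τ => (gw_pos _ _ _).le)
  · refine IntegrableOn.mono_set (t := Set.uIcc a b ×ˢ Set.uIcc u v) ?_
      (Set.prod_mono Set.uIoc_subset_uIcc Set.uIoc_subset_uIcc)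
    exact hc.continuousOn.integrableOn_compact (isCompact_uIcc.prod isCompact_uIcc)

theorem exists_eventually_le_integral_zl {k : ℝ} (hk : 0 < k) : ∃ c T₁ : ℝ, 0 < c ∧ 2 ≤ T₁ ∧
    ∀ T : ℝ, T₁ ≤ T → c * (T * Real.log T ^ (k ^ 2 + 2 * k)) ≤ ∫ t in (1 : ℝ)..T, zl t ^ (2 * k) := by
  obtain ⟨c, Δ₀, hc, h⟩ := exists_le_integral_gw_mul_zl hk
  obtain ⟨T₁, hT₁⟩ := exists_integral_gw_mul_zl_le (by positivity : 0 ≤ 2 * k)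
  set ex := k ^ 2 + 2 * k with hex
  have hex0 : 0 < ex := by positivity
  have hpi : 0 < √Real.pi := Real.sqrt_pos.2 Real.pi_pos
  set Δ₁ := max (max Δ₀ (Real.exp 1)) (2 / c) with hΔ₁
  refine ⟨c * (1 / 2) ^ ex / (6 * √Real.pi), max (max T₁ (Real.exp 1)) (max 2 (Δ₁ ^ 2)),
    by positivity, (le_max_left _ _).trans (le_max_right _ _), fun T hT => ?_⟩
  have hTT₁ : T₁ ≤ T := (le_max_left _ _).trans ((le_max_left _ _).trans hT)
  have hTe : Real.exp 1 ≤ T := (le_max_right _ _).trans ((le_max_left _ _).trans hT)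
  have hT2 : 2 ≤ T := (le_max_left _ _).trans ((le_max_right _ _).trans hT)
  have hTΔ : Δ₁ ^ 2 ≤ T := (le_max_right _ _).trans ((le_max_right _ _).trans hT)
  have hT0 : 0 < T := by linarith
  have hlog1 : 1 ≤ Real.log T := by rwa [Real.le_log_iff_exp_le hT0]
  have hlog0 : 0 < Real.log T := by linarith
  set Δ := T / Real.log T with hΔ
  have hΔ0 : 0 < Δ := by positivity
  -- Hence log Δ ≥ (log T)/2, and log Δ may be replaced by log T up to a constant.
  have hsq : √T ≤ Δ := by
    rw [hΔ, le_div_iff₀ hlog0]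
    have h1 : Real.log T ≤ √T := by
      have h2 := Real.add_one_le_exp (Real.log T / 2 - 1)
      have h3 : Real.exp (Real.log T / 2) = √T := by
        rw [Real.exp_half, Real.exp_log hT0]
      have h4 : Real.exp (Real.log T / 2 - 1) * Real.exp 1 = √T := by
        rw [← Real.exp_add, sub_add_cancel, h3]
      have h5 : 2 ≤ Real.exp 1 := by linarith [Real.add_one_le_exp (1 : ℝ)]
      have h6 := Real.exp_pos (Real.log T / 2 - 1)
      nlinarith
    calc √T * Real.log T ≤ √T * √T := by gcongr
      _ = T := Real.mul_self_sqrt hT0.le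
  have hΔ₁pos : 0 < Δ₁ := lt_of_lt_of_le (by positivity : 0 < 2 / c) (le_max_right _ _)
  have hΔΔ₁ : Δ₁ ≤ Δ := (Real.le_sqrt_of_sq_le hTΔ).trans hsq
  have hΔΔ₀ : Δ₀ ≤ Δ := (le_max_left _ _).trans ((le_max_left _ _).trans hΔΔ₁)
  have hΔe : Real.exp 1 ≤ Δ := (le_max_right _ _).trans ((le_max_left _ _).trans hΔΔ₁)
  have hΔc : 2 / c ≤ Δ := (le_max_right _ _).trans hΔΔ₁
  rw [div_le_iff₀ hc] at hΔc
  have hlogΔ : 1 ≤ Real.log Δ := by rwa [Real.le_log_iff_exp_le hΔ0]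
  have hlogΔ' : 1 / 2 * Real.log T ≤ Real.log Δ := by
    have := Real.log_le_log (Real.sqrt_pos.2 hT0) hsq
    rw [Real.log_sqrt hT0.le] at this
    linarith
  set R := Real.log Δ ^ ex with hR
  have hR1 : 1 ≤ R := Real.one_le_rpow hlogΔ hex0.le
  have hR2 : (1 / 2) ^ ex * Real.log T ^ ex ≤ R := by
    rw [← Real.mul_rpow (by norm_num) hlog0.le]
    exact Real.rpow_le_rpow (by positivity) hlogΔ' hex0.le
  have hlow : ∀ τ ∈ Set.Icc (T / 3) (2 * T / 3), c * (Δ * R) / 2 ≤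
      ∫ t in (1 : ℝ)..T, gw τ Δ t * zl t ^ (2 * k) := by
    intro τ hτ
    have h1 := h Δ hΔΔ₀ τ
    have h2 := hT₁ T hTT₁ τ hτ.1 hτ.2
    have h3 : 2 ≤ c * (Δ * R) := by
      have : Δ * c ≤ Δ * c * R := le_mul_of_one_le_right (by positivity) hR1
      linarith
    linarith
  have hfc : Continuous fun t => zl t ^ (2 * k) :=
    continuous_zl.rpow_const fun _ => Or.inr (by positivity)
  have hf0 : ∀ t, 0 ≤ zl t ^ (2 * k) := fun t => Real.rpow_nonneg (zl_nonneg t) _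
  have hc' : Continuous (Function.uncurry fun τ t : ℝ => gw τ Δ t * zl t ^ (2 * k)) := by
    have : Continuous fun x : ℝ × ℝ => zl x.2 ^ (2 * k) := hfc.comp continuous_snd
    unfold gw Function.uncurry
    fun_prop
  have hup := intervalIntegral_gw_mul_le hfc hf0 hΔ0 (by linarith : T / 3 ≤ 2 * T / 3)
    (by linarith : (1 : ℝ) ≤ T)
  have hmid : ∫ τ in (T / 3)..(2 * T / 3), c * (Δ * R) / 2 ≤
      ∫ τ in (T / 3)..(2 * T / 3), ∫ t in (1 : ℝ)..T, gw τ Δ t * zl t ^ (2 * k) := by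
    refine intervalIntegral.integral_mono_on (by linarith) intervalIntegrable_const ?_ hlow
    exact (intervalIntegral.continuous_parametric_intervalIntegral_of_continuous' hc' 1
      T).intervalIntegrable _ _
  rw [intervalIntegral.integral_const, smul_eq_mul] at hmid
  have hfin := hmid.trans hup
  have h1 : T / 6 * (c * R) ≤ √Real.pi * ∫ t in (1 : ℝ)..T, zl t ^ (2 * k) := by
    refine le_of_mul_le_mul_right ?_ hΔ0
    linarith
  have h2 : c * (1 / 2) ^ ex / (6 * √Real.pi) * (T * Real.log T ^ ex) * √Real.pi ≤
      T / 6 * (c * R) := by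
    calc _ = T / 6 * (c * ((1 / 2) ^ ex * Real.log T ^ ex)) := by field_simp
      _ ≤ _ := by gcongr
  refine le_of_mul_le_mul_right ?_ hpi
  linarith

/-! ### Small heights -/

/-- If ζ' vanished on a segment, the entire function (s - 1)² ζ'(s) would vanish identically, yet
its value at 1 is -1. -/
theorem exists_zl_pos : ∃ t ∈ Set.Icc (1 : ℝ) 2, 0 < zl t := by
  by_contra! hcon
  have hz : ∀ t ∈ Set.Icc (1 : ℝ) 2, zetaD (1 / 2 + (t : ℂ) * Complex.I) = 0 := by
    intro t ht
    have h := le_antisymm (hcon t ht) (zl_nonneg t)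
    rw [zetaD_eq (half_add_ne_one t), norm_eq_zero.1 h, mul_zero]
  have hA : AnalyticOnNhd ℂ zetaD Set.univ := fun s _ =>
    differentiable_zetaD.analyticAt s
  have hfreq : ∃ᶠ z in nhdsWithin (1 / 2 + ((3 / 2 : ℝ) : ℂ) * Complex.I) {1 / 2 + ((3 / 2 : ℝ) : ℂ) * Complex.I}ᶜ,
      zetaD z = (fun _ => (0 : ℂ)) z := by
    have ht : Filter.Tendsto (fun t : ℝ => 1 / 2 + (t : ℂ) * Complex.I)
        (nhdsWithin (3 / 2) {3 / 2}ᶜ)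
        (nhdsWithin (1 / 2 + ((3 / 2 : ℝ) : ℂ) * Complex.I) {1 / 2 + ((3 / 2 : ℝ) : ℂ) * Complex.I}ᶜ) := by
      refine tendsto_nhdsWithin_iff.2 ⟨?_, ?_⟩
      · have : Continuous fun t : ℝ => 1 / 2 + (t : ℂ) * Complex.I := by fun_prop
        exact (this.tendsto (3 / 2)).mono_left nhdsWithin_le_nhds
      · filter_upwards [self_mem_nhdsWithin] with t ht h
        have := congrArg Complex.im h
        simp at this
        exact ht (by simpa using this)
    refine ht.frequently (Filter.Eventually.frequently ?_)
    have : Set.Icc (1 : ℝ) 2 ∈ nhdsWithin (3 / 2 : ℝ) {3 / 2}ᶜ :=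
      mem_nhdsWithin_of_mem_nhds (Icc_mem_nhds (by norm_num) (by norm_num))
    filter_upwards [this] with t ht using hz t ht
  have h0 := hA.eq_of_frequently_eq analyticOnNhd_const hfreq
  have h1 := congrFun h0 1
  simp [zetaD] at h1

theorem integral_zl_one_two_pos {r : ℝ} (hr : 0 ≤ r) : 0 < ∫ t in (1 : ℝ)..2, zl t ^ r := by
  obtain ⟨t, ht, h⟩ := exists_zl_pos
  exact intervalIntegral.integral_pos one_lt_two
    (continuous_zl.rpow_const fun _ => Or.inr hr).continuousOn
    (fun t _ => Real.rpow_nonneg (zl_nonneg t) r) ⟨t, ht, Real.rpow_pos_of_pos h r⟩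

/-- On the bounded range between 2 and the k-dependent threshold, the integral is at least its
positive part over [1, 2]. Shrinking the constant removes the dependence of the threshold on k. -/
theorem exists_le_integral_zl {k : ℝ} (hk : 0 < k) : ∃ c : ℝ, 0 < c ∧ ∀ T : ℝ, 2 ≤ T →
    c * (T * Real.log T ^ (k ^ 2 + 2 * k)) ≤ ∫ t in (1 : ℝ)..T, zl t ^ (2 * k) := by
  obtain ⟨c, T₁, hc, hT₁, h⟩ := exists_eventually_le_integral_zl hk
  have hI := integral_zl_one_two_pos (by positivity : 0 ≤ 2 * k)
  set I := ∫ t in (1 : ℝ)..2, zl t ^ (2 * k) with hIdef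
  have hlog : 0 < Real.log T₁ := Real.log_pos (by linarith)
  set M := T₁ * Real.log T₁ ^ (k ^ 2 + 2 * k) with hM
  have hM0 : 0 < M := by positivity
  refine ⟨min c (I / M), lt_min hc (by positivity), fun T hT => ?_⟩
  have hlogT : 0 < Real.log T := Real.log_pos (by linarith)
  have hpos : 0 ≤ T * Real.log T ^ (k ^ 2 + 2 * k) := by positivity
  rcases le_total T₁ T with hle | hle
  · exact (mul_le_mul_of_nonneg_right (min_le_left _ _) hpos).trans (h T hle)
  · have hfc : Continuous fun t => zl t ^ (2 * k) :=
      continuous_zl.rpow_const fun _ => Or.inr (by positivity)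
    calc _ ≤ I / M * M := by
          refine mul_le_mul (min_le_right _ _) ?_ hpos (by positivity)
          rw [hM]
          gcongr
      _ = I := div_mul_cancel₀ _ hM0.ne'
      _ ≤ _ := by
          refine intervalIntegral.integral_mono_interval le_rfl (by norm_num) hT
            (Filter.Eventually.of_forall fun t => Real.rpow_nonneg (zl_nonneg t) _)
            (hfc.intervalIntegrable _ _)

end ZetaMoments

theorem theorem1p1 :
    ∃ T₀ : ℝ, ∀ k : ℝ, 0 ≤ k → ∃ c : ℝ, 0 < c ∧ ∀ T : ℝ, T₀ ≤ T →
      c * (T * Real.log T ^ (k ^ 2 + 2 * k)) ≤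
        ∫ t in (1 : ℝ)..T, ‖deriv riemannZeta (1 / 2 + (t : ℂ) * Complex.I)‖ ^ (2 * k) := by
  refine ⟨2, fun k hk => ?_⟩
  rcases hk.eq_or_lt with rfl | hk
  -- For k = 0 the integrand is 1, zeros included since `0 ^ 0 = 1`, and T - 1 ≥ T/2 for T ≥ 2.
  · refine ⟨1 / 2, by norm_num, fun T hT => ?_⟩
    simp
    linarith
  · exact ZetaMoments.exists_le_integral_zl hk
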